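/- Let $D,T,N\ge 1$, $\mathsf X=\mathbb R^D$, $\delta_1,\dots,\delta_T>0$ and $\kappa\in\{0,1\}$. For $t=1,\dots,T$ let $m_t\in\mathsf X$, let $(C_{t,k})_{k}$ be a sequence of symmetric positive definite $D\times D$ matrices, and let $G_t:\mathsf X\to(0,\infty)$ be differentiable such that - (A1) $G_t$ is bounded (and $m_t$, $C_{t,k}$, $G_t$ do not depend on the state at time $t-1$); - (A2) there are $C_0,C_1\ge 0$ with $\kappa\|\nabla\log G_t(x)\|_2\le C_0+C_1\|x\|_2$ for all $x\in\mathsf X$; - (A3) $\int_{\mathsf X} x_d^2\,G_t(x)\,\mathrm dx<\infty$ for every coordinate $d$. Write $N(\cdot;m,S)$ for the Gaussian density, $M_{t,k}=N(\cdot;m_t,C_{t,k})$, $Q_{t,k}=M_{t,k}G_t$, and let $\pi_{T,k}$ be the probability measure on $\mathsf X^T$ with density proportional to $\prod_{t=1}^T Q_{t,k}(x_t)$. **Algorithms.** Drop the index $k$. Each algorithm is given by a shift $\phi_t$, a proposal density $M'_t(\cdot\,;u)$, unnormalised weights $w_t^n$, and backward functions $b_{t}(\cdot\,;u)$. Given a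 reference path $x_{1:T}$, for $t=1,\dots,T$: draw $k_t$ uniformly on $\{0,\dots,N\}$ and set $x_t^{k_t}=x_t$; if $t>1$, set $a_{t-1}^{k_t}=k_{t-1}$ and draw the other ancestor indices $a_{t-1}^n$ independently from $W_{t-1}^{0:N}$; draw $u_t\sim N(x_t+\phi_t(x_t),\tfrac{\delta_t}2 I)$ and, for $n\ne k_t$, independently $x_t^n\sim M'_t(\cdot\,;u_t)$; set $W_t^n=w_t^n/\sum_m w_t^m$. (Under A1 the proposals and weights do not depend on the ancestors.) Then draw $i\neq k_T$ with probability $W_T^i/(1-W_T^{k_T})$ and set $l_T=i$ with probability $1\wedge\frac{1-W_T^{k_T}}{1-W_T^i}$, otherwise $l_T=k_T$. For $t=T-1,\dots,1$ draw $l_t=i$ with probability proportional to $W_t^i\,b_{t+1}(x_{t+1}^{l_{t+1}};u_{t+1})$ (under A1, with probability $W_t^i$). The law of the output $(x_1^{l_1},\dots,x_T^{l_T})$ is $P(\cdot\mid x_{1:T})$. Let $\bar x_t=\frac1{N+1}\sum_n x_t^n$, $A_t=(C_t+\tfrac{\delta_t}2I)^{-1}C_t$, $\phi^Q_t=\kappa\tfrac{\delta_t}2\nabla\log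 Q_t$, $\phi^G_t=\kappa\tfrac{\delta_t}2\nabla\log G_t$. The four algorithms are: - *Particle-aMALA*: $\phi_t=\phi_t^Q$, $M'_t(x;u)=N(x;u,\tfrac{\delta_t}2I)$, $w_t^n=G'_t(x_t^n;u_t)$ with $G'_t(x;u)=Q_t(x)\,\dfrac{N(u;x+\phi^Q_t(x),\frac{\delta_t}2I)}{N(u;x,\frac{\delta_t}2I)}$, $b_t=M'_tG'_t$. - *Particle-MALA*: the same $\phi_t$, $M'_t$; $w_t^n=Q_t(x_t^n)\exp\bigl(\tfrac1{\delta_t}[2\phi^\top(\bar x_t-x_t^n)-\tfrac N{N+1}\phi^\top\phi]\bigr)$ with $\phi=\phi^Q_t(x_t^n)$; $b_t=Q_t$. - *Particle-aGRAD*: $\phi_t=\phi_t^G$, $M'_t(x;u)=N(x;m_t+A_t(u-m_t),\tfrac{\delta_t}2A_t)$, $w_t^n=G'_t(x_t^n;u_t)$ with $G'_t(x;u)=Q_t(x)\,\dfrac{N(u;x+\phi_t^G(x),\frac{\delta_t}2I)}{M'_t(x;u)}$, $b_t=M'_tG'_t$. - *Particle-mGRAD*: $\phi_t$, $M'_t$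 as for Particle-aGRAD; $w_t^n=Q_t(x_t^n)H_t^n$ where, with $v=(I-A_t)m_t$, $x=x_t^n$, $\phi=\phi_t^G(x)$ and $\mathbf G_t=\tfrac2{\delta_t}(I+NA_t)^{-1}$, $$\log H_t^n=\tfrac12(x-v)^\top\bigl((\tfrac{\delta_t}2A_t)^{-1}+\mathbf G_t\bigr)(x-v)-\bigl[\tfrac12N(x+\phi)^\top A_t+(x-v)^\top\bigr]\mathbf G_t(x+\phi)+(N+1)(\bar x_t-v)^\top\mathbf G_t(v+\phi);$$ $b_t=Q_t$. **Proposition.** Suppose there is a sequence $(\lambda_k)$ in $(0,\infty)$ with $\lambda_k\to\infty$ such that, for every $k$, all eigenvalues of $C_{1,k},\dots,C_{T,k}$ are at least $\lambda_k$. Then for every $\varepsilon>0$ there are measurable sets $F_{T,k}\subseteq\mathsf X^T$ with $\lim_{k\to\infty}\pi_{T,k}(F_{T,k})=1$ such that, as $k\to\infty$, 1. $\displaystyle\sup_{x_{1:T}\in F_{T,k}}\bigl\|P_{\text{Particle-mGRAD},k}(\cdot\mid x_{1:T})-P_{\text{Particle-MALA},k}(\cdot\mid x_{1:T})\bigr\|_{\mathrm{TV}}=O\bigl(\lambda_k^{-(1-\varepsilon)/4}\bigr)$;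 2. $\displaystyle\sup_{x_{1:T}\in F_{T,k}}\bigl\|P_{\text{Particle-aGRAD},k}(\cdot\mid x_{1:T})-P_{\text{Particle-aMALA},k}(\cdot\mid x_{1:T})\bigr\|_{\mathrm{TV}}=O\bigl(\lambda_k^{-(1-\varepsilon)/4}\bigr)$. -/

import Mathlib

open MeasureTheory ProbabilityTheory Filter Topology
open scoped ENNReal Matrix

noncomputable section

namespace ParticleMCMC

/-- The state space `ℝ^D` with its Euclidean norm. -/
abbrev St (D : ℕ) : Type := EuclideanSpace ℝ (Fin D)

/-- A square matrix acting on a vector. -/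
def act {D : ℕ} (M : Matrix (Fin D) (Fin D) ℝ) (x : St D) : St D :=
  Matrix.toEuclideanCLM (𝕜 := ℝ) M x

/-- The density `N(x; m, S)` of the Gaussian law with mean `m` and non-singular covariance `S`. -/
def gaussDensity {D : ℕ} (m : St D) (S : Matrix (Fin D) (Fin D) ℝ) (x : St D) : ℝ :=
  (Real.sqrt ((2 * Real.pi) ^ D * S.det))⁻¹ *
    Real.exp (-(1 / 2) * inner ℝ (x - m) (act S⁻¹ (x - m)))

/-- The arithmetic mean of `N + 1` vectors. -/
def average {D N : ℕ} (y : Fin (N + 1) → St D) : St D :=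
  ((N : ℝ) + 1)⁻¹ • ∑ n, y n

/-! ### Feynman--Kac models with Gaussian mutation kernels -/

/-- A Feynman--Kac model on `T` time steps: the mutation kernels are `N(m_t(x_{t-1}), C_t)` and the
potentials are `G_t(x_{t-1}, x_t)`. The previous state is an argument at every time step; at the
first time step, where there is no previous state, the dummy value `0` is always inserted. -/
structure Model (D T : ℕ) where
  m : Fin T → St D → St D
  C : Fin T → Matrix (Fin D) (Fin D) ℝ
  G : Fin T → St D → St D → ℝ

namespace Model

variable {D T : ℕ} (F : Model D T)

/-- The mutation density `M_t(x | x_{t-1})`. -/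
def M (t : Fin T) (xp x : St D) : ℝ := gaussDensity (F.m t xp) (F.C t) x

/-- `Q_t(x_{t-1}, x) = M_t(x | x_{t-1}) G_t(x_{t-1}, x)`. -/
def Q (t : Fin T) (xp x : St D) : ℝ := F.M t xp x * F.G t xp x

/-- `∇_x log Q_t(x_{t-1}, x)`. -/
def gradLogQ (t : Fin T) (xp x : St D) : St D := gradient (fun y => Real.log (F.Q t xp y)) x

/-- `∇_x log G_t(x_{t-1}, x)`. -/
def gradLogG (t : Fin T) (xp x : St D) : St D := gradient (fun y => Real.log (F.G t xp y)) x

/-- The unnormalised target `∏_t Q_t(x_{t-1}, x_t) dx_{1:T}` on the path space. -/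
def unnormalisedTarget : Measure (Fin T → St D) :=
  volume.withDensity fun x => ENNReal.ofReal (∏ t : Fin T,
    F.Q t (if h : (t : ℕ) = 0 then 0 else x ⟨(t : ℕ) - 1, by omega⟩) (x t))

/-- The joint smoothing distribution `π_T`. -/
def target : Measure (Fin T → St D) :=
  (F.unnormalisedTarget Set.univ)⁻¹ • F.unnormalisedTarget

/-- The model which factorises over time: `m_t`, `C_t`, `G_t` are constant in the previous state. -/
def factorised (m : Fin T → St D) (C : Fin T → Matrix (Fin D) (Fin D) ℝ)
    (G : Fin T → St D → ℝ) : Model D T where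
  m t _ := m t
  C := C
  G t _ x := G t x

end Model

/-! ### Conditional sequential Monte Carlo with auxiliary variables -/

/-- The ingredients of one time step of a conditional SMC algorithm with `N + 1` particles:
* `auxLaw x_{t-1} x_t`: the law of the auxiliary variable `u_t` given the reference path;
* `proposal z u`: the law of a non-reference particle with ancestor state `z` given `u_t = u`;
* `weight z y u n`: the unnormalised weight of the `n`th of the particles `y` whose ancestor
  states are `z`, given `u_t = u`;
* `backward z x u`: the function of `(x_{t-1}, x_t) = (z, x)` used in the backward kernel that
  selects the particle at time `t - 1`. -/
structure Step (D N : ℕ) where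
  auxLaw : St D → St D → Measure (St D)
  proposal : St D → St D → Measure (St D)
  weight : (Fin (N + 1) → St D) → (Fin (N + 1) → St D) → St D → Fin (N + 1) → ℝ
  backward : St D → St D → St D → ℝ

/-- Normalisation of weights. -/
def normalise {N : ℕ} (w : Fin (N + 1) → ℝ) (n : Fin (N + 1)) : ℝ := w n / ∑ i, w i

/-- Probability that the ancestor indices are `a`: the reference particle `k'` has ancestor `k`;
the other ancestors are drawn independently from the normalised weights `W`. -/
def ancestorProb {N : ℕ} (W : Fin (N + 1) → ℝ) (k k' : Fin (N + 1))
    (a : Fin (N + 1) → Fin (N + 1)) : ℝ :=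
  if a k' = k then ∏ n ∈ Finset.univ.erase k', W (a n) else 0

/-- Probability that the forced-move step at the final time selects `l` when the reference
particle is `k`: propose `i ≠ k` with probability `W i / (1 - W k)`, accept it with probability
`1 ∧ (1 - W k) / (1 - W i)`, and otherwise select `k`. -/
def forcedMoveProb {N : ℕ} (W : Fin (N + 1) → ℝ) (k l : Fin (N + 1)) : ℝ :=
  if l = k then
    1 - ∑ i ∈ Finset.univ.erase k, W i / (1 - W k) * min 1 ((1 - W k) / (1 - W i))
  else W l / (1 - W k) * min 1 ((1 - W k) / (1 - W l))

/-- Joint law of the `N + 1` particles given `u`: the `k`th is the reference state `x`, the others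
are independent draws from the proposals given their ancestor states `z`. -/
def Step.particleLaw {D N : ℕ} (s : Step D N) (x : St D) (k : Fin (N + 1))
    (z : Fin (N + 1) → St D) (u : St D) : Measure (Fin (N + 1) → St D) :=
  Measure.pi fun n => if n = k then Measure.dirac x else s.proposal (z n) u

/-- The normalised weights `W_t^{0:N}`. -/
def Step.W {D N : ℕ} (s : Step D N) (z y : Fin (N + 1) → St D) (u : St D) :
    Fin (N + 1) → ℝ :=
  normalise (s.weight z y u)

/-- Resampling between two time steps: the position `k'` of the next reference particle is uniform,
the ancestor indices `a` are drawn from the normalised weights, and the algorithm continues with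
the law `next k' z'`, where `z'` are the ancestor states of the next particles. -/
def Step.resample {D N : ℕ} {β : Type*} [MeasurableSpace β] (s : Step D N) (k : Fin (N + 1))
    (z y : Fin (N + 1) → St D) (u : St D)
    (next : Fin (N + 1) → (Fin (N + 1) → St D) → Measure β) : Measure β :=
  ∑ k' : Fin (N + 1), ((N : ℝ≥0∞) + 1)⁻¹ •
    ∑ a : Fin (N + 1) → Fin (N + 1), ENNReal.ofReal (ancestorProb (s.W z y u) k k' a) •
      next k' (fun n => y (a n))

/-- Selection of the returned state at the final time step by the forced move. -/
def Step.finalMove {D N : ℕ} (s : Step D N) (k : Fin (N + 1)) (z : Fin (N + 1) → St D) (u : St D)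
    (y : Fin (N + 1) → St D) : Measure (St D × (Fin 1 → St D)) :=
  ∑ l, ENNReal.ofReal (forcedMoveProb (s.W z y u) k l) • Measure.dirac (u, fun _ => y l)

/-- Backward sampling at a time step `s` followed by the time step `s'`, when `p` consists of
the auxiliary variable of `s'` and of the path returned from `s'` on. -/
def Step.backwardMove {D N T : ℕ} (s s' : Step D N) (z y : Fin (N + 1) → St D) (u : St D)
    (p : St D × (Fin (T + 1) → St D)) : Measure (St D × (Fin (T + 2) → St D)) :=
  ∑ l, ENNReal.ofReal
      (normalise (fun i => s.W z y u i * s'.backward (y i) (p.2 0) p.1) l) •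
    Measure.dirac (u, (Fin.cons (y l) p.2 : Fin (T + 2) → St D))

/-- The part of the algorithm from the current time step on. The arguments are the remaining time
steps, the remaining reference path, the previous reference state `xp`, the position `k` of the
reference particle, and the ancestor states `z` of the current particles. The result is the
joint law of the current auxiliary variable and of the returned path from the current time on. -/
def forward {D N : ℕ} : (T : ℕ) → (Fin T → Step D N) → (Fin T → St D) → St D → Fin (N + 1) →
    (Fin (N + 1) → St D) → Measure (St D × (Fin T → St D))
  | 0, _, _, _, _, _ => Measure.dirac (0, Fin.elim0)
  | 1, s, x, xp, k, z =>
      ((s 0).auxLaw xp (x 0)).bind fun u =>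
      ((s 0).particleLaw (x 0) k z u).bind fun y =>
        (s 0).finalMove k z u y
  | T + 2, s, x, xp, k, z =>
      ((s 0).auxLaw xp (x 0)).bind fun u =>
      ((s 0).particleLaw (x 0) k z u).bind fun y =>
        (s 0).resample k z y u fun k' z' =>
          (forward (T + 1) (fun t => s t.succ) (fun t => x t.succ) (x 0) k' z').bind
            ((s 0).backwardMove (s 1) z y u)

/-- The law `P(· | x_{1:T})` of the path returned by the algorithm with the given time steps. At
the first time step the ancestor states are the dummy value `0`. -/
def kernel {D N T : ℕ} (s : Fin T → Step D N) (x : Fin T → St D) : Measure (Fin T → St D) :=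
  (∑ k : Fin (N + 1), ((N : ℝ≥0∞) + 1)⁻¹ • forward T s x 0 k (fun _ => 0)).map Prod.snd

/-! ### Particle-aMALA, Particle-MALA, Particle-aGRAD, Particle-mGRAD -/

section Algorithms

variable {D T : ℕ} (N : ℕ) (F : Model D T) (δ : Fin T → ℝ) (κ : ℝ)

/-- `φ_t(x_{t-1}, x) = κ (δ_t / 2) ∇_x log Q_t(x_{t-1}, x)`. -/
def malaShift (t : Fin T) (xp x : St D) : St D := (κ * (δ t / 2)) • F.gradLogQ t xp x

/-- `φ_t(x_{t-1}, x) = κ (δ_t / 2) ∇_x log G_t(x_{t-1}, x)`. -/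
def gradShift (t : Fin T) (xp x : St D) : St D := (κ * (δ t / 2)) • F.gradLogG t xp x

/-- The isotropic covariance `(δ_t / 2) I`. -/
def isoCov (t : Fin T) : Matrix (Fin D) (Fin D) ℝ := (δ t / 2) • 1

/-- The modified potential `G'_t(x_{t-1}, x; u)` of Particle-aMALA. -/
def amalaPotential (t : Fin T) (xp x u : St D) : ℝ :=
  F.Q t xp x * (gaussDensity (x + malaShift F δ κ t xp x) (isoCov δ t) u /
    gaussDensity x (isoCov δ t) u)

/-- Particle-aMALA. -/
def amalaStep (t : Fin T) : Step D N where
  auxLaw xp x := multivariateGaussian (x + malaShift F δ κ t xp x) (isoCov δ t)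
  proposal _ u := multivariateGaussian u (isoCov δ t)
  weight z y u n := amalaPotential F δ κ t (z n) (y n) u
  backward z x u := gaussDensity u (isoCov δ t) x * amalaPotential F δ κ t z x u

/-- The factor `H_{t,φ}(x, x̄)` in the weights of Particle-MALA. -/
def malaFactor (t : Fin T) (φ x xbar : St D) : ℝ :=
  Real.exp ((1 / δ t) *
    (2 * inner ℝ φ (xbar - x) - (N : ℝ) / ((N : ℝ) + 1) * inner ℝ φ φ))

/-- Particle-MALA. -/
def malaStep (t : Fin T) : Step D N where
  auxLaw xp x := multivariateGaussian (x + malaShift F δ κ t xp x) (isoCov δ t)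
  proposal _ u := multivariateGaussian u (isoCov δ t)
  weight z y _ n := F.Q t (z n) (y n) *
    malaFactor N δ t (malaShift F δ κ t (z n) (y n)) (y n) (average y)
  backward z x _ := F.Q t z x

/-- `A_t = (C_t + (δ_t / 2) I)⁻¹ C_t`. -/
def matA (t : Fin T) : Matrix (Fin D) (Fin D) ℝ := (F.C t + isoCov δ t)⁻¹ * F.C t

/-- The mean of `M'_t(· | x_{t-1}; u)`, i.e. `m_t(x_{t-1}) + A_t (u - m_t(x_{t-1}))`. -/
def agradMean (t : Fin T) (xp u : St D) : St D :=
  F.m t xp + act (matA F δ t) (u - F.m t xp)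

/-- The covariance of `M'_t(· | x_{t-1}; u)`, i.e. `(I - A_t) C_t = (δ_t / 2) A_t`. -/
def agradCov (t : Fin T) : Matrix (Fin D) (Fin D) ℝ := (δ t / 2) • matA F δ t

/-- The modified potential `G'_t(x_{t-1}, x; u)` of Particle-aGRAD. -/
def agradPotential (t : Fin T) (xp x u : St D) : ℝ :=
  F.Q t xp x * (gaussDensity (x + gradShift F δ κ t xp x) (isoCov δ t) u /
    gaussDensity (agradMean F δ t xp u) (agradCov F δ t) x)

/-- Particle-aGRAD. -/
def agradStep (t : Fin T) : Step D N where
  auxLaw xp x := multivariateGaussian (x + gradShift F δ κ t xp x) (isoCov δ t)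
  proposal z u := multivariateGaussian (agradMean F δ t z u) (agradCov F δ t)
  weight z y u n := agradPotential F δ κ t (z n) (y n) u
  backward z x u := gaussDensity (agradMean F δ t z u) (agradCov F δ t) x *
    agradPotential F δ κ t z x u

/-- The matrix `(2 / δ_t) (I + N A_t)⁻¹`. -/
def matG (t : Fin T) : Matrix (Fin D) (Fin D) ℝ :=
  (2 / δ t) • (1 + (N : ℝ) • matA F δ t)⁻¹

/-- The factor `H_{t,φ}(x, v, x̄, v̄)` in the weights of Particle-mGRAD. -/
def mgradFactor (t : Fin T) (φ x v xbar vbar : St D) : ℝ :=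
  Real.exp
    ((1 / 2) * inner ℝ (x - v) (act ((agradCov F δ t)⁻¹ + matG N F δ t) (x - v))
      - ((1 / 2) * (N : ℝ) * inner ℝ (x + φ) (act (matA F δ t * matG N F δ t) (x + φ))
          + inner ℝ (x - v) (act (matG N F δ t) (x + φ)))
      + ((N : ℝ) + 1) * inner ℝ (xbar - vbar) (act (matG N F δ t) (v + φ)))

/-- `v = (I - A_t) m_t(x_{t-1})`. -/
def mgradV (t : Fin T) (xp : St D) : St D := act (1 - matA F δ t) (F.m t xp)

/-- Particle-mGRAD. -/
def mgradStep (t : Fin T) : Step D N where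
  auxLaw xp x := multivariateGaussian (x + gradShift F δ κ t xp x) (isoCov δ t)
  proposal z u := multivariateGaussian (agradMean F δ t z u) (agradCov F δ t)
  weight z y _ n := F.Q t (z n) (y n) *
    mgradFactor N F δ t (gradShift F δ κ t (z n) (y n)) (y n) (mgradV F δ t (z n))
      (average y) (average fun i => mgradV F δ t (z i))
  backward z x _ := F.Q t z x

/-- The Markov kernel of Particle-aMALA. -/
def kernelAMALA : (Fin T → St D) → Measure (Fin T → St D) := kernel (amalaStep N F δ κ)

/-- The Markov kernel of Particle-MALA. -/
def kernelMALA : (Fin T → St D) → Measure (Fin T → St D) := kernel (malaStep N F δ κ)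

/-- The Markov kernel of Particle-aGRAD. -/
def kernelAGRAD : (Fin T → St D) → Measure (Fin T → St D) := kernel (agradStep N F δ κ)

/-- The Markov kernel of Particle-mGRAD. -/
def kernelMGRAD : (Fin T → St D) → Measure (Fin T → St D) := kernel (mgradStep N F δ κ)

end Algorithms

/-- Total variation distance of two finite measures. -/
def tvDist {α : Type*} [MeasurableSpace α] (μ ν : Measure α) : ℝ≥0∞ :=
  ⨆ (A : Set α) (_ : MeasurableSet A), ENNReal.ofReal |μ.real A - ν.real A|


/-! ### Well-definedness

All measures above that are built with `Measure.bind` are probability measures: the functions which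
are integrated are measurable and the discrete probabilities are non-negative and sum to one. -/

theorem measurable_bind_param {α β γ : Type*} [MeasurableSpace α] [MeasurableSpace β]
    [MeasurableSpace γ] {μ : α → Measure β} (hμ : Measurable μ)
    (hp : ∀ a, IsProbabilityMeasure (μ a)) {f : α → β → Measure γ}
    (hf : Measurable (Function.uncurry f)) : Measurable fun a => (μ a).bind (f a) := by
  refine Measure.measurable_of_measurable_coe _ fun s hs => ?_
  have h1 : ∀ a, Measurable (f a) := fun a => hf.comp measurable_prodMk_left
  simp_rw [fun a => Measure.bind_apply (m := μ a) hs (h1 a).aemeasurable]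
  let K : Kernel α β := ⟨μ, hμ⟩
  have : IsMarkovKernel K := ⟨hp⟩
  exact Measurable.lintegral_kernel_prod_right (κ := K)
    (f := fun a b => f a b s) ((Measure.measurable_coe hs).comp hf)

theorem isProb_bind {β γ : Type*} [MeasurableSpace β]
    [MeasurableSpace γ] {μ : Measure β} (hp : IsProbabilityMeasure μ) {f : β → Measure γ}
    (hf : Measurable f) (hfp : ∀ b, IsProbabilityMeasure (f b)) :
    IsProbabilityMeasure (μ.bind f) := by
  constructor
  rw [Measure.bind_apply MeasurableSet.univ hf.aemeasurable]
  simp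

theorem isProb_sum {ι γ : Type*} [Fintype ι] [MeasurableSpace γ] {c : ι → ℝ≥0∞}
    (hc : ∑ i, c i = 1) {μ : ι → Measure γ} (hμ : ∀ i, IsProbabilityMeasure (μ i)) :
    IsProbabilityMeasure (∑ i, c i • μ i) := by
  constructor
  simp [hc]

theorem measurable_sum_smul {ι α γ : Type*} [Fintype ι] [MeasurableSpace α] [MeasurableSpace γ]
    {c : ι → α → ℝ≥0∞} (hc : ∀ i, Measurable (c i)) {μ : ι → α → Measure γ}
    (hμ : ∀ i, Measurable (μ i)) : Measurable fun a => ∑ i, c i a • μ i a := by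
  refine Measure.measurable_of_measurable_coe _ fun s hs => ?_
  simp only [Measure.coe_finsetSum, Finset.sum_apply, Measure.smul_apply, smul_eq_mul]
  exact Finset.measurable_fun_sum _ fun i _ => (hc i).mul ((Measure.measurable_coe hs).comp (hμ i))

theorem sum_ofReal_one {ι : Type*} [Fintype ι] {p : ι → ℝ} (h0 : ∀ i, 0 ≤ p i)
    (h1 : ∑ i, p i = 1) : ∑ i, ENNReal.ofReal (p i) = 1 := by
  rw [← ENNReal.ofReal_sum_of_nonneg fun i _ => h0 i, h1, ENNReal.ofReal_one]

theorem normalise_pos {N : ℕ} {w : Fin (N + 1) → ℝ} (hw : ∀ n, 0 < w n) (n) :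
    0 < normalise w n :=
  div_pos (hw n) (Finset.sum_pos (fun i _ => hw i) Finset.univ_nonempty)

theorem sum_normalise {N : ℕ} {w : Fin (N + 1) → ℝ} (hw : ∀ n, 0 < w n) :
    ∑ n, normalise w n = 1 := by
  have : 0 < ∑ i, w i := Finset.sum_pos (fun i _ => hw i) Finset.univ_nonempty
  simp only [normalise, ← Finset.sum_div]
  exact div_self this.ne'

theorem ancestorProb_nonneg {N : ℕ} {W : Fin (N + 1) → ℝ} (hW : ∀ n, 0 < W n) (k k' a) :
    0 ≤ ancestorProb W k k' a := by
  unfold ancestorProb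
  split_ifs
  · exact Finset.prod_nonneg fun n _ => (hW _).le
  · exact le_rfl

theorem sum_ancestorProb {N : ℕ} {W : Fin (N + 1) → ℝ} (h1 : ∑ n, W n = 1) (k k') :
    ∑ a, ancestorProb W k k' a = 1 := by
  have h : ∀ a, ancestorProb W k k' a =
      ∏ n, (if n = k' then (if a n = k then (1 : ℝ) else 0) else W (a n)) := by
    intro a
    rw [← Finset.mul_prod_erase _ _ (Finset.mem_univ k'), if_pos rfl, ancestorProb]
    rw [Finset.prod_congr rfl (fun n hn => if_neg (Finset.ne_of_mem_erase hn))]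
    split_ifs <;> simp
  simp_rw [h]
  have := (Finset.prod_univ_sum (fun _ : Fin (N+1) => (Finset.univ : Finset (Fin (N + 1))))
    (fun n i => (if n = k' then (if i = k then (1 : ℝ) else 0) else W i))).symm
  rw [Fintype.piFinset_univ] at this
  rw [this]
  apply Finset.prod_eq_one
  intro n _
  split_ifs
  · simp
  · exact h1

theorem forcedMoveProb_nonneg {N : ℕ} {W : Fin (N + 1) → ℝ} (hN : 1 ≤ N) (hW : ∀ n, 0 < W n)
    (h1 : ∑ n, W n = 1) (k l) : 0 ≤ forcedMoveProb W k l := by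
  have hlt : ∀ i, W i < 1 := by
    intro i
    obtain ⟨j, hj⟩ : ∃ j : Fin (N + 1), j ≠ i := by
      have : Nontrivial (Fin (N + 1)) := Fin.nontrivial_iff_two_le.2 (by omega)
      exact exists_ne i
    have := Finset.add_le_sum (s := Finset.univ) (f := W) (fun i _ => (hW i).le)
      (Finset.mem_univ i) (Finset.mem_univ j) hj.symm
    linarith [hW j]
  have hk := hlt k
  unfold forcedMoveProb
  split_ifs with h
  · have hs : ∑ i ∈ Finset.univ.erase k, W i / (1 - W k) = 1 := by
      rw [← Finset.sum_div, div_eq_one_iff_eq (by linarith)]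
      have := Finset.add_sum_erase Finset.univ W (Finset.mem_univ k)
      linarith
    have : ∑ i ∈ Finset.univ.erase k, W i / (1 - W k) * min 1 ((1 - W k) / (1 - W i)) ≤
        ∑ i ∈ Finset.univ.erase k, W i / (1 - W k) :=
      Finset.sum_le_sum fun i _ => mul_le_of_le_one_right
        (div_nonneg (hW i).le (by linarith)) (min_le_left _ _)
    linarith
  · exact mul_nonneg (div_nonneg (hW _).le (by linarith)) (le_min zero_le_one
      (div_nonneg (by linarith) (by linarith [hlt l])))

theorem sum_forcedMoveProb {N : ℕ} (W : Fin (N + 1) → ℝ) (k) :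
    ∑ l, forcedMoveProb W k l = 1 := by
  rw [← Finset.add_sum_erase _ _ (Finset.mem_univ k), Finset.sum_congr rfl
    (g := fun i => W i / (1 - W k) * min 1 ((1 - W k) / (1 - W i)))
    (fun l hl => by rw [forcedMoveProb, if_neg (Finset.ne_of_mem_erase hl)])]
  simp [forcedMoveProb]

/-- Regularity of the ingredients of a time step that makes the algorithm well defined. -/
structure Step.Regular {D N : ℕ} (s : Step D N) : Prop where
  aux : ∀ xp x, IsProbabilityMeasure (s.auxLaw xp x)
  prop : ∀ z u, IsProbabilityMeasure (s.proposal z u)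
  prop_meas : Measurable (Function.uncurry s.proposal)
  weight_pos : ∀ z y u n, 0 < s.weight z y u n
  weight_meas : ∀ n, Measurable fun p : (Fin (N + 1) → St D) × (Fin (N + 1) → St D) × St D =>
    s.weight p.1 p.2.1 p.2.2 n
  back_pos : ∀ z x u, 0 < s.backward z x u
  back_meas : Measurable fun p : St D × St D × St D => s.backward p.1 p.2.1 p.2.2

theorem Step.Regular.isProb_particleLaw {D N : ℕ} {s : Step D N} (hs : s.Regular) (x k z u) :
    IsProbabilityMeasure (s.particleLaw x k z u) := by
  have : ∀ n, IsProbabilityMeasure (if n = k then Measure.dirac x else s.proposal (z n) u) := by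
    intro n
    split_ifs
    · infer_instance
    · exact hs.prop _ _
  unfold Step.particleLaw
  infer_instance

theorem Step.Regular.measurable_particleLaw {D N : ℕ} {s : Step D N} (hs : s.Regular) (x k) :
    Measurable fun p : (Fin (N + 1) → St D) × St D => s.particleLaw x k p.1 p.2 := by
  have := fun p : (Fin (N + 1) → St D) × St D => hs.isProb_particleLaw x k p.1 p.2
  refine Measurable.measure_of_isPiSystem_of_isProbabilityMeasure
    generateFrom_pi.symm isPiSystem_pi ?_
  rintro _ ⟨A, hA, rfl⟩
  have hp : ∀ (p : (Fin (N + 1) → St D) × St D) n,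
      IsProbabilityMeasure (if n = k then Measure.dirac x else s.proposal (p.1 n) p.2) := by
    intro p n
    split_ifs
    · infer_instance
    · exact hs.prop _ _
  simp only [Step.particleLaw, Measure.pi_pi]
  refine Finset.measurable_fun_prod _ fun n _ => ?_
  have hAn : MeasurableSet (A n) := hA n (Set.mem_univ n)
  by_cases h : n = k
  · simp only [h, if_true]; exact measurable_const
  · simp only [h, if_false]
    have : Measurable fun p : (Fin (N + 1) → St D) × St D => (p.1 n, p.2) := by fun_prop
    exact (Measure.measurable_coe hAn).comp (hs.prop_meas.comp this)

theorem Step.Regular.W_pos {D N : ℕ} {s : Step D N} (hs : s.Regular) (z y u n) :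
    0 < s.W z y u n := normalise_pos (hs.weight_pos z y u) n

theorem Step.Regular.sum_W {D N : ℕ} {s : Step D N} (hs : s.Regular) (z y u) :
    ∑ n, s.W z y u n = 1 := sum_normalise (hs.weight_pos z y u)

theorem Step.Regular.measurable_W {D N : ℕ} {s : Step D N} (hs : s.Regular) (n) :
    Measurable fun p : (Fin (N + 1) → St D) × (Fin (N + 1) → St D) × St D =>
      s.W p.1 p.2.1 p.2.2 n := by
  unfold Step.W normalise
  exact (hs.weight_meas n).div (Finset.measurable_fun_sum _ fun i _ => hs.weight_meas i)

theorem measurable_forcedMoveProb {N : ℕ} {α : Type*} [MeasurableSpace α]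
    {W : α → Fin (N + 1) → ℝ} (hW : ∀ n, Measurable fun a => W a n) (k l) :
    Measurable fun a => forcedMoveProb (W a) k l := by
  unfold forcedMoveProb
  split_ifs <;> fun_prop

theorem measurable_ancestorProb {N : ℕ} {α : Type*} [MeasurableSpace α]
    {W : α → Fin (N + 1) → ℝ} (hW : ∀ n, Measurable fun a => W a n) (k k' b) :
    Measurable fun a => ancestorProb (W a) k k' b := by
  unfold ancestorProb
  split_ifs <;> fun_prop

theorem inv_sum_one (N : ℕ) : ∑ _k : Fin (N + 1), ((N : ℝ≥0∞) + 1)⁻¹ = 1 := by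
  rw [Finset.sum_const, Finset.card_univ, Fintype.card_fin, nsmul_eq_mul]
  push_cast
  exact ENNReal.mul_inv_cancel (by simp) (by simp)

theorem Step.Regular.finalMove {D N : ℕ} (hN : 1 ≤ N) {s : Step D N} (hs : s.Regular) (k) :
    (∀ z u y, IsProbabilityMeasure (s.finalMove k z u y)) ∧
    Measurable fun p : ((Fin (N + 1) → St D) × St D) × (Fin (N + 1) → St D) =>
      s.finalMove k p.1.1 p.1.2 p.2 := by
  constructor
  · intro z u y
    exact isProb_sum (sum_ofReal_one
      (forcedMoveProb_nonneg hN (hs.W_pos z y u) (hs.sum_W z y u) k)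
      (sum_forcedMoveProb _ _)) fun l => inferInstance
  · refine measurable_sum_smul (fun l => ENNReal.measurable_ofReal.comp
      (measurable_forcedMoveProb (fun n => ?_) k l)) fun l => ?_
    · exact (hs.measurable_W n).comp (by fun_prop :
        Measurable fun p : ((Fin (N + 1) → St D) × St D) × (Fin (N + 1) → St D) =>
          (p.1.1, p.2, p.1.2))
    · exact Measure.measurable_dirac.comp (by fun_prop)

theorem Step.Regular.backwardMove {D N T : ℕ} {s s' : Step D N} (hs : s.Regular)
    (hs' : s'.Regular) :
    (∀ z y u (p : St D × (Fin (T + 1) → St D)),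
      IsProbabilityMeasure (s.backwardMove s' z y u p)) ∧
    Measurable fun q : (((Fin (N + 1) → St D) × St D) × (Fin (N + 1) → St D)) ×
      (St D × (Fin (T + 1) → St D)) => s.backwardMove s' q.1.1.1 q.1.2 q.1.1.2 q.2 := by
  constructor
  · intro z y u p
    have hpos : ∀ i, 0 < s.W z y u i * s'.backward (y i) (p.2 0) p.1 := fun i =>
      mul_pos (hs.W_pos _ _ _ _) (hs'.back_pos _ _ _)
    exact isProb_sum (sum_ofReal_one (fun l => (normalise_pos hpos l).le)
      (sum_normalise hpos)) fun l => inferInstance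
  · refine measurable_sum_smul (fun l => ENNReal.measurable_ofReal.comp ?_) fun l => ?_
    · have : ∀ i, Measurable fun q : (((Fin (N + 1) → St D) × St D) × (Fin (N + 1) → St D)) ×
          (St D × (Fin (T + 1) → St D)) =>
          s.W q.1.1.1 q.1.2 q.1.1.2 i * s'.backward (q.1.2 i) (q.2.2 0) q.2.1 := by
        intro i
        refine Measurable.mul ?_ ?_
        · exact (hs.measurable_W i).comp (by fun_prop : Measurable
            fun q : (((Fin (N + 1) → St D) × St D) × (Fin (N + 1) → St D)) ×
              (St D × (Fin (T + 1) → St D)) => (q.1.1.1, q.1.2, q.1.1.2))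
        · exact hs'.back_meas.comp (by fun_prop : Measurable
            fun q : (((Fin (N + 1) → St D) × St D) × (Fin (N + 1) → St D)) ×
              (St D × (Fin (T + 1) → St D)) => (q.1.2 i, q.2.2 0, q.2.1))
      exact (this l).div (Finset.measurable_fun_sum _ fun i _ => this i)
    · refine Measure.measurable_dirac.comp (Measurable.prodMk (by fun_prop) ?_)
      refine measurable_pi_lambda _ fun t => ?_
      refine Fin.cases ?_ (fun j => ?_) t
      · simp only [Fin.cons_zero]; fun_prop
      · simp only [Fin.cons_succ]; fun_prop

theorem Step.Regular.resample {D N : ℕ} {β : Type*} [MeasurableSpace β] {s : Step D N}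
    (hs : s.Regular) (k)
    (f : ((Fin (N + 1) → St D) × St D) × (Fin (N + 1) → St D) → Fin (N + 1) →
      (Fin (N + 1) → St D) → Measure β)
    (hp : ∀ q k' z', IsProbabilityMeasure (f q k' z'))
    (hm : ∀ k', Measurable (Function.uncurry fun q z' => f q k' z')) :
    (∀ z u y, IsProbabilityMeasure (s.resample k z y u (f ((z, u), y)))) ∧
    Measurable fun q : ((Fin (N + 1) → St D) × St D) × (Fin (N + 1) → St D) =>
      s.resample k q.1.1 q.2 q.1.2 (f q) := by
  constructor
  · intro z u y
    exact isProb_sum (inv_sum_one N) fun k' => isProb_sum (sum_ofReal_one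
      (ancestorProb_nonneg (hs.W_pos z y u) k k') (sum_ancestorProb (hs.sum_W z y u) k k'))
      fun a => hp _ _ _
  · refine measurable_sum_smul (fun _ => measurable_const) fun k' => ?_
    refine measurable_sum_smul (fun a => ENNReal.measurable_ofReal.comp
      (measurable_ancestorProb (fun n => ?_) k k' a)) fun a => ?_
    · exact (hs.measurable_W n).comp (by fun_prop : Measurable
        fun q : ((Fin (N + 1) → St D) × St D) × (Fin (N + 1) → St D) => (q.1.1, q.2, q.1.2))
    · exact (hm k').comp (by fun_prop : Measurable
        fun q : ((Fin (N + 1) → St D) × St D) × (Fin (N + 1) → St D) => (q, fun n => q.2 (a n)))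

theorem forward_step {D N : ℕ} {β : Type*} [MeasurableSpace β] {s : Step D N} (hs : s.Regular)
    (x xp : St D) (k : Fin (N + 1))
    (f : ((Fin (N + 1) → St D) × St D) × (Fin (N + 1) → St D) → Measure β)
    (hp : ∀ q, IsProbabilityMeasure (f q)) (hm : Measurable f) :
    (∀ z, IsProbabilityMeasure ((s.auxLaw xp x).bind fun u =>
      (s.particleLaw x k z u).bind fun y => f ((z, u), y))) ∧
    Measurable fun z => (s.auxLaw xp x).bind fun u =>
      (s.particleLaw x k z u).bind fun y => f ((z, u), y) := by
  have hb := measurable_bind_param (hs.measurable_particleLaw x k)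
    (fun p => hs.isProb_particleLaw x k p.1 p.2) (f := fun p y => f (p, y)) hm
  constructor
  · intro z
    refine isProb_bind (hs.aux _ _) (hb.comp measurable_prodMk_left) fun u => ?_
    exact isProb_bind (hs.isProb_particleLaw _ _ _ _)
      (hm.comp (measurable_prodMk_left (x := (z, u)))) fun y => hp _
  · exact measurable_bind_param (μ := fun _ => s.auxLaw xp x) measurable_const
      (fun _ => hs.aux _ _) hb

theorem resample_bind {D N : ℕ} {β γ : Type*} [MeasurableSpace β] [MeasurableSpace γ]
    {s : Step D N} (hs : s.Regular) (k : Fin (N + 1))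
    (Φ : Fin (N + 1) → (Fin (N + 1) → St D) → Measure β)
    (hp : ∀ k' z', IsProbabilityMeasure (Φ k' z')) (hm : ∀ k', Measurable (Φ k'))
    (Ψ : (Fin (N + 1) → St D) → (Fin (N + 1) → St D) → St D → β → Measure γ)
    (hΨ : ∀ z y u p, IsProbabilityMeasure (Ψ z y u p))
    (hΨm : Measurable fun q : (((Fin (N + 1) → St D) × St D) × (Fin (N + 1) → St D)) × β =>
      Ψ q.1.1.1 q.1.2 q.1.1.2 q.2) :
    (∀ z u y, IsProbabilityMeasure (s.resample k z y u fun k' z' =>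
      (Φ k' z').bind (Ψ z y u))) ∧
    Measurable fun q : ((Fin (N + 1) → St D) × St D) × (Fin (N + 1) → St D) =>
      s.resample k q.1.1 q.2 q.1.2 fun k' z' => (Φ k' z').bind (Ψ q.1.1 q.2 q.1.2) := by
  refine hs.resample k (fun q k' z' => (Φ k' z').bind (Ψ q.1.1 q.2 q.1.2))
    (fun q k' z' => ?_) fun k' => ?_
  · exact isProb_bind (hp k' z') (hΨm.comp (measurable_prodMk_left (x := q)))
      fun p => hΨ q.1.1 q.2 q.1.2 p
  · have h1 : Measurable fun r : (((Fin (N + 1) → St D) × St D) × (Fin (N + 1) → St D)) ×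
        (Fin (N + 1) → St D) => Φ k' r.2 := (hm k').comp measurable_snd
    have h2 : Measurable fun w : ((((Fin (N + 1) → St D) × St D) ×
        (Fin (N + 1) → St D)) × (Fin (N + 1) → St D)) × β => (w.1.1, w.2) :=
      (measurable_fst.comp measurable_fst).prodMk measurable_snd
    exact measurable_bind_param h1 (fun r => hp k' r.2)
      (f := fun r => Ψ r.1.1.1 r.1.2 r.1.1.2) (hΨm.comp h2)

theorem forward_wellDefined {D N : ℕ} (hN : 1 ≤ N) : ∀ (T : ℕ) (s : Fin T → Step D N)
    (_ : ∀ t, (s t).Regular) (x : Fin T → St D) (xp : St D) (k : Fin (N + 1)),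
    (∀ z, IsProbabilityMeasure (forward T s x xp k z)) ∧
      Measurable fun z => forward T s x xp k z
  | 0, s, hs, x, xp, k => by
    simp only [forward]
    exact ⟨fun _ => inferInstance, measurable_const⟩
  | 1, s, hs, x, xp, k => by
    simp only [forward]
    exact forward_step (hs 0) (x 0) xp k (fun q => (s 0).finalMove k q.1.1 q.1.2 q.2)
      (fun q => ((hs 0).finalMove hN k).1 _ _ _) ((hs 0).finalMove hN k).2
  | T + 2, s, hs, x, xp, k => by
    have ih := forward_wellDefined hN (T + 1) (fun t => s t.succ) (fun t => hs _)
      (fun t => x t.succ) (x 0)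
    simp only [forward]
    generalize forward (T + 1) (fun t => s t.succ) (fun t => x t.succ) (x 0) = Φ at ih ⊢
    have hr := resample_bind (hs 0) k Φ (fun k' => (ih k').1)
      (fun k' => (ih k').2) ((s 0).backwardMove (s 1)) ((hs 0).backwardMove (hs 1)).1
      ((hs 0).backwardMove (hs 1)).2
    exact forward_step (hs 0) (x 0) xp k (fun q => (s 0).resample k q.1.1 q.2 q.1.2
      fun k' z' => (Φ k' z').bind ((s 0).backwardMove (s 1) q.1.1 q.2 q.1.2))
      (fun q => hr.1 _ _ _) hr.2

theorem isProb_kernel {D N T : ℕ} (hN : 1 ≤ N) {s : Fin T → Step D N} (hs : ∀ t, (s t).Regular)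
    (x : Fin T → St D) : IsProbabilityMeasure (kernel s x) := by
  unfold kernel
  have := isProb_sum (inv_sum_one N)
    fun k => (forward_wellDefined hN T s hs x 0 k).1 (fun _ => 0)
  exact Measure.isProbabilityMeasure_map measurable_snd.aemeasurable

theorem gaussDensity_pos {D : ℕ} {S : Matrix (Fin D) (Fin D) ℝ} (hS : S.PosDef) (m x : St D) :
    0 < gaussDensity m S x := by
  have := hS.det_pos
  unfold gaussDensity
  positivity

theorem measurable_gaussDensity {D : ℕ} {α : Type*} [MeasurableSpace α] {f g : α → St D}
    (hf : Measurable f) (hg : Measurable g) (S : Matrix (Fin D) (Fin D) ℝ) :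
    Measurable fun a => gaussDensity (f a) S (g a) := by
  unfold gaussDensity act
  fun_prop

theorem posDef_isoCov {D T : ℕ} {δ : Fin T → ℝ} (hδ : ∀ t, 0 < δ t) (t : Fin T) :
    (isoCov (D := D) δ t).PosDef := Matrix.PosDef.one.smul (half_pos (hδ t))

theorem posDef_matA {D T : ℕ} {F : Model D T} {δ : Fin T → ℝ} (hδ : ∀ t, 0 < δ t) (t : Fin T)
    (hC : (F.C t).PosDef) : (matA F δ t).PosDef := by
  have hu : IsUnit (F.C t).det := (Matrix.isUnit_iff_isUnit_det _).1 hC.isUnit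
  have h1 : (1 + (δ t / 2) • (F.C t)⁻¹ : Matrix (Fin D) (Fin D) ℝ).PosDef :=
    Matrix.PosDef.one.add (hC.inv.smul (half_pos (hδ t)))
  have h2 : matA F δ t = (1 + (δ t / 2) • (F.C t)⁻¹)⁻¹ := by
    have : F.C t + isoCov δ t = F.C t * (1 + (δ t / 2) • (F.C t)⁻¹) := by
      rw [Matrix.mul_add, Matrix.mul_smul, Matrix.mul_nonsing_inv _ hu, Matrix.mul_one, isoCov]
    rw [matA, this, Matrix.mul_inv_rev, Matrix.mul_assoc, Matrix.nonsing_inv_mul _ hu,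
      Matrix.mul_one]
  rw [h2]
  exact h1.inv

theorem agradCov_eq {D T : ℕ} {F : Model D T} {δ : Fin T → ℝ} (hδ : ∀ t, 0 < δ t) (t : Fin T)
    (hC : (F.C t).PosDef) : agradCov F δ t = (1 - matA F δ t) * F.C t := by
  have hS : (F.C t + isoCov δ t).PosDef := hC.add (posDef_isoCov hδ t)
  have hu : IsUnit (F.C t + isoCov δ t).det := (Matrix.isUnit_iff_isUnit_det _).1 hS.isUnit
  have h : 1 - matA F δ t = (F.C t + isoCov δ t)⁻¹ * isoCov δ t := by
    have := Matrix.nonsing_inv_mul _ hu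
    rw [Matrix.mul_add] at this
    rw [matA, ← this, add_sub_cancel_left]
  rw [h, Matrix.mul_assoc, isoCov, Matrix.smul_mul, Matrix.one_mul, Matrix.mul_smul, agradCov,
    matA, isoCov]

theorem measurable_average {D N : ℕ} : Measurable (average : (Fin (N + 1) → St D) → St D) := by
  unfold average; fun_prop


open scoped MatrixOrder in
theorem measurable_multivariateGaussian {D : ℕ} (S : Matrix (Fin D) (Fin D) ℝ) :
    Measurable fun u : St D => multivariateGaussian u S := by
  refine Measure.measurable_of_measurable_coe _ fun s hs => ?_
  unfold multivariateGaussian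
  have h2 : Measurable fun p : St D × St D =>
    p.1 + Matrix.toEuclideanCLM (𝕜 := ℝ) (CFC.sqrt S) p.2 := by fun_prop
  have : ∀ u : St D, Measurable fun x : St D =>
    u + Matrix.toEuclideanCLM (𝕜 := ℝ) (CFC.sqrt S) x := fun u => by fun_prop
  simp_rw [fun u => Measure.map_apply (μ := stdGaussian (St D)) (this u) hs]
  exact measurable_measure_prodMk_left (ν := stdGaussian (St D)) (h2 hs)

theorem measurable_gradient {D : ℕ} (g : St D → ℝ) : Measurable (gradient g) := by
  unfold gradient
  exact (LinearIsometryEquiv.continuous _).measurable.comp (measurable_fderiv ℝ _)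

/-- Regularity of a model that makes the four algorithms well defined. -/
structure Model.Regular {D T : ℕ} (F : Model D T) (δ : Fin T → ℝ) (κ : ℝ) : Prop where
  hδ : ∀ t, 0 < δ t
  hC : ∀ t, (F.C t).PosDef
  hm : ∀ t, Measurable (F.m t)
  hQ : ∀ t z x, 0 < F.Q t z x
  hQm : ∀ t, Measurable fun p : St D × St D => F.Q t p.1 p.2
  hQs : ∀ t, Measurable fun p : St D × St D => malaShift F δ κ t p.1 p.2
  hGs : ∀ t, Measurable fun p : St D × St D => gradShift F δ κ t p.1 p.2

section
variable {D T : ℕ} (N : ℕ) {F : Model D T} {δ : Fin T → ℝ} {κ : ℝ}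

theorem Model.Regular.hA (h : F.Regular δ κ) (t) : (agradCov F δ t).PosDef :=
  (posDef_matA h.hδ t (h.hC t)).smul (half_pos (h.hδ t))

theorem Model.Regular.hmean (h : F.Regular δ κ) (t) :
    Measurable fun p : St D × St D => agradMean F δ t p.1 p.2 := by
  have := h.hm t
  unfold agradMean act
  fun_prop

theorem Model.Regular.hamp (h : F.Regular δ κ) (t) :
    Measurable fun p : St D × St D × St D => amalaPotential F δ κ t p.1 p.2.1 p.2.2 := by
  have h1 : Measurable fun p : St D × St D × St D => (p.1, p.2.1) := by fun_prop
  have h3 := (h.hQs t).comp h1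
  simp only [Function.comp_def] at h3
  unfold amalaPotential
  refine ((h.hQm t).comp h1).mul (Measurable.div ?_ ?_)
  · exact measurable_gaussDensity (by fun_prop) (by fun_prop) _
  · exact measurable_gaussDensity (by fun_prop) (by fun_prop) _

theorem Model.Regular.hagp (h : F.Regular δ κ) (t) :
    Measurable fun p : St D × St D × St D => agradPotential F δ κ t p.1 p.2.1 p.2.2 := by
  have h1 : Measurable fun p : St D × St D × St D => (p.1, p.2.1) := by fun_prop
  have h2 : Measurable fun p : St D × St D × St D => (p.1, p.2.2) := by fun_prop
  have h3 := (h.hGs t).comp h1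
  have h4 := (h.hmean t).comp h2
  simp only [Function.comp_def] at h3 h4
  unfold agradPotential
  refine ((h.hQm t).comp h1).mul (Measurable.div ?_ ?_)
  · exact measurable_gaussDensity (by fun_prop) (by fun_prop) _
  · exact measurable_gaussDensity h4 (by fun_prop) _

theorem Model.Regular.amala_pos (h : F.Regular δ κ) (t z x u) :
    0 < amalaPotential F δ κ t z x u :=
  mul_pos (h.hQ _ _ _) (div_pos (gaussDensity_pos (posDef_isoCov h.hδ t) _ _)
    (gaussDensity_pos (posDef_isoCov h.hδ t) _ _))

theorem Model.Regular.agrad_pos (h : F.Regular δ κ) (t z x u) :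
    0 < agradPotential F δ κ t z x u :=
  mul_pos (h.hQ _ _ _) (div_pos (gaussDensity_pos (posDef_isoCov h.hδ t) _ _)
    (gaussDensity_pos (h.hA t) _ _))

theorem Model.Regular.agradStep (h : F.Regular δ κ) (t) : (agradStep N F δ κ t).Regular where
  aux _ _ := by dsimp only [ParticleMCMC.agradStep]; infer_instance
  prop _ _ := by dsimp only [ParticleMCMC.agradStep]; infer_instance
  prop_meas := (measurable_multivariateGaussian _).comp (h.hmean t)
  weight_pos _ _ _ _ := by dsimp only [ParticleMCMC.agradStep]; exact h.agrad_pos _ _ _ _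
  weight_meas n := by
    dsimp only [ParticleMCMC.agradStep]
    have h1 : Measurable fun p : (Fin (N + 1) → St D) × (Fin (N + 1) → St D) × St D =>
      (p.1 n, p.2.1 n, p.2.2) := by fun_prop
    have h2 := (h.hagp t).comp h1
    simp only [Function.comp_def] at h2
    exact h2
  back_pos _ _ _ := by
    dsimp only [ParticleMCMC.agradStep]
    exact mul_pos (gaussDensity_pos (h.hA t) _ _) (h.agrad_pos _ _ _ _)
  back_meas := by
    dsimp only [ParticleMCMC.agradStep]
    exact (measurable_gaussDensity ((h.hmean t).comp (by fun_prop : Measurable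
      fun p : St D × St D × St D => (p.1, p.2.2))) (by fun_prop) _).mul (h.hagp t)

theorem Model.Regular.amalaStep (h : F.Regular δ κ) (t) : (amalaStep N F δ κ t).Regular where
  aux _ _ := by dsimp only [ParticleMCMC.amalaStep]; infer_instance
  prop _ _ := by dsimp only [ParticleMCMC.amalaStep]; infer_instance
  prop_meas := (measurable_multivariateGaussian _).comp measurable_snd
  weight_pos _ _ _ _ := by dsimp only [ParticleMCMC.amalaStep]; exact h.amala_pos _ _ _ _
  weight_meas n := by
    dsimp only [ParticleMCMC.amalaStep]
    have h1 : Measurable fun p : (Fin (N + 1) → St D) × (Fin (N + 1) → St D) × St D =>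
      (p.1 n, p.2.1 n, p.2.2) := by fun_prop
    have h2 := (h.hamp t).comp h1
    simp only [Function.comp_def] at h2
    exact h2
  back_pos _ _ _ := by
    dsimp only [ParticleMCMC.amalaStep]
    exact mul_pos (gaussDensity_pos (posDef_isoCov h.hδ t) _ _) (h.amala_pos _ _ _ _)
  back_meas := by
    dsimp only [ParticleMCMC.amalaStep]
    exact (measurable_gaussDensity (by fun_prop) (by fun_prop) _).mul (h.hamp t)

theorem Model.Regular.malaStep (h : F.Regular δ κ) (t) : (malaStep N F δ κ t).Regular where
  aux _ _ := by dsimp only [ParticleMCMC.malaStep]; infer_instance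
  prop _ _ := by dsimp only [ParticleMCMC.malaStep]; infer_instance
  prop_meas := (measurable_multivariateGaussian _).comp measurable_snd
  weight_pos _ _ _ _ := by
    dsimp only [ParticleMCMC.malaStep]; exact mul_pos (h.hQ _ _ _) (Real.exp_pos _)
  weight_meas n := by
    dsimp only [ParticleMCMC.malaStep]
    have hyz : Measurable fun p : (Fin (N + 1) → St D) × (Fin (N + 1) → St D) × St D =>
      (p.1 n, p.2.1 n) := by fun_prop
    have h1 := (h.hQs t).comp hyz
    have h2 := (h.hQm t).comp hyz
    have h3 := measurable_average (D := D) (N := N)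
    simp only [Function.comp_def] at h1 h2
    unfold malaFactor
    fun_prop
  back_pos _ _ _ := by dsimp only [ParticleMCMC.malaStep]; exact h.hQ _ _ _
  back_meas := by
    dsimp only [ParticleMCMC.malaStep]
    have h1 : Measurable fun p : St D × St D × St D => (p.1, p.2.1) := by fun_prop
    have h2 := (h.hQm t).comp h1
    simp only [Function.comp_def] at h2
    exact h2

theorem Model.Regular.mgradStep (h : F.Regular δ κ) (t) : (mgradStep N F δ κ t).Regular where
  aux _ _ := by dsimp only [ParticleMCMC.mgradStep]; infer_instance
  prop _ _ := by dsimp only [ParticleMCMC.mgradStep]; infer_instance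
  prop_meas := (measurable_multivariateGaussian _).comp (h.hmean t)
  weight_pos _ _ _ _ := by
    dsimp only [ParticleMCMC.mgradStep]; exact mul_pos (h.hQ _ _ _) (Real.exp_pos _)
  weight_meas n := by
    dsimp only [ParticleMCMC.mgradStep]
    have hyz : Measurable fun p : (Fin (N + 1) → St D) × (Fin (N + 1) → St D) × St D =>
      (p.1 n, p.2.1 n) := by fun_prop
    have h1 := (h.hGs t).comp hyz
    have h2 := (h.hQm t).comp hyz
    have h3 := measurable_average (D := D) (N := N)
    have h4 := h.hm t
    simp only [Function.comp_def] at h1 h2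
    unfold mgradFactor mgradV act
    fun_prop
  back_pos _ _ _ := by dsimp only [ParticleMCMC.mgradStep]; exact h.hQ _ _ _
  back_meas := by
    dsimp only [ParticleMCMC.mgradStep]
    have h1 : Measurable fun p : St D × St D × St D => (p.1, p.2.1) := by fun_prop
    have h2 := (h.hQm t).comp h1
    simp only [Function.comp_def] at h2
    exact h2

theorem regular_factorised {m : Fin T → St D} {C : Fin T → Matrix (Fin D) (Fin D) ℝ}
    {G : Fin T → St D → ℝ} (hC : ∀ t, (C t).PosDef) (hG : ∀ t x, 0 < G t x)
    (hGd : ∀ t, Differentiable ℝ (G t)) {δ : Fin T → ℝ} (hδ : ∀ t, 0 < δ t) (κ : ℝ) :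
    (Model.factorised m C G).Regular δ κ where
  hδ := hδ
  hC := hC
  hm t := by simp only [Model.factorised]; exact measurable_const
  hQ t z x := by
    simp only [Model.factorised, Model.Q, Model.M]
    exact mul_pos (gaussDensity_pos (hC t) _ _) (hG t x)
  hQm t := by
    have := (hGd t).continuous.measurable
    simp only [Model.factorised, Model.Q, Model.M]
    exact (measurable_gaussDensity measurable_const measurable_snd _).mul
      (this.comp measurable_snd)
  hQs t := by
    simp only [malaShift, Model.gradLogQ, Model.factorised, Model.Q, Model.M]
    exact ((measurable_gradient _).comp (measurable_snd (α := St D))).const_smul (κ * (δ t / 2))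
  hGs t := by
    simp only [gradShift, Model.gradLogG, Model.factorised]
    exact ((measurable_gradient _).comp (measurable_snd (α := St D))).const_smul (κ * (δ t / 2))

/-- The four algorithms define probability laws. -/
theorem isProb_kernels (hN : 1 ≤ N) (h : F.Regular δ κ) (x : Fin T → St D) :
    IsProbabilityMeasure (kernelAGRAD N F δ κ x) ∧ IsProbabilityMeasure (kernelMGRAD N F δ κ x) ∧
    IsProbabilityMeasure (kernelAMALA N F δ κ x) ∧ IsProbabilityMeasure (kernelMALA N F δ κ x) :=
  ⟨isProb_kernel hN (h.agradStep N) x, isProb_kernel hN (h.mgradStep N) x,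
    isProb_kernel hN (h.amalaStep N) x, isProb_kernel hN (h.malaStep N) x⟩
end

end ParticleMCMC

end

/-!
The four algorithms differ only in the auxiliary shift, the proposal and the weights of each time
step, and the two members of each pair agree in the limit of a flat Gaussian prior: as the
smallest eigenvalue `λ` of `C` grows, `A = (C + (δ / 2) 1)⁻¹ C` differs from the identity, and the
prior drift `C⁻¹ (x - m)` from zero, by a term of order `λ⁻¹`. Apart from `log Q`, which both
members of a pair share, all log-densities and log-weights are polynomials of degree two in
the states and shifts, and the shifts grow linearly. So the logarithms of the auxiliary densities
and of the weights differ by at most `λ⁻¹` times a quadratic polynomial, up to terms which are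
common to all particles and cancel in the normalisation
(`log_auxDensity_sub_le`, `log_amalaPotential_sub`, `log_malaFactor_sub_log_mgradFactor_le`). For
the proposals only the upper bound of the log-ratio is needed (`log_proposalDensity_sub_le`).

These bounds are turned into bounds on laws with the relation `Close μ ν c`: test functions with
values in `[0, 1]` integrate under `μ` to at most `c` more than under `ν`. It is stable under
`Measure.bind`, products and mixtures. If the log-ratio of two densities is at most `η`, then
`c = ∫ η dμ` is admissible (`Close.of_density`), so that second moments of isotropic Gaussian laws
are all that is needed; for this reason the algorithm without preconditioning is always `μ`.
The normalised weights and the forced-move probabilities away from the reference particle are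
perturbed multiplicatively (`forcedMoveProb_le_mul`). Since nothing depends on ancestors, backward
sampling uses the normalised weights only (`backwardMove_eq`) and the errors of the time steps add
up (`close_forward`). The total error at the reference path `x` is of order
`λ⁻¹ ∑ t, (1 + ‖x t‖ ^ 2)` (`exists_stepsClose`).

On the set of paths in the ball of radius `λ ^ (1 / 8)` this is of order `λ ^ (-3 / 4)`, which is
more than enough. The targets converge to the law with density proportional to `∏ t, G t (x t)`,
which has finite mass because `G` is bounded with finite second moments; hence these balls
have asymptotically full mass (`tendsto_target_balls`).
-/

noncomputable section

namespace ParticleMCMC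

/-! ### One-sided closeness of measures -/

/-- The integral under `μ` of every measurable function with values in `[0, 1]` exceeds its integral
under `ν` by at most `c`. Between probability measures this bounds the total variation distance;
unlike that distance it is stable under `Measure.bind` without any integrability assumptions. -/
def Close {α : Type*} [MeasurableSpace α] (μ ν : Measure α) (c : ℝ≥0∞) : Prop :=
  ∀ h : α → ℝ≥0∞, Measurable h → (∀ a, h a ≤ 1) → ∫⁻ a, h a ∂μ ≤ ∫⁻ a, h a ∂ν + c

section Close

variable {α β : Type*} [MeasurableSpace α] [MeasurableSpace β]

theorem Close.refl (μ : Measure α) : Close μ μ 0 := fun h _ _ => by simp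

theorem Close.mono {μ ν : Measure α} {c d : ℝ≥0∞} (h : Close μ ν c) (hcd : c ≤ d) :
    Close μ ν d := fun f hf h1 => (h f hf h1).trans (by gcongr)

theorem Close.map {μ ν : Measure α} {c : ℝ≥0∞} (h : Close μ ν c) {f : α → β}
    (hf : Measurable f) : Close (μ.map f) (ν.map f) c := fun g hg h1 => by
  rw [lintegral_map hg hf, lintegral_map hg hf]
  exact h _ (hg.comp hf) fun a => h1 _

theorem lintegral_le_one {μ : Measure α} [IsProbabilityMeasure μ] {h : α → ℝ≥0∞}
    (h1 : ∀ a, h a ≤ 1) : ∫⁻ a, h a ∂μ ≤ 1 :=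
  (lintegral_mono h1).trans (by simp)

theorem measurable_lintegral_fun {f : α → Measure β} (hf : Measurable f) {h : β → ℝ≥0∞}
    (hh : Measurable h) : Measurable fun a => ∫⁻ b, h b ∂(f a) :=
  (Measure.measurable_lintegral hh).comp hf

theorem Close.bind {μ ν : Measure α} {c : ℝ≥0∞} (h : Close μ ν c) {f g : α → Measure β}
    (hf : Measurable f) (hg : Measurable g) (hgp : ∀ a, IsProbabilityMeasure (g a))
    {η : α → ℝ≥0∞} (hη : ∀ a, Close (f a) (g a) (η a)) :
    Close (μ.bind f) (ν.bind g) (c + ∫⁻ a, η a ∂μ) := fun F hF h1 => by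
  rw [Measure.lintegral_bind hf.aemeasurable hF.aemeasurable,
    Measure.lintegral_bind hg.aemeasurable hF.aemeasurable]
  calc ∫⁻ a, ∫⁻ b, F b ∂(f a) ∂μ
      ≤ ∫⁻ a, (∫⁻ b, F b ∂(g a) + η a) ∂μ := lintegral_mono fun a => hη a F hF h1
    _ = ∫⁻ a, ∫⁻ b, F b ∂(g a) ∂μ + ∫⁻ a, η a ∂μ :=
        lintegral_add_left (measurable_lintegral_fun hg hF) _
    _ ≤ ∫⁻ a, ∫⁻ b, F b ∂(g a) ∂ν + c + ∫⁻ a, η a ∂μ := by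
        gcongr
        exact h _ (measurable_lintegral_fun hg hF) fun a => lintegral_le_one h1
    _ = _ := add_assoc _ _ _

theorem Close.prod {μ μ' : Measure α} {ν ν' : Measure β} [IsProbabilityMeasure μ]
    [IsProbabilityMeasure μ'] [IsProbabilityMeasure ν] [IsProbabilityMeasure ν'] {c d : ℝ≥0∞}
    (h : Close μ μ' c) (h' : Close ν ν' d) : Close (μ.prod ν) (μ'.prod ν') (c + d) :=
  fun F hF h1 => by
  rw [lintegral_prod _ hF.aemeasurable, lintegral_prod _ hF.aemeasurable]
  calc ∫⁻ a, ∫⁻ b, F (a, b) ∂ν ∂μ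
      ≤ ∫⁻ a, (∫⁻ b, F (a, b) ∂ν' + d) ∂μ := lintegral_mono fun a =>
        h' _ (hF.comp measurable_prodMk_left) fun _ => h1 _
    _ = ∫⁻ a, ∫⁻ b, F (a, b) ∂ν' ∂μ + d := by
        rw [lintegral_add_left hF.lintegral_prod_right']; simp
    _ ≤ ∫⁻ a, ∫⁻ b, F (a, b) ∂ν' ∂μ' + c + d := by
        gcongr
        exact h _ hF.lintegral_prod_right' fun a => lintegral_le_one fun _ => h1 _
    _ = _ := add_assoc _ _ _

theorem Close.pi : ∀ {n : ℕ} {μ μ' : Fin n → Measure α} [∀ i, IsProbabilityMeasure (μ i)]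
    [∀ i, IsProbabilityMeasure (μ' i)] {c : Fin n → ℝ≥0∞} (_ : ∀ i, Close (μ i) (μ' i) (c i)),
    Close (Measure.pi μ) (Measure.pi μ') (∑ i, c i)
  | 0, μ, μ', _, _, c, h => by
    rw [Measure.pi_of_empty, Measure.pi_of_empty]
    simpa using Close.refl _
  | n + 1, μ, μ', _, _, c, h => by
    have ih := Close.pi (μ := fun i => μ (Fin.succ i)) (μ' := fun i => μ' (Fin.succ i))
      fun i => h i.succ
    have key : ∀ (ν : Fin (n + 1) → Measure α) [∀ i, IsProbabilityMeasure (ν i)],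
        Measure.pi ν = ((ν 0).prod (Measure.pi fun i => ν (Fin.succ i))).map
          (MeasurableEquiv.piFinSuccAbove (fun _ => α) 0).symm := fun ν _ =>
      (((measurePreserving_piFinSuccAbove ν 0).symm).map_eq).symm
    rw [key μ, key μ', Fin.sum_univ_succ]
    exact ((h 0).prod ih).map (MeasurableEquiv.measurable _)

/-- Finite mixtures with possibly different weights, when all components are close. -/
theorem Close.mixture_of_all {ι κ : Type*} [Fintype ι] [Fintype κ] {p : ι → ℝ≥0∞}
    {q : κ → ℝ≥0∞} (hp : ∑ i, p i = 1) (hq : ∑ i, q i = 1) {μ : ι → Measure α}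
    {ν : κ → Measure α} {c : ℝ≥0∞} (h : ∀ i j, Close (μ i) (ν j) c) :
    Close (∑ i, p i • μ i) (∑ j, q j • ν j) c := fun F hF h1 => by
  simp only [lintegral_finsetSum_measure, lintegral_smul_measure, smul_eq_mul]
  have h2 : ∀ j, ∑ i, p i * ∫⁻ a, F a ∂(μ i) ≤ ∫⁻ a, F a ∂(ν j) + c := fun j => by
    calc ∑ i, p i * ∫⁻ a, F a ∂(μ i) ≤ ∑ i, p i * (∫⁻ a, F a ∂(ν j) + c) := by
          gcongr with i _; exact h i j F hF h1
      _ = _ := by rw [← Finset.sum_mul, hp, one_mul]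
  calc ∑ i, p i * ∫⁻ a, F a ∂(μ i) = ∑ j, q j * ∑ i, p i * ∫⁻ a, F a ∂(μ i) := by
        rw [← Finset.sum_mul, hq, one_mul]
    _ ≤ ∑ j, q j * (∫⁻ a, F a ∂(ν j) + c) := by gcongr with j _; exact h2 j
    _ = _ := by simp only [mul_add]; rw [Finset.sum_add_distrib, ← Finset.sum_mul, hq, one_mul]

theorem Close.mixture {ι : Type*} [Fintype ι] {p : ι → ℝ≥0∞}
    (hp : ∑ i, p i = 1) {μ ν : ι → Measure α} {c : ℝ≥0∞} (h : ∀ i, Close (μ i) (ν i) c) :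
    Close (∑ i, p i • μ i) (∑ j, p j • ν j) c := fun F hF h1 => by
  simp only [lintegral_finsetSum_measure, lintegral_smul_measure, smul_eq_mul]
  calc ∑ i, p i * ∫⁻ a, F a ∂(μ i) ≤ ∑ i, p i * (∫⁻ a, F a ∂(ν i) + c) := by
        gcongr with i _; exact h i F hF h1
    _ = _ := by simp only [mul_add]; rw [Finset.sum_add_distrib, ← Finset.sum_mul, hp, one_mul]

theorem Close.discrete {ι : Type*} [Fintype ι] {p q : ι → ℝ} {e : ℝ} (he : 0 ≤ e)
    (hq : ∀ i, 0 ≤ q i) (hpq : ∀ i, p i ≤ q i + e) (μ : ι → Measure α)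
    [∀ i, IsProbabilityMeasure (μ i)] :
    Close (∑ i, ENNReal.ofReal (p i) • μ i) (∑ i, ENNReal.ofReal (q i) • μ i)
      (ENNReal.ofReal (Fintype.card ι * e)) := fun F hF h1 => by
  simp only [lintegral_finsetSum_measure, lintegral_smul_measure, smul_eq_mul]
  calc ∑ i, ENNReal.ofReal (p i) * ∫⁻ a, F a ∂(μ i)
      ≤ ∑ i, (ENNReal.ofReal (q i) * ∫⁻ a, F a ∂(μ i) + ENNReal.ofReal e) := by
        refine Finset.sum_le_sum fun i _ => ?_
        calc ENNReal.ofReal (p i) * ∫⁻ a, F a ∂(μ i)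
            ≤ (ENNReal.ofReal (q i) + ENNReal.ofReal e) * ∫⁻ a, F a ∂(μ i) := by
              gcongr
              rw [← ENNReal.ofReal_add (hq i) he]
              exact ENNReal.ofReal_le_ofReal (hpq i)
          _ ≤ _ := by
              rw [add_mul]
              gcongr
              exact mul_le_of_le_one_right' (lintegral_le_one h1)
    _ = _ := by
        rw [Finset.sum_add_distrib, Finset.sum_const, Finset.card_univ, nsmul_eq_mul,
          ENNReal.ofReal_mul (by positivity), ENNReal.ofReal_natCast]

/-- If the log-ratio of two positive densities is at most `η`, then the measures are close up to the
integral of `η`, because `1 - exp (-η) ≤ η`. -/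
theorem Close.of_density {ρ : Measure α} {p q : α → ℝ} (hp : ∀ a, 0 < p a) (hq : ∀ a, 0 < q a)
    (hpm : Measurable p) (hqm : Measurable q) {η : α → ℝ}
    (hη : ∀ a, Real.log (p a) - Real.log (q a) ≤ η a) :
    Close (ρ.withDensity fun a => ENNReal.ofReal (p a))
      (ρ.withDensity fun a => ENNReal.ofReal (q a))
      (∫⁻ a, ENNReal.ofReal (η a) ∂(ρ.withDensity fun a => ENNReal.ofReal (p a))) :=
  fun F hF h1 => by
  rw [lintegral_withDensity_eq_lintegral_mul _ hpm.ennreal_ofReal hF,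
    lintegral_withDensity_eq_lintegral_mul _ hqm.ennreal_ofReal hF,
    lintegral_withDensity_eq_lintegral_mul_non_measurable _ hpm.ennreal_ofReal
      (Eventually.of_forall fun _ => ENNReal.ofReal_lt_top),
    ← lintegral_add_left (hqm.ennreal_ofReal.mul hF)]
  refine lintegral_mono fun a => ?_
  simp only [Pi.mul_apply]
  have h2 : p a ≤ q a + p a * η a := by
    have h3 := Real.add_one_le_exp (Real.log (q a) - Real.log (p a))
    rw [Real.exp_sub, Real.exp_log (hq a), Real.exp_log (hp a), le_div_iff₀ (hp a)] at h3
    nlinarith [hη a, hp a]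
  calc ENNReal.ofReal (p a) * F a
      ≤ (ENNReal.ofReal (q a) + ENNReal.ofReal (p a) * ENNReal.ofReal (η a)) * F a := by
        gcongr
        rw [← ENNReal.ofReal_mul (hp a).le]
        exact (ENNReal.ofReal_le_ofReal h2).trans ENNReal.ofReal_add_le
    _ ≤ _ := by
        rw [add_mul]
        exact add_le_add le_rfl (mul_le_of_le_one_right' (h1 a))

theorem Close.tvDist_le {μ ν : Measure α} [IsProbabilityMeasure μ] [IsProbabilityMeasure ν]
    {c : ℝ≥0∞} (h : Close μ ν c) : tvDist ν μ ≤ c := by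
  refine iSup₂_le fun A hA => ?_
  by_cases hc : c = ∞
  · simp [hc]
  have key : ∀ B, MeasurableSet B → μ.real B - ν.real B ≤ c.toReal := fun B hB => by
    have := h (B.indicator 1) (measurable_one.indicator hB)
      (fun a => Set.indicator_le (fun _ _ => le_rfl) a)
    rw [lintegral_indicator_one hB, lintegral_indicator_one hB] at this
    have h2 := ENNReal.toReal_mono (ENNReal.add_ne_top.2 ⟨measure_ne_top ν B, hc⟩) this
    rw [ENNReal.toReal_add (measure_ne_top _ _) hc] at h2
    simp only [Measure.real]
    linarith
  rw [← ENNReal.ofReal_toReal hc]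
  refine ENNReal.ofReal_le_ofReal (abs_le.2 ⟨?_, ?_⟩)
  · linarith [key A hA]
  · have := key Aᶜ hA.compl
    rw [measureReal_compl hA, measureReal_compl hA] at this
    simp only [probReal_univ] at this
    linarith

end Close

/-! ### Perturbation of the selection probabilities -/

section Selection

variable {N : ℕ}

theorem le_add_of_le_exp_mul {p q s : ℝ} (hs : 0 ≤ s) (hp0 : 0 ≤ p) (hp1 : p ≤ 1)
    (h : p ≤ Real.exp s * q) : p ≤ q + s := by
  have h1 : Real.exp (-s) * p ≤ q := by
    rw [Real.exp_neg, inv_mul_le_iff₀ (Real.exp_pos s)]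
    exact h
  nlinarith [Real.add_one_le_exp (-s)]

/-- Weights whose logarithms agree up to a common constant and an error `η` have normalisations
that agree up to the factor `exp (2 η)`. -/
theorem normalise_le_exp_mul {w w' : Fin (N + 1) → ℝ} (hw : ∀ n, 0 < w n) (hw' : ∀ n, 0 < w' n)
    {η a : ℝ} (h : ∀ n, |Real.log (w n) - Real.log (w' n) - a| ≤ η) (n : Fin (N + 1)) :
    normalise w n ≤ Real.exp (2 * η) * normalise w' n := by
  have h1 : ∀ n, w n ≤ Real.exp (a + η) * w' n := fun n => by
    rw [← Real.exp_log (hw n)]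
    nth_rw 1 [← Real.exp_log (hw' n)]
    rw [← Real.exp_add, Real.exp_le_exp]
    linarith [(abs_le.1 (h n)).2]
  have h2 : ∀ n, Real.exp (a - η) * w' n ≤ w n := fun n => by
    rw [← Real.exp_log (hw n)]
    nth_rw 1 [← Real.exp_log (hw' n)]
    rw [← Real.exp_add, Real.exp_le_exp]
    linarith [(abs_le.1 (h n)).1]
  have hs : 0 < ∑ i, w i := Finset.sum_pos (fun i _ => hw i) Finset.univ_nonempty
  have hs' : 0 < ∑ i, w' i := Finset.sum_pos (fun i _ => hw' i) Finset.univ_nonempty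
  have h3 : Real.exp (a - η) * ∑ i, w' i ≤ ∑ i, w i := by
    rw [Finset.mul_sum]
    exact Finset.sum_le_sum fun i _ => h2 i
  unfold normalise
  rw [div_le_iff₀ hs, ← mul_div_assoc, div_mul_eq_mul_div, le_div_iff₀ hs']
  have h4 : Real.exp (2 * η) * Real.exp (a - η) = Real.exp (a + η) := by
    rw [← Real.exp_add]; ring_nf
  calc w n * ∑ i, w' i ≤ Real.exp (a + η) * w' n * ∑ i, w' i := by gcongr; exact h1 n
    _ = Real.exp (2 * η) * w' n * (Real.exp (a - η) * ∑ i, w' i) := by rw [← h4]; ring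
    _ ≤ Real.exp (2 * η) * w' n * ∑ i, w i := by
      have := hw' n
      gcongr

theorem normalise_le_one {w : Fin (N + 1) → ℝ} (hw : ∀ n, 0 < w n) (n : Fin (N + 1)) :
    normalise w n ≤ 1 := by
  rw [← sum_normalise hw]
  exact Finset.single_le_sum (fun i _ => (normalise_pos hw i).le) (Finset.mem_univ n)

/-- Normalising probabilities multiplied by a constant gives them back. -/
theorem normalise_mul_const {W : Fin (N + 1) → ℝ} (h1 : ∑ i, W i = 1) {b : ℝ} (hb : b ≠ 0)
    (n : Fin (N + 1)) : normalise (fun i => W i * b) n = W n := by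
  rw [normalise, ← Finset.sum_mul, h1, one_mul, mul_div_cancel_right₀ _ hb]

theorem one_sub_pos_of_sum {W : Fin (N + 1) → ℝ} (hN : 1 ≤ N) (hW : ∀ n, 0 < W n)
    (h1 : ∑ n, W n = 1) (k : Fin (N + 1)) : 0 < 1 - W k := by
  rw [← h1, ← Finset.add_sum_erase _ _ (Finset.mem_univ k), add_sub_cancel_left]
  refine Finset.sum_pos (fun i _ => hW i) ?_
  have : Nontrivial (Fin (N + 1)) := Fin.nontrivial_iff_two_le.2 (by omega)
  obtain ⟨j, hj⟩ := exists_ne k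
  exact ⟨j, Finset.mem_erase.2 ⟨hj, Finset.mem_univ _⟩⟩

/-- Away from the reference particle, the forced-move probability is
`W l / max (1 - W k) (1 - W l)`, and both denominators are sums of normalised weights; hence it is
perturbed by at most a factor even if `W k` is close to one. -/
theorem forcedMoveProb_le_mul {W W' : Fin (N + 1) → ℝ} (hN : 1 ≤ N) (hW : ∀ n, 0 < W n)
    (h1 : ∑ n, W n = 1) (hW' : ∀ n, 0 < W' n) (h1' : ∑ n, W' n = 1) {r : ℝ}
    (hr : 0 < r) (h : ∀ n, W n ≤ r * W' n) (h' : ∀ n, W' n ≤ r * W n) {k l : Fin (N + 1)}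
    (hl : l ≠ k) : forcedMoveProb W k l ≤ r ^ 2 * forcedMoveProb W' k l := by
  have hd := one_sub_pos_of_sum hN hW h1
  have hd' := one_sub_pos_of_sum hN hW' h1'
  have hdd : ∀ i, 1 - W' i ≤ r * (1 - W i) := fun i => by
    have e : ∀ {V : Fin (N + 1) → ℝ}, ∑ n, V n = 1 → 1 - V i = ∑ n ∈ Finset.univ.erase i, V n :=
      fun {V} hV => by
        rw [← hV, ← Finset.add_sum_erase _ _ (Finset.mem_univ i), add_sub_cancel_left]
    rw [e h1, e h1', Finset.mul_sum]
    exact Finset.sum_le_sum fun i _ => h' i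
  have hq : ∀ i, W l / (1 - W i) ≤ r ^ 2 * (W' l / (1 - W' i)) := fun i => by
    rw [div_le_iff₀ (hd i), ← mul_div_assoc, div_mul_eq_mul_div, le_div_iff₀ (hd' i)]
    calc W l * (1 - W' i) ≤ (r * W' l) * (r * (1 - W i)) :=
          mul_le_mul (h l) (hdd i) (hd' i).le (mul_pos hr (hW' l)).le
      _ = _ := by ring
  have hf : ∀ V : Fin (N + 1) → ℝ, (∀ n, 0 < V n) → (∀ i, 0 < 1 - V i) →
      forcedMoveProb V k l = min (V l / (1 - V k)) (V l / (1 - V l)) := fun V hV hd => by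
    have h3 := hd k
    have h4 := hd l
    rw [forcedMoveProb, if_neg hl, mul_min_of_nonneg _ _ (div_nonneg (hV l).le h3.le), mul_one]
    congr 1
    field_simp
  rw [hf W hW hd, hf W' hW' hd', mul_min_of_nonneg _ _ (by positivity)]
  exact min_le_min (hq k) (hq l)

theorem forcedMoveProb_le_add {w w' : Fin (N + 1) → ℝ} (hN : 1 ≤ N) (hw : ∀ n, 0 < w n)
    (hw' : ∀ n, 0 < w' n) {η a : ℝ} (hη : 0 ≤ η)
    (h : ∀ n, |Real.log (w n) - Real.log (w' n) - a| ≤ η) (k l : Fin (N + 1)) :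
    forcedMoveProb (normalise w) k l ≤
      forcedMoveProb (normalise w') k l + ((N : ℝ) + 1) * (4 * η) := by
  have hsymm : ∀ n, |Real.log (w' n) - Real.log (w n) - -a| ≤ η := fun n => by
    rw [← abs_neg]
    convert h n using 2
    ring
  have hle : ∀ {v v' : Fin (N + 1) → ℝ} {b : ℝ}, (∀ n, 0 < v n) → (∀ n, 0 < v' n) →
      (∀ n, |Real.log (v n) - Real.log (v' n) - b| ≤ η) →
      (∀ n, |Real.log (v' n) - Real.log (v n) - -b| ≤ η) → ∀ i, i ≠ k →
      forcedMoveProb (normalise v) k i ≤ forcedMoveProb (normalise v') k i + 4 * η := by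
    intro v v' b hv hv' hb hb' i hi
    have h0 := forcedMoveProb_nonneg hN (normalise_pos hv) (sum_normalise hv) k
    refine le_add_of_le_exp_mul (by positivity) (h0 i) ?_ ?_
    · rw [← sum_forcedMoveProb (normalise v) k]
      exact Finset.single_le_sum (fun i _ => h0 i) (Finset.mem_univ i)
    · have := forcedMoveProb_le_mul hN (normalise_pos hv) (sum_normalise hv) (normalise_pos hv')
        (sum_normalise hv') (Real.exp_pos (2 * η)) (normalise_le_exp_mul hv hv' hb)
        (normalise_le_exp_mul hv' hv hb') hi
      rwa [← Real.exp_nat_mul, show ((2 : ℕ) : ℝ) * (2 * η) = 4 * η by push_cast; ring] at this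
  by_cases hl : l = k
  · subst hl
    -- The probability of staying is the complement of the others and is only perturbed additively.
    have e : ∀ V : Fin (N + 1) → ℝ, forcedMoveProb V l l =
        1 - ∑ i ∈ Finset.univ.erase l, forcedMoveProb V l i := fun V => by
      rw [← sum_forcedMoveProb V l, ← Finset.add_sum_erase _ _ (Finset.mem_univ l)]
      ring
    have h2 : ∑ i ∈ Finset.univ.erase l, forcedMoveProb (normalise w') l i ≤
        ∑ i ∈ Finset.univ.erase l, (forcedMoveProb (normalise w) l i + 4 * η) :=
      Finset.sum_le_sum fun i hi => hle hw' hw hsymm (by simpa using h)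
        i (Finset.ne_of_mem_erase hi)
    rw [Finset.sum_add_distrib, Finset.sum_const, Finset.card_erase_of_mem (Finset.mem_univ l),
      Finset.card_univ, Fintype.card_fin, Nat.add_sub_cancel, nsmul_eq_mul] at h2
    rw [e, e (normalise w')]
    nlinarith
  · have := hle hw hw' h hsymm l hl
    have hN0 : (0 : ℝ) ≤ N := Nat.cast_nonneg N
    nlinarith

end Selection

/-! ### Perturbation of the whole algorithm -/

/-- Two time steps of conditional SMC algorithms are close at the reference state `x` if their
backward functions do not depend on the ancestor states, their auxiliary laws, proposals and
(up to a common factor) weights are close, and the accumulated error is at most `c`. Errors are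
integrated under the law of the first algorithm. -/
structure StepsClose {D N : ℕ} (s s' : Step D N) (x : St D) (c : ℝ≥0∞) : Prop where
  regular : s.Regular
  regular' : s'.Regular
  backward : ∀ z z' x u, s.backward z x u = s.backward z' x u
  backward' : ∀ z z' x u, s'.backward z x u = s'.backward z' x u
  exists_bounds : ∃ (c₁ : ℝ≥0∞) (c₂ : St D → ℝ≥0∞) (η : St D → (Fin (N + 1) → St D) → ℝ),
    (∀ xp xp', Close (s.auxLaw xp x) (s'.auxLaw xp' x) c₁) ∧
    (∀ z z' u, Close (s.proposal z u) (s'.proposal z' u) (c₂ u)) ∧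
    (∀ u y, 0 ≤ η u y) ∧
    (∀ z z' y u, ∃ a, ∀ n, |Real.log (s.weight z y u n) - Real.log (s'.weight z' y u n) - a|
      ≤ η u y) ∧
    ∀ xp k z, c₁ + ∫⁻ u, (((N : ℝ≥0∞) + 1) * c₂ u + ∫⁻ y,
      ENNReal.ofReal (((N : ℝ) + 1) * (((N : ℝ) + 1) * (4 * η u y)))
        ∂(s.particleLaw x k z u)) ∂(s.auxLaw xp x) ≤ c

section Propagation

variable {D N : ℕ} {s s' : Step D N}

theorem Step.Regular.close_particleLaw (hs : s.Regular) (hs' : s'.Regular)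
    {z z' : Fin (N + 1) → St D} {u : St D} {c : ℝ≥0∞}
    (h : ∀ n, Close (s.proposal (z n) u) (s'.proposal (z' n) u) c)
    (x : St D) (k : Fin (N + 1)) :
    Close (s.particleLaw x k z u) (s'.particleLaw x k z' u) (((N : ℝ≥0∞) + 1) * c) := by
  have hp : ∀ {s : Step D N} {z : Fin (N + 1) → St D}, s.Regular → ∀ n,
      IsProbabilityMeasure (if n = k then Measure.dirac x else s.proposal (z n) u) := by
    intro s z hs n
    split_ifs
    · infer_instance
    · exact hs.prop _ _
  have := hp (z := z) hs
  have := hp (z := z') hs'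
  refine (Close.pi (c := fun _ => c) fun n => ?_).mono (by simp)
  split_ifs
  · exact (Close.refl _).mono bot_le
  · exact h n

/-- One time step followed by arbitrary continuations that are close. -/
theorem close_bind_step {β : Type*} [MeasurableSpace β] (hs : s.Regular) (hs' : s'.Regular)
    {x xp xp' : St D} {k : Fin (N + 1)} {z z' : Fin (N + 1) → St D}
    {f f' : ((Fin (N + 1) → St D) × St D) × (Fin (N + 1) → St D) → Measure β}
    (hf : Measurable f) (hf' : Measurable f') (hp' : ∀ q, IsProbabilityMeasure (f' q))
    {c₁ : ℝ≥0∞} {c₂ : St D → ℝ≥0∞} {d : St D → (Fin (N + 1) → St D) → ℝ≥0∞}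
    (h1 : Close (s.auxLaw xp x) (s'.auxLaw xp' x) c₁)
    (h2 : ∀ u n, Close (s.proposal (z n) u) (s'.proposal (z' n) u) (c₂ u))
    (h3 : ∀ u y, Close (f ((z, u), y)) (f' ((z', u), y)) (d u y)) :
    Close ((s.auxLaw xp x).bind fun u => (s.particleLaw x k z u).bind fun y => f ((z, u), y))
      ((s'.auxLaw xp' x).bind fun u => (s'.particleLaw x k z' u).bind fun y => f' ((z', u), y))
      (c₁ + ∫⁻ u, (((N : ℝ≥0∞) + 1) * c₂ u + ∫⁻ y, d u y ∂(s.particleLaw x k z u))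
        ∂(s.auxLaw xp x)) := by
  have hb := measurable_bind_param (hs.measurable_particleLaw x k)
    (fun p => hs.isProb_particleLaw x k p.1 p.2) (f := fun p y => f (p, y)) hf
  have hb' := measurable_bind_param (hs'.measurable_particleLaw x k)
    (fun p => hs'.isProb_particleLaw x k p.1 p.2) (f := fun p y => f' (p, y)) hf'
  refine h1.bind (hb.comp measurable_prodMk_left) (hb'.comp measurable_prodMk_left)
    (fun u => isProb_bind (hs'.isProb_particleLaw _ _ _ _)
      (hf'.comp (measurable_prodMk_left (x := (z', u)))) fun y => hp' _) fun u => ?_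
  exact (hs.close_particleLaw hs' (h2 u) x k).bind
    (hf.comp (measurable_prodMk_left (x := (z, u))))
    (hf'.comp (measurable_prodMk_left (x := (z', u)))) (fun y => hp' _) (h3 u)

/-- If the backward function does not depend on the previous state, backward sampling is sampling
from the normalised weights. -/
theorem backwardMove_eq {T : ℕ} (hs : s.Regular) (hs' : s'.Regular)
    (hb : ∀ z z' x u, s'.backward z x u = s'.backward z' x u) (z y : Fin (N + 1) → St D) (u : St D)
    (p : St D × (Fin (T + 1) → St D)) : s.backwardMove s' z y u p =
      ∑ l, ENNReal.ofReal (s.W z y u l) •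
        Measure.dirac (u, (Fin.cons (y l) p.2 : Fin (T + 2) → St D)) := by
  unfold Step.backwardMove
  have h : (fun i => s.W z y u i * s'.backward (y i) (p.2 0) p.1) =
      fun i => s.W z y u i * s'.backward 0 (p.2 0) p.1 := by
    funext i; rw [hb (y i) 0]
  simp only [h, normalise_mul_const (hs.sum_W z y u) (hs'.back_pos 0 (p.2 0) p.1).ne']

/-- The errors of the time steps add up. -/
theorem close_forward (hN : 1 ≤ N) : ∀ (T : ℕ) (s s' : Fin T → Step D N) (x : Fin T → St D)
    (c : Fin T → ℝ≥0∞) (_ : ∀ t, StepsClose (s t) (s' t) (x t) (c t)) (xp xp' : St D)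
    (k : Fin (N + 1)) (z z' : Fin (N + 1) → St D),
    Close (forward T s x xp k z) (forward T s' x xp' k z') (∑ t, c t)
  | 0, s, s', x, c, h, xp, xp', k, z, z' => by
    simp only [forward, Finset.univ_eq_empty, Finset.sum_empty]
    exact Close.refl _
  | 1, s, s', x, c, h, xp, xp', k, z, z' => by
    obtain ⟨c₁, c₂, η, h1, h2, h0, hw, hc⟩ := (h 0).exists_bounds
    have hr := (h 0).regular
    have hr' := (h 0).regular'
    simp only [forward, Finset.univ_unique, Fin.default_eq_zero, Finset.sum_singleton]
    refine (close_bind_step hr hr' (f := fun q => (s 0).finalMove k q.1.1 q.1.2 q.2)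
      (f' := fun q => (s' 0).finalMove k q.1.1 q.1.2 q.2) (hr.finalMove hN k).2
      (hr'.finalMove hN k).2 (fun q => (hr'.finalMove hN k).1 _ _ _) (h1 xp xp')
      (fun u n => h2 _ _ u) (d := fun u y => ENNReal.ofReal
        (((N : ℝ) + 1) * (((N : ℝ) + 1) * (4 * η u y)))) fun u y => ?_).mono (hc xp k z)
    obtain ⟨a, ha⟩ := hw z z' y u
    have := h0 u y
    refine (Close.discrete (e := ((N : ℝ) + 1) * (4 * η u y)) (by positivity)
      (forcedMoveProb_nonneg hN (hr'.W_pos z' y u) (hr'.sum_W z' y u) k)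
      (fun l => forcedMoveProb_le_add hN (hr.weight_pos z y u) (hr'.weight_pos z' y u) (h0 u y)
        ha k l) _).mono (by simp)
  | T + 2, s, s', x, c, h, xp, xp', k, z, z' => by
    obtain ⟨c₁, c₂, η, h1, h2, h0, hw, hc⟩ := (h 0).exists_bounds
    have hr := fun t => (h t).regular
    have hr' := fun t => (h t).regular'
    have ih := close_forward hN (T + 1) (fun t => s t.succ) (fun t => s' t.succ)
      (fun t => x t.succ) (fun t => c t.succ) (fun t => h _) (x 0) (x 0)
    have wd := forward_wellDefined hN (T + 1) (fun t => s t.succ) (fun t => hr _)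
      (fun t => x t.succ) (x 0)
    have wd' := forward_wellDefined hN (T + 1) (fun t => s' t.succ) (fun t => hr' _)
      (fun t => x t.succ) (x 0)
    simp only [forward]
    generalize forward (T + 1) (fun t => s t.succ) (fun t => x t.succ) (x 0) = Φ at ih wd ⊢
    generalize forward (T + 1) (fun t => s' t.succ) (fun t => x t.succ) (x 0) = Φ' at ih wd' ⊢
    have hb := (hr 0).backwardMove (T := T) (hr 1)
    have hb' := (hr' 0).backwardMove (T := T) (hr' 1)
    have hm := resample_bind (hr 0) k Φ (fun k' => (wd k').1)
      (fun k' => (wd k').2) ((s 0).backwardMove (s 1)) hb.1 hb.2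
    have hm' := resample_bind (hr' 0) k Φ' (fun k' => (wd' k').1)
      (fun k' => (wd' k').2) ((s' 0).backwardMove (s' 1)) hb'.1 hb'.2
    set e : St D → (Fin (N + 1) → St D) → ℝ≥0∞ := fun u y => ENNReal.ofReal
      (((N : ℝ) + 1) * (((N : ℝ) + 1) * (4 * η u y))) with he
    refine (close_bind_step (hr 0) (hr' 0) (f := fun q => (s 0).resample k q.1.1 q.2 q.1.2
      fun k' z' => (Φ k' z').bind ((s 0).backwardMove (s 1) q.1.1 q.2 q.1.2))
      (f' := fun q => (s' 0).resample k q.1.1 q.2 q.1.2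
      fun k' z' => (Φ' k' z').bind ((s' 0).backwardMove (s' 1) q.1.1 q.2 q.1.2))
      hm.2 hm'.2 (fun q => hm'.1 _ _ _) (h1 xp xp')
      (fun u n => h2 _ _ u) (d := fun u y => e u y + ∑ t : Fin (T + 1), c t.succ)
        fun u y => ?_).mono ?_
    · obtain ⟨a, ha⟩ := hw z z' y u
      have hη := h0 u y
      have hN0 : (0 : ℝ) ≤ N := Nat.cast_nonneg N
      -- The continuations are close for any two vectors of ancestors, so the laws of the ancestors
      -- need not be compared.
      refine Close.mixture (inv_sum_one N) fun k' => Close.mixture_of_all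
        (sum_ofReal_one (ancestorProb_nonneg ((hr 0).W_pos z y u) k k')
          (sum_ancestorProb ((hr 0).sum_W z y u) k k'))
        (sum_ofReal_one (ancestorProb_nonneg ((hr' 0).W_pos z' y u) k k')
          (sum_ancestorProb ((hr' 0).sum_W z' y u) k k')) fun i j => ?_
      have := (wd k').1 fun n => y (i n)
      refine ((ih k' (fun n => y (i n)) (fun n => y (j n))).bind
        (hb.2.comp (measurable_prodMk_left (x := ((z, u), y))))
        (hb'.2.comp (measurable_prodMk_left (x := ((z', u), y))))
        (fun p => hb'.1 z' y u p) (η := fun _ => e u y) fun p => ?_).mono ?_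
      · rw [Function.comp_apply, Function.comp_apply,
          backwardMove_eq (hr 0) (hr 1) (h 1).backward,
          backwardMove_eq (hr' 0) (hr' 1) (h 1).backward']
        refine (Close.discrete (e := 2 * η u y) (by positivity)
          (fun l => ((hr' 0).W_pos z' y u l).le) (fun l => ?_) _).mono ?_
        · exact le_add_of_le_exp_mul (by positivity) ((hr 0).W_pos z y u l).le
            (normalise_le_one ((hr 0).weight_pos z y u) l)
            (normalise_le_exp_mul ((hr 0).weight_pos z y u) ((hr' 0).weight_pos z' y u) ha l)
        · refine ENNReal.ofReal_le_ofReal ?_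
          simp only [Fintype.card_fin, Nat.cast_add, Nat.cast_one]
          exact mul_le_mul_of_nonneg_left (by nlinarith) (by positivity)
      · simp [add_comm]
    · have hsum : ∑ t, c t = c 0 + ∑ t : Fin (T + 1), c t.succ := Fin.sum_univ_succ _
      have := (hr 0).aux xp (x 0)
      have := fun u => (hr 0).isProb_particleLaw (x 0) k z u
      rw [hsum]
      refine le_trans (le_of_eq ?_) (add_le_add (hc xp k z) le_rfl)
      have : ∀ u, ∫⁻ y, (e u y + ∑ t : Fin (T + 1), c t.succ)
          ∂((s 0).particleLaw (x 0) k z u) =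
          ∫⁻ y, e u y ∂((s 0).particleLaw (x 0) k z u) + ∑ t : Fin (T + 1), c t.succ := fun u => by
        rw [lintegral_add_right _ measurable_const]; simp
      simp only [this, ← add_assoc]
      rw [lintegral_add_right _ measurable_const]
      simp [he, add_assoc]

theorem close_kernel {T : ℕ} (hN : 1 ≤ N) {s s' : Fin T → Step D N} {x : Fin T → St D}
    {c : Fin T → ℝ≥0∞} (h : ∀ t, StepsClose (s t) (s' t) (x t) (c t)) :
    Close (kernel s x) (kernel s' x) (∑ t, c t) :=
  (Close.mixture (inv_sum_one N) fun k => close_forward hN T s s' x c h 0 0 k _ _).map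
    measurable_snd

end Propagation

/-! ### Matrices acting on vectors -/

section Act

variable {D : ℕ} (A B : Matrix (Fin D) (Fin D) ℝ) (x y : St D) (r : ℝ)

@[simp] theorem act_one : act (1 : Matrix (Fin D) (Fin D) ℝ) x = x := by simp [act]

theorem act_mul : act (A * B) x = act A (act B x) := by simp [act]

theorem act_add_left : act (A + B) x = act A x + act B x := by simp [act]

theorem act_sub_left : act (A - B) x = act A x - act B x := by simp [act]

theorem act_smul_left : act (r • A) x = r • act A x := by simp [act]

theorem act_sub : act A (x - y) = act A x - act A y := by simp [act]

theorem inner_act_right : inner ℝ x (act A y) = inner ℝ (act Aᵀ x) y := by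
  have h : (Matrix.toEuclideanCLM (𝕜 := ℝ) Aᵀ : St D →L[ℝ] St D) =
      ContinuousLinearMap.adjoint (Matrix.toEuclideanCLM (𝕜 := ℝ) A) := by
    rw [← ContinuousLinearMap.star_eq_adjoint, ← map_star, Matrix.star_eq_conjTranspose,
      Matrix.conjTranspose_eq_transpose_of_trivial]
  rw [act, act, h, ContinuousLinearMap.adjoint_inner_left]

variable {A B x y r}

theorem inner_act_comm (hA : A.IsHermitian) (x y : St D) :
    inner ℝ x (act A y) = inner ℝ (act A x) y := by
  rw [inner_act_right, ← Matrix.conjTranspose_eq_transpose_of_trivial, hA.eq]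

theorem inner_act_self_nonneg (hA : A.PosSemidef) (x : St D) : 0 ≤ inner ℝ x (act A x) := by
  rw [act, Matrix.inner_toEuclideanCLM]
  simpa using (Matrix.posSemidef_iff_dotProduct_mulVec.1 hA).2 x.ofLp

theorem le_inner_act_self_of_spectrum (hA : A.IsHermitian) {c : ℝ}
    (h : ∀ μ ∈ spectrum ℝ A, c ≤ μ) (x : St D) : c * ‖x‖ ^ 2 ≤ inner ℝ x (act A x) := by
  have hB : (A - c • (1 : Matrix (Fin D) (Fin D) ℝ)).IsHermitian := by
    refine hA.sub ?_
    rw [Matrix.IsHermitian, Matrix.conjTranspose_smul, Matrix.conjTranspose_one, star_trivial]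
  have hP : (A - c • (1 : Matrix (Fin D) (Fin D) ℝ)).PosSemidef := by
    rw [hB.posSemidef_iff_eigenvalues_nonneg]
    intro i
    have h1 := hB.eigenvalues_mem_spectrum_real i
    rw [Pi.zero_apply]
    generalize hB.eigenvalues i = e at h1 ⊢
    rw [← Algebra.algebraMap_eq_smul_one, ← spectrum.sub_singleton_eq] at h1
    obtain ⟨μ, hμ, d, hd, he⟩ := h1
    rw [Set.mem_singleton_iff] at hd
    subst hd
    simp only at he
    rw [← he]
    linarith [h μ hμ]
  have := inner_act_self_nonneg hP x
  rw [act_sub_left, act_smul_left, act_one, inner_sub_right, real_inner_smul_right,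
    real_inner_self_eq_norm_sq] at this
  linarith

/-- A coercive matrix has an inverse of norm at most the reciprocal of its coercivity constant. -/
theorem norm_act_inv_le {c : ℝ} (hc : 0 < c) (hA : IsUnit A.det)
    (h : ∀ x : St D, c * ‖x‖ ^ 2 ≤ inner ℝ x (act A x)) (x : St D) :
    ‖act A⁻¹ x‖ ≤ c⁻¹ * ‖x‖ := by
  have h1 := h (act A⁻¹ x)
  rw [← act_mul, Matrix.mul_nonsing_inv _ hA, act_one] at h1
  have h2 := real_inner_le_norm (act A⁻¹ x) x
  rcases (norm_nonneg (act A⁻¹ x)).eq_or_lt with h0 | h0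
  · rw [← h0]; positivity
  · rw [inv_mul_eq_div, le_div_iff₀ hc]
    nlinarith

theorem abs_inner_act_le {c : ℝ} (h : ∀ x : St D, ‖act A x‖ ≤ c * ‖x‖) (x y : St D) :
    |inner ℝ x (act A y)| ≤ c * (‖x‖ * ‖y‖) := by
  refine (abs_real_inner_le_norm _ _).trans ?_
  calc ‖x‖ * ‖act A y‖ ≤ ‖x‖ * (c * ‖y‖) := by gcongr; exact h y
    _ = _ := by ring

theorem det_toEuclideanCLM (A : Matrix (Fin D) (Fin D) ℝ) :
    (Matrix.toEuclideanCLM (𝕜 := ℝ) A : St D →L[ℝ] St D).det = A.det := by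
  rw [ContinuousLinearMap.det, Matrix.coe_toEuclideanCLM_eq_toEuclideanLin,
    Matrix.toEuclideanLin_eq_toLin_orthonormal, LinearMap.det_toLin]

end Act

/-! ### The density of a multivariate Gaussian law -/

theorem lintegral_fin_prod_eq_prod {α : Type*} [MeasurableSpace α] : ∀ {n : ℕ}
    (μ : Fin n → Measure α) [∀ i, SigmaFinite (μ i)] (f : Fin n → α → ℝ≥0∞)
    (_ : ∀ i, Measurable (f i)),
    ∫⁻ x, ∏ i, f i (x i) ∂(Measure.pi μ) = ∏ i, ∫⁻ a, f i a ∂(μ i)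
  | 0, μ, _, f, _ => by simp
  | n + 1, μ, _, f, hf => by
    have ih := lintegral_fin_prod_eq_prod (fun i => μ (Fin.succ i)) (fun i => f i.succ)
      fun i => hf _
    have hm : Measurable fun x : Fin n → α => ∏ i, f i.succ (x i) :=
      Finset.measurable_fun_prod _ fun i _ => (hf _).comp (measurable_pi_apply i)
    have hm' : Measurable fun x : Fin (n + 1) → α => ∏ i, f i (x i) :=
      Finset.measurable_fun_prod _ fun i _ => (hf i).comp (measurable_pi_apply i)
    rw [← ((measurePreserving_piFinSuccAbove μ 0).symm).lintegral_comp hm',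
      Fin.prod_univ_succ, ← ih, ← lintegral_prod_mul (hf 0).aemeasurable hm.aemeasurable]
    refine lintegral_congr fun p => ?_
    simp [Fin.prod_univ_succ, MeasurableEquiv.piFinSuccAbove_symm_apply, Fin.insertNthEquiv]

theorem pi_withDensity {α : Type*} [MeasurableSpace α] {n : ℕ} (μ : Fin n → Measure α)
    [∀ i, SigmaFinite (μ i)] (f : Fin n → α → ℝ≥0∞) (hf : ∀ i, Measurable (f i))
    [∀ i, SigmaFinite ((μ i).withDensity (f i))] :
    Measure.pi (fun i => (μ i).withDensity (f i)) =
      (Measure.pi μ).withDensity fun x => ∏ i, f i (x i) := by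
  refine Measure.pi_eq fun s hs => ?_
  rw [withDensity_apply _ (MeasurableSet.univ_pi hs),
    ← lintegral_indicator (MeasurableSet.univ_pi hs)]
  have h : ∀ x : Fin n → α, (Set.univ.pi s).indicator (fun x => ∏ i, f i (x i)) x =
      ∏ i, (s i).indicator (f i) (x i) := fun x => by
    by_cases hx : x ∈ Set.univ.pi s
    · rw [Set.indicator_of_mem hx]
      exact Finset.prod_congr rfl fun i _ => (Set.indicator_of_mem (hx i (Set.mem_univ i)) _).symm
    · rw [Set.indicator_of_notMem hx]
      simp only [Set.mem_pi, Set.mem_univ, forall_const, not_forall] at hx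
      obtain ⟨i, hi⟩ := hx
      exact (Finset.prod_eq_zero (Finset.mem_univ i) (Set.indicator_of_notMem hi _)).symm
  simp only [h]
  rw [lintegral_fin_prod_eq_prod μ _ fun i => (hf i).indicator (hs i)]
  exact Finset.prod_congr rfl fun i _ => by
    rw [lintegral_indicator (hs i), withDensity_apply _ (hs i)]

theorem stdGaussian_eq_withDensity (D : ℕ) : stdGaussian (St D) =
    volume.withDensity fun x => ENNReal.ofReal (∏ i, gaussianPDFReal 0 1 (x i)) := by
  rw [← map_pi_eq_stdGaussian]
  have h1 : gaussianReal 0 1 = volume.withDensity (gaussianPDF 0 1) :=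
    gaussianReal_of_var_ne_zero 0 one_ne_zero
  have : SigmaFinite (volume.withDensity (gaussianPDF 0 1)) := by rw [← h1]; infer_instance
  rw [h1, pi_withDensity _ _ fun _ => measurable_gaussianPDF 0 1]
  have hmp := PiLp.volume_preserving_toLp (Fin D)
  ext s hs
  rw [Measure.map_apply hmp.measurable hs, withDensity_apply _ (hmp.measurable hs),
    withDensity_apply _ hs, ← hmp.setLIntegral_comp_preimage hs]
  · rw [← volume_pi]
    refine lintegral_congr fun x => ?_
    simp only [gaussianPDF]
    rw [ENNReal.ofReal_prod_of_nonneg fun i _ => gaussianPDFReal_nonneg _ _ _]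
  · have := measurable_gaussianPDFReal 0 1
    fun_prop

theorem prod_gaussianPDFReal {D : ℕ} (x : St D) : ∏ i, gaussianPDFReal 0 1 (x i) =
    (Real.sqrt ((2 * Real.pi) ^ D))⁻¹ * Real.exp (-(1 / 2) * ‖x‖ ^ 2) := by
  simp only [gaussianPDFReal_def, NNReal.coe_one, mul_one, sub_zero]
  rw [Finset.prod_mul_distrib, ← Real.exp_sum, Finset.prod_const, Finset.card_univ,
    Fintype.card_fin, EuclideanSpace.real_norm_sq_eq, Finset.mul_sum, inv_pow]
  congr 2
  · rw [Real.sqrt_eq_rpow, Real.sqrt_eq_rpow, ← Real.rpow_natCast, ← Real.rpow_natCast,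
      ← Real.rpow_mul (by positivity), ← Real.rpow_mul (by positivity), mul_comm (1 / 2 : ℝ)]
  · exact Finset.sum_congr rfl fun i _ => by ring

open scoped MatrixOrder in
/-- With `L = √S`, the image of the standard Gaussian under `x ↦ m + L x` has the density
`N(·; m, S)`. -/
theorem multivariateGaussian_eq_withDensity {D : ℕ} {S : Matrix (Fin D) (Fin D) ℝ} (hS : S.PosDef)
    (m : St D) : multivariateGaussian m S =
      volume.withDensity fun x => ENNReal.ofReal (gaussDensity m S x) := by
  set L := CFC.sqrt S with hL
  have hLL : L * L = S :=
    CFC.sqrt_mul_sqrt_self S (Matrix.nonneg_iff_posSemidef.2 hS.posSemidef)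
  have hLh : L.IsHermitian :=
    (Matrix.nonneg_iff_posSemidef.1 (CFC.sqrt_nonneg S)).isHermitian
  have hdet : L.det * L.det = S.det := by rw [← Matrix.det_mul, hLL]
  have hdS := hS.det_pos
  have hd0 : L.det ≠ 0 := fun h => by rw [h, zero_mul] at hdet; exact hdS.ne hdet
  have hu : IsUnit L.det := isUnit_iff_ne_zero.2 hd0
  have hsqrt : Real.sqrt S.det = |L.det| := by rw [← hdet, Real.sqrt_mul_self_eq_abs]
  have hquad : ∀ x : St D, inner ℝ (act L x) (act S⁻¹ (act L x)) = ‖x‖ ^ 2 := fun x => by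
    rw [← inner_act_comm hLh, ← act_mul, ← act_mul, ← hLL, Matrix.mul_inv_rev,
      ← Matrix.mul_assoc L, Matrix.mul_nonsing_inv _ hu, Matrix.one_mul,
      Matrix.nonsing_inv_mul _ hu, act_one, real_inner_self_eq_norm_sq]
  have hf : Measurable fun x : St D => m + Matrix.toEuclideanCLM (𝕜 := ℝ) L x := by fun_prop
  have hinj : Function.Injective fun x : St D => m + Matrix.toEuclideanCLM (𝕜 := ℝ) L x := by
    intro x y hxy
    have h1 : act L x = act L y := add_left_cancel hxy
    have h2 := congrArg (act L⁻¹) h1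
    rwa [← act_mul, ← act_mul, Matrix.nonsing_inv_mul _ hu, act_one, act_one] at h2
  have hsurj : Function.Surjective fun x : St D => m + Matrix.toEuclideanCLM (𝕜 := ℝ) L x := by
    intro y
    refine ⟨act L⁻¹ (y - m), ?_⟩
    change m + act L _ = y
    rw [← act_mul, Matrix.mul_nonsing_inv _ hu, act_one]
    abel
  have hcv : ∀ g : St D → ℝ≥0∞, ∫⁻ y, g y = ∫⁻ x, ENNReal.ofReal
      |(Matrix.toEuclideanCLM (𝕜 := ℝ) L : St D →L[ℝ] St D).det| *
        g (m + Matrix.toEuclideanCLM (𝕜 := ℝ) L x) := fun g => by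
    have := lintegral_image_eq_lintegral_abs_det_fderiv_mul volume MeasurableSet.univ
      (f' := fun _ => Matrix.toEuclideanCLM (𝕜 := ℝ) L)
      (fun x _ => ((ContinuousLinearMap.hasFDerivAt _).const_add m).hasFDerivWithinAt)
      hinj.injOn g
    rwa [Set.image_univ_of_surjective hsurj, setLIntegral_univ, setLIntegral_univ] at this
  rw [multivariateGaussian, stdGaussian_eq_withDensity]
  ext s hs
  rw [Measure.map_apply hf hs, withDensity_apply _ (hf hs), withDensity_apply _ hs,
    ← lintegral_indicator hs, hcv, ← lintegral_indicator (hf hs)]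
  refine lintegral_congr fun x => ?_
  rw [det_toEuclideanCLM]
  by_cases hx : m + Matrix.toEuclideanCLM (𝕜 := ℝ) L x ∈ s
  · rw [Set.indicator_of_mem (by exact hx), Set.indicator_of_mem hx,
      ← ENNReal.ofReal_mul (abs_nonneg _), prod_gaussianPDFReal, gaussDensity]
    congr 1
    have h1 : m + Matrix.toEuclideanCLM (𝕜 := ℝ) L x - m = act L x := by simp [act]
    rw [h1, hquad, Real.sqrt_mul (by positivity), hsqrt]
    have := abs_pos.2 hd0
    field_simp
  · rw [Set.indicator_of_notMem (by exact hx), Set.indicator_of_notMem hx, mul_zero]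

/-! ### Preconditioning matrices for a large prior covariance -/

section LargeCovariance

variable {D T : ℕ} {F : Model D T} {δ : Fin T → ℝ} {t : Fin T} {lam : ℝ}

theorem isUnit_det_of_posDef {A : Matrix (Fin D) (Fin D) ℝ} (hA : A.PosDef) : IsUnit A.det :=
  isUnit_iff_ne_zero.2 hA.det_pos.ne'

theorem isoCov_inv (hδ : 0 < δ t) :
    (isoCov (D := D) δ t)⁻¹ = (2 / δ t) • (1 : Matrix (Fin D) (Fin D) ℝ) := by
  refine Matrix.inv_eq_right_inv ?_
  rw [isoCov, Matrix.smul_mul, Matrix.one_mul, smul_smul, show δ t / 2 * (2 / δ t) = 1 by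
    field_simp, one_smul]

theorem matA_eq_inv (hC : (F.C t).PosDef) :
    matA F δ t = (1 + (δ t / 2) • (F.C t)⁻¹)⁻¹ := by
  have hu := isUnit_det_of_posDef hC
  have : F.C t + isoCov δ t = F.C t * (1 + (δ t / 2) • (F.C t)⁻¹) := by
    rw [Matrix.mul_add, Matrix.mul_smul, Matrix.mul_nonsing_inv _ hu, Matrix.mul_one, isoCov]
  rw [matA, this, Matrix.mul_inv_rev, Matrix.mul_assoc, Matrix.nonsing_inv_mul _ hu,
    Matrix.mul_one]

theorem posDef_one_add_inv (hδ : 0 < δ t) (hC : (F.C t).PosDef) :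
    (1 + (δ t / 2) • (F.C t)⁻¹ : Matrix (Fin D) (Fin D) ℝ).PosDef :=
  Matrix.PosDef.one.add (hC.inv.smul (half_pos hδ))

theorem agradCov_inv (hδ : 0 < δ t) (hC : (F.C t).PosDef) :
    (agradCov F δ t)⁻¹ = (2 / δ t) • (1 : Matrix (Fin D) (Fin D) ℝ) + (F.C t)⁻¹ := by
  have hu := isUnit_det_of_posDef (posDef_one_add_inv hδ hC)
  refine Matrix.inv_eq_left_inv ?_
  have : (2 / δ t) • (1 : Matrix (Fin D) (Fin D) ℝ) + (F.C t)⁻¹ =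
      (2 / δ t) • (1 + (δ t / 2) • (F.C t)⁻¹) := by
    rw [smul_add, smul_smul, show 2 / δ t * (δ t / 2) = 1 by field_simp, one_smul]
  rw [this, agradCov, matA_eq_inv hC, Matrix.smul_mul, Matrix.mul_smul,
    Matrix.mul_nonsing_inv _ hu, smul_smul, show 2 / δ t * (δ t / 2) = 1 by field_simp, one_smul]

theorem one_sub_matA (hδ : 0 < δ t) (hC : (F.C t).PosDef) :
    1 - matA F δ t = (δ t / 2) • (F.C t + isoCov δ t)⁻¹ := by
  have hS : (F.C t + isoCov δ t).PosDef := hC.add (Matrix.PosDef.one.smul (half_pos hδ))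
  have := Matrix.nonsing_inv_mul _ (isUnit_det_of_posDef hS)
  rw [Matrix.mul_add] at this
  rw [matA, ← this, add_sub_cancel_left, isoCov, Matrix.mul_smul, Matrix.mul_one]

theorem posDef_matA_of_pos (hδ : 0 < δ t) (hC : (F.C t).PosDef) : (matA F δ t).PosDef := by
  rw [matA_eq_inv hC]
  exact (posDef_one_add_inv hδ hC).inv

theorem posDef_agradCov (hδ : 0 < δ t) (hC : (F.C t).PosDef) : (agradCov F δ t).PosDef :=
  (posDef_matA_of_pos hδ hC).smul (half_pos hδ)

theorem isHermitian_matA (hδ : 0 < δ t) (hC : (F.C t).PosDef) : (matA F δ t).IsHermitian :=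
  (posDef_matA_of_pos hδ hC).isHermitian

theorem posSemidef_one_sub_matA (hδ : 0 < δ t) (hC : (F.C t).PosDef) :
    (1 - matA F δ t).PosSemidef := by
  rw [one_sub_matA hδ hC]
  exact ((hC.add (Matrix.PosDef.one.smul (half_pos hδ))).inv.smul (half_pos hδ)).posSemidef

theorem one_le_det_one_add {P : Matrix (Fin D) (Fin D) ℝ} (hP : P.PosSemidef) :
    1 ≤ (1 + P).det := by
  have hH : (1 + P).IsHermitian := (Matrix.PosSemidef.one.add hP).isHermitian
  rw [hH.det_eq_prod_eigenvalues]
  refine Finset.one_le_prod fun i _ => ?_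
  have h1 := hH.eigenvalues_mem_spectrum_real i
  generalize hH.eigenvalues i = e at h1 ⊢
  have h2 : (1 + P : Matrix (Fin D) (Fin D) ℝ) = algebraMap ℝ _ 1 + P := by rw [map_one]
  rw [h2, ← spectrum.singleton_add_eq] at h1
  obtain ⟨d, hd, μ, hμ, he⟩ := h1
  rw [Set.mem_singleton_iff] at hd
  rw [hP.isHermitian.spectrum_real_eq_range_eigenvalues] at hμ
  obtain ⟨j, rfl⟩ := hμ
  simp only [hd] at he
  have := hP.eigenvalues_nonneg j
  simp only [RCLike.ofReal_real_eq_id, id_eq, ← he]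
  linarith

theorem det_agradCov_le (hδ : 0 < δ t) (hC : (F.C t).PosDef) :
    (agradCov F δ t).det ≤ (isoCov (D := D) δ t).det := by
  have h1 := one_le_det_one_add (hC.inv.smul (half_pos hδ)).posSemidef
  rw [agradCov, isoCov, Matrix.det_smul, Matrix.det_smul, Matrix.det_one, matA_eq_inv hC,
    Matrix.det_nonsing_inv, Ring.inverse_eq_inv']
  gcongr
  exact inv_le_one_of_one_le₀ h1

theorem norm_act_inv_C_le (hC : (F.C t).PosDef) (hlam : 0 < lam)
    (hco : ∀ x : St D, lam * ‖x‖ ^ 2 ≤ inner ℝ x (act (F.C t) x)) (x : St D) :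
    ‖act (F.C t)⁻¹ x‖ ≤ lam⁻¹ * ‖x‖ :=
  norm_act_inv_le hlam (isUnit_det_of_posDef hC) hco x

theorem norm_act_one_sub_matA_le (hC : (F.C t).PosDef) (hlam : 0 < lam)
    (hco : ∀ x : St D, lam * ‖x‖ ^ 2 ≤ inner ℝ x (act (F.C t) x)) (hδ : 0 < δ t) (x : St D) :
    ‖act (1 - matA F δ t) x‖ ≤ δ t / 2 * lam⁻¹ * ‖x‖ := by
  have hS : (F.C t + isoCov δ t).PosDef := hC.add (Matrix.PosDef.one.smul (half_pos hδ))
  rw [one_sub_matA hδ hC, act_smul_left, norm_smul, Real.norm_of_nonneg (half_pos hδ).le,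
    mul_assoc]
  refine mul_le_mul_of_nonneg_left (norm_act_inv_le hlam (isUnit_det_of_posDef hS) (fun y => ?_) x)
    (half_pos hδ).le
  rw [act_add_left, inner_add_right, isoCov, act_smul_left, act_one, real_inner_smul_right,
    real_inner_self_eq_norm_sq]
  nlinarith [hco y, sq_nonneg ‖y‖]

theorem norm_act_inv_one_add_le (hC : (F.C t).PosDef) (N : ℕ) (hδ : 0 < δ t) (x : St D) :
    ‖act (1 + (N : ℝ) • matA F δ t)⁻¹ x‖ ≤ ‖x‖ := by
  have hA : (matA F δ t).PosSemidef := (posDef_matA_of_pos hδ hC).posSemidef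
  have hS : (1 + (N : ℝ) • matA F δ t).PosDef :=
    Matrix.PosDef.one.add_posSemidef (hA.smul N.cast_nonneg)
  have := norm_act_inv_le one_pos (isUnit_det_of_posDef hS) (fun y => ?_) x
  · simpa using this
  · rw [act_add_left, act_one, act_smul_left, inner_add_right, real_inner_smul_right,
      real_inner_self_eq_norm_sq]
    nlinarith [mul_nonneg N.cast_nonneg (inner_act_self_nonneg hA y)]

/-- The matrix `G = (2 / δ) (1 + N A)⁻¹` differs from its limit `2 / (δ (N + 1))` by a multiple of
`1 - A`. -/
theorem matG_eq (hC : (F.C t).PosDef) (N : ℕ) (hδ : 0 < δ t) :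
    matG N F δ t - (2 / δ t / ((N : ℝ) + 1)) • (1 : Matrix (Fin D) (Fin D) ℝ) =
      (2 / δ t * ((N : ℝ) / ((N : ℝ) + 1))) •
        ((1 + (N : ℝ) • matA F δ t)⁻¹ * (1 - matA F δ t)) := by
  have hA : (matA F δ t).PosSemidef := (posDef_matA_of_pos hδ hC).posSemidef
  have hS : (1 + (N : ℝ) • matA F δ t).PosDef :=
    Matrix.PosDef.one.add_posSemidef (hA.smul N.cast_nonneg)
  have hu := isUnit_det_of_posDef hS
  have h0 : (N : ℝ) + 1 ≠ 0 := by positivity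
  have h1 : (N : ℝ) • ((1 + (N : ℝ) • matA F δ t)⁻¹ * (1 - matA F δ t)) =
      ((N : ℝ) + 1) • (1 + (N : ℝ) • matA F δ t)⁻¹ - 1 := by
    have : (N : ℝ) • (1 - matA F δ t) = ((N : ℝ) + 1) • (1 : Matrix (Fin D) (Fin D) ℝ) -
        (1 + (N : ℝ) • matA F δ t) := by
      rw [smul_sub, add_smul, one_smul]; abel
    rw [← Matrix.mul_smul, this, Matrix.mul_sub, Matrix.mul_smul, Matrix.mul_one,
      Matrix.nonsing_inv_mul _ hu]
  rw [show 2 / δ t * ((N : ℝ) / ((N : ℝ) + 1)) = 2 / δ t / ((N : ℝ) + 1) * N by ring, mul_smul, h1,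
    smul_sub, smul_smul, div_mul_cancel₀ _ h0, matG]

theorem norm_act_matG_sub_le (hC : (F.C t).PosDef) (hlam : 0 < lam)
    (hco : ∀ x : St D, lam * ‖x‖ ^ 2 ≤ inner ℝ x (act (F.C t) x)) (N : ℕ) (hδ : 0 < δ t)
    (x : St D) :
    ‖act (matG N F δ t - (2 / δ t / ((N : ℝ) + 1)) • (1 : Matrix (Fin D) (Fin D) ℝ)) x‖ ≤
      lam⁻¹ * ‖x‖ := by
  rw [matG_eq hC N hδ, act_smul_left, act_mul, norm_smul, Real.norm_of_nonneg (by positivity)]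
  have h1 : (N : ℝ) / ((N : ℝ) + 1) ≤ 1 := (div_le_one (by positivity)).2 (by linarith)
  calc 2 / δ t * ((N : ℝ) / ((N : ℝ) + 1)) *
        ‖act (1 + (N : ℝ) • matA F δ t)⁻¹ (act (1 - matA F δ t) x)‖
      ≤ 2 / δ t * 1 * (δ t / 2 * lam⁻¹ * ‖x‖) := by
        gcongr
        exact (norm_act_inv_one_add_le hC N hδ _).trans
          (norm_act_one_sub_matA_le hC hlam hco hδ x)
    _ = _ := by field_simp

theorem norm_act_matA_matG_sub_le (hC : (F.C t).PosDef) (hlam : 0 < lam)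
    (hco : ∀ x : St D, lam * ‖x‖ ^ 2 ≤ inner ℝ x (act (F.C t) x)) (N : ℕ) (hδ : 0 < δ t)
    (x : St D) :
    ‖act (matA F δ t * matG N F δ t -
      (2 / δ t / ((N : ℝ) + 1)) • (1 : Matrix (Fin D) (Fin D) ℝ)) x‖ ≤ 2 * (lam⁻¹ * ‖x‖) := by
  have h1 : matA F δ t * matG N F δ t -
      (2 / δ t / ((N : ℝ) + 1)) • (1 : Matrix (Fin D) (Fin D) ℝ) =
      (matG N F δ t - (2 / δ t / ((N : ℝ) + 1)) • (1 : Matrix (Fin D) (Fin D) ℝ)) -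
        (1 - matA F δ t) * matG N F δ t := by
    rw [Matrix.sub_mul, Matrix.one_mul]; abel
  rw [h1, act_sub_left, act_mul, two_mul]
  refine (norm_sub_le _ _).trans (add_le_add (norm_act_matG_sub_le hC hlam hco N hδ x) ?_)
  refine (norm_act_one_sub_matA_le hC hlam hco hδ _).trans ?_
  rw [matG, act_smul_left, norm_smul, Real.norm_of_nonneg (by positivity)]
  calc δ t / 2 * lam⁻¹ * (2 / δ t * ‖act (1 + (N : ℝ) • matA F δ t)⁻¹ x‖)
      ≤ δ t / 2 * lam⁻¹ * (2 / δ t * ‖x‖) := by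
        gcongr; exact norm_act_inv_one_add_le hC N hδ x
    _ = _ := by field_simp

end LargeCovariance

/-! ### Quadratic forms in the Gaussian exponents -/

section Exponents

variable {D T : ℕ} {F : Model D T} {δ : Fin T → ℝ} {t : Fin T}

theorem log_gaussDensity {S : Matrix (Fin D) (Fin D) ℝ} (hS : S.PosDef) (m x : St D) :
    Real.log (gaussDensity m S x) = -Real.log (Real.sqrt ((2 * Real.pi) ^ D * S.det)) -
      1 / 2 * inner ℝ (x - m) (act S⁻¹ (x - m)) := by
  have := hS.det_pos
  rw [gaussDensity, Real.log_mul (by positivity) (Real.exp_pos _).ne', Real.log_exp, Real.log_inv]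
  ring

theorem log_gaussDensity_isoCov (hδ : 0 < δ t) (m x : St D) :
    Real.log (gaussDensity m (isoCov δ t) x) =
      -Real.log (Real.sqrt ((2 * Real.pi) ^ D * (isoCov (D := D) δ t).det)) -
        1 / δ t * ‖x - m‖ ^ 2 := by
  have hS : (isoCov (D := D) δ t).PosDef := Matrix.PosDef.one.smul (half_pos hδ)
  rw [log_gaussDensity hS, isoCov_inv hδ, act_smul_left,
    act_one, real_inner_smul_right, real_inner_self_eq_norm_sq]
  ring

/-- The quadratic form in the exponent of the preconditioned proposal
`N(m + A (u - m), (δ / 2) A)`, compared with the one of the isotropic proposal. -/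
theorem inner_agradCov_inv (hδ : 0 < δ t) (hC : (F.C t).PosDef) (z u x : St D) :
    inner ℝ (x - agradMean F δ t z u) (act (agradCov F δ t)⁻¹ (x - agradMean F δ t z u)) =
      2 / δ t * ‖x - u‖ ^ 2 +
        inner ℝ (x - F.m t z) (act (F.C t)⁻¹ (x - F.m t z)) -
        2 / δ t * inner ℝ (u - F.m t z) (act (1 - matA F δ t) (u - F.m t z)) := by
  have hBA : (agradCov F δ t)⁻¹ * matA F δ t = (2 / δ t) • 1 := by
    have h := Matrix.nonsing_inv_mul _ (isUnit_det_of_posDef (posDef_agradCov hδ hC))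
    nth_rw 2 [agradCov] at h
    rw [Matrix.mul_smul] at h
    rw [← h, smul_smul, show 2 / δ t * (δ t / 2) = 1 by field_simp, one_smul]
  have hBh : (agradCov F δ t)⁻¹.IsHermitian := by
    rw [agradCov_inv hδ hC]
    exact ((Matrix.PosDef.one.smul (by positivity : 0 < 2 / δ t)).add hC.inv).isHermitian
  have hAh := isHermitian_matA hδ hC
  generalize hm : F.m t z = m
  rw [show x - agradMean F δ t z u = (x - m) - act (matA F δ t) (u - m) by
    rw [agradMean, hm]; abel]
  have h1 : x - u = (x - m) - (u - m) := by abel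
  rw [h1]
  generalize x - m = a
  generalize u - m = b
  rw [act_sub, inner_sub_left, inner_sub_right, inner_sub_right, ← act_mul, hBA,
    inner_act_comm hBh, ← inner_act_comm hBh, inner_act_comm hBh (act (matA F δ t) b) a,
    ← act_mul, hBA, agradCov_inv hδ hC]
  simp only [act_add_left, act_sub_left, act_smul_left, act_one, inner_add_right, inner_sub_right,
    real_inner_smul_right, real_inner_smul_left, norm_sub_sq_real, real_inner_self_eq_norm_sq]
  rw [real_inner_comm a b, real_inner_comm b (act (matA F δ t) b)]
  ring

end Exponents

/-! ### The Langevin shifts -/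

theorem hasGradientAt_inner_act {D : ℕ} {B : Matrix (Fin D) (Fin D) ℝ} (hB : B.IsHermitian)
    (m x : St D) : HasGradientAt (fun y : St D => 1 / 2 * inner ℝ (y - m) (act B (y - m)))
      (act B (x - m)) x := by
  have h1 : HasFDerivAt (fun y : St D => y - m) (ContinuousLinearMap.id ℝ (St D)) x :=
    (hasFDerivAt_id x).sub_const m
  have h2 : HasFDerivAt (fun y : St D => act B (y - m))
      ((Matrix.toEuclideanCLM (𝕜 := ℝ) B : St D →L[ℝ] St D).comp
        (ContinuousLinearMap.id ℝ (St D))) x :=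
    (ContinuousLinearMap.hasFDerivAt _).comp x h1
  have h3 := (h1.inner ℝ h2).const_mul (1 / 2)
  rw [hasGradientAt_iff_hasFDerivAt]
  refine h3.congr_fderiv ?_
  ext v
  have h4 : inner ℝ (x - m) (act B v) = inner ℝ (act B (x - m)) v := inner_act_comm hB _ _
  have h5 : (Matrix.toEuclideanCLM (𝕜 := ℝ) B : St D →L[ℝ] St D) v = act B v := rfl
  simp [h4, h5, real_inner_comm v]
  ring

section Shift

variable {D T : ℕ} {m : Fin T → St D} {C : Fin T → Matrix (Fin D) (Fin D) ℝ}
  {G : Fin T → St D → ℝ} {δ : Fin T → ℝ} {κ : ℝ} {t : Fin T}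

/-- The two Langevin shifts differ by the drift `-κ (δ / 2) C⁻¹ (x - m)` of the Gaussian prior. -/
theorem malaShift_factorised (hC : (C t).PosDef) (hGpos : ∀ x, 0 < G t x)
    (hGd : Differentiable ℝ (G t)) (z x : St D) :
    malaShift (Model.factorised m C G) δ κ t z x =
      gradShift (Model.factorised m C G) δ κ t z x -
        (κ * (δ t / 2)) • act (C t)⁻¹ (x - m t) := by
  have hG : HasGradientAt (fun y => Real.log (G t y)) (gradient (fun y => Real.log (G t y)) x) x :=
    ((hGd x).log (hGpos x).ne').hasGradientAt
  have hB := hasGradientAt_inner_act hC.inv.isHermitian (m t) x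
  have hfun : (fun y => Real.log ((Model.factorised m C G).Q t z y)) = fun y =>
      (Real.log (G t y) - 1 / 2 * inner ℝ (y - m t) (act (C t)⁻¹ (y - m t))) +
        -Real.log (Real.sqrt ((2 * Real.pi) ^ D * (C t).det)) := by
    funext y
    simp only [Model.factorised, Model.Q, Model.M]
    rw [Real.log_mul (gaussDensity_pos hC _ _).ne' (hGpos y).ne', log_gaussDensity hC]
    ring
  have h : gradient (fun y => Real.log ((Model.factorised m C G).Q t z y)) x =
      gradient (fun y => Real.log (G t y)) x - act (C t)⁻¹ (x - m t) := by
    rw [hfun]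
    refine HasGradientAt.gradient ?_
    rw [hasGradientAt_iff_hasFDerivAt] at hG hB ⊢
    rw [map_sub]
    exact (hG.sub hB).add_const _
  rw [malaShift, gradShift, Model.gradLogQ, h, smul_sub, Model.gradLogG]
  rfl

end Shift

/-! ### Comparison of log-densities and log-weights -/

/-- A constant that dominates all errors between the log-densities and log-weights of the
algorithms with and without preconditioning, when `d` is the step size. -/
def errConst (N : ℕ) (d : ℝ) : ℝ := (8 + d) + (2 * N + 3 + 10 / d) * (3 + d) ^ 2

theorem le_errConst (N : ℕ) {d : ℝ} (hd : 0 < d) : 8 + d ≤ errConst N d := by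
  unfold errConst
  have : 0 ≤ (2 * (N : ℝ) + 3 + 10 / d) * (3 + d) ^ 2 := by positivity
  linarith

theorem abs_inner_le_mul {E : Type*} [NormedAddCommGroup E] [InnerProductSpace ℝ E] {a b : E}
    {α β : ℝ} (ha : ‖a‖ ≤ α) (hb : ‖b‖ ≤ β) : |inner ℝ a b| ≤ α * β :=
  (abs_real_inner_le_norm _ _).trans
    (mul_le_mul ha hb (norm_nonneg _) ((norm_nonneg _).trans ha))

section Comparison

variable {D T : ℕ} {m : Fin T → St D} {C : Fin T → Matrix (Fin D) (Fin D) ℝ}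
  {G : Fin T → St D → ℝ} {δ : Fin T → ℝ} {κ : ℝ} {t : Fin T} {lam S : ℝ}

/-- The prior drift at a point of norm at most `S`. -/
theorem norm_priorDrift_le (hδ : 0 < δ t) (hκ : |κ| ≤ 1) (hC : (C t).PosDef) (hlam : 0 < lam)
    (hco : ∀ x : St D, lam * ‖x‖ ^ 2 ≤ inner ℝ x (act (C t) x)) {x : St D} (hm : ‖m t‖ ≤ S)
    (hx : ‖x‖ ≤ S) : ‖(κ * (δ t / 2)) • act (C t)⁻¹ (x - m t)‖ ≤ δ t * (lam⁻¹ * S) := by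
  have h1 : ‖act (C t)⁻¹ (x - m t)‖ ≤ lam⁻¹ * ‖x - m t‖ :=
    norm_act_inv_le hlam (isUnit_det_of_posDef hC) hco _
  have h2 : ‖x - m t‖ ≤ 2 * S := (norm_sub_le _ _).trans (by linarith)
  rw [norm_smul, norm_mul, Real.norm_eq_abs, Real.norm_of_nonneg (half_pos hδ).le]
  calc |κ| * (δ t / 2) * ‖act (C t)⁻¹ (x - m t)‖
      ≤ 1 * (δ t / 2) * (lam⁻¹ * (2 * S)) := by
        gcongr
        exact h1.trans (by gcongr)
    _ = _ := by ring

theorem abs_sq_norm_sub_le (hδ : 0 < δ t) (hlam : 1 ≤ lam) (hS : 1 ≤ S) {r φ d : St D}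
    (hr : ‖r‖ ≤ 2 * S) (hφ : ‖φ‖ ≤ S) (hd : ‖d‖ ≤ δ t * (lam⁻¹ * S)) :
    |1 / δ t * (‖r - (φ - d)‖ ^ 2 - ‖r - φ‖ ^ 2)| ≤ (6 + δ t) * (lam⁻¹ * S ^ 2) := by
  have he : lam⁻¹ ≤ 1 := inv_le_one_of_one_le₀ hlam
  have he0 : 0 < lam⁻¹ := inv_pos.2 (by linarith)
  have h1 : ‖r - (φ - d)‖ ^ 2 - ‖r - φ‖ ^ 2 = 2 * inner ℝ (r - φ) d + inner ℝ d d := by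
    rw [show r - (φ - d) = (r - φ) + d by abel, norm_add_sq_real, real_inner_self_eq_norm_sq]
    ring
  have hrφ : ‖r - φ‖ ≤ 3 * S := (norm_sub_le _ _).trans (by linarith)
  have hd' : ‖d‖ ≤ δ t * S := hd.trans (by
    have : lam⁻¹ * S ≤ 1 * S := by gcongr
    nlinarith)
  have h2 := abs_inner_le_mul hrφ hd
  have h3 := abs_inner_le_mul hd hd'
  rw [h1, abs_mul, abs_of_pos (by positivity : 0 < 1 / δ t)]
  calc 1 / δ t * |2 * inner ℝ (r - φ) d + inner ℝ d d|
      ≤ 1 / δ t * (2 * (3 * S * (δ t * (lam⁻¹ * S))) + δ t * (lam⁻¹ * S) * (δ t * S)) := by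
        gcongr
        refine (abs_add_le _ _).trans (add_le_add ?_ h3)
        rw [abs_mul, abs_two]
        gcongr
    _ = _ := by field_simp; ring

theorem inner_act_inv_C_le (hC : (C t).PosDef) (hlam : 0 < lam)
    (hco : ∀ x : St D, lam * ‖x‖ ^ 2 ≤ inner ℝ x (act (C t) x)) {x : St D} (hm : ‖m t‖ ≤ S)
    (hx : ‖x‖ ≤ S) :
    |1 / 2 * inner ℝ (x - m t) (act (C t)⁻¹ (x - m t))| ≤ 2 * (lam⁻¹ * S ^ 2) := by
  have h2 : ‖x - m t‖ ≤ 2 * S := (norm_sub_le _ _).trans (by linarith)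
  have h1 := abs_inner_act_le (fun y => norm_act_inv_le hlam (isUnit_det_of_posDef hC) hco y)
    (x - m t) (x - m t)
  rw [abs_mul, abs_of_pos (by norm_num : (0 : ℝ) < 1 / 2)]
  have h3 : ‖x - m t‖ * ‖x - m t‖ ≤ 2 * S * (2 * S) :=
    mul_le_mul h2 h2 (norm_nonneg _) ((norm_nonneg _).trans h2)
  have h4 : lam⁻¹ * (‖x - m t‖ * ‖x - m t‖) ≤ lam⁻¹ * (2 * S * (2 * S)) := by gcongr
  linarith

/-- Comparison of the laws of the auxiliary variables. -/
theorem log_auxDensity_sub_le (hδ : 0 < δ t) (hκ : |κ| ≤ 1) (hC : (C t).PosDef)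
    (hGpos : ∀ x, 0 < G t x) (hGd : Differentiable ℝ (G t)) (hlam : 1 ≤ lam)
    (hco : ∀ x : St D, lam * ‖x‖ ^ 2 ≤ inner ℝ x (act (C t) x)) {x u z z' : St D} (hS : 1 ≤ S)
    (hm : ‖m t‖ ≤ S) (hx : ‖x‖ ≤ S) (hu : ‖u‖ ≤ S)
    (hφ : ‖gradShift (Model.factorised m C G) δ κ t z x‖ ≤ S) :
    |Real.log (gaussDensity (x + malaShift (Model.factorised m C G) δ κ t z x) (isoCov δ t) u) -
      Real.log (gaussDensity (x + gradShift (Model.factorised m C G) δ κ t z' x) (isoCov δ t) u)|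
      ≤ (6 + δ t) * (lam⁻¹ * S ^ 2) := by
  have hd := norm_priorDrift_le hδ hκ hC (by linarith) hco hm hx
  have hr : ‖u - x‖ ≤ 2 * S := (norm_sub_le _ _).trans (by linarith)
  have h := abs_sq_norm_sub_le hδ hlam hS hr hφ hd
  rw [← malaShift_factorised (δ := δ) (κ := κ) hC hGpos hGd z x] at h
  have hz : gradShift (Model.factorised m C G) δ κ t z' x =
      gradShift (Model.factorised m C G) δ κ t z x := rfl
  rw [hz, log_gaussDensity_isoCov hδ, log_gaussDensity_isoCov hδ, ← sub_sub, ← sub_sub, ← abs_neg]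
  convert h using 2
  ring

/-- Comparison of the proposals. The normalising constants and the term with `1 - A` have the
right sign. -/
theorem log_proposalDensity_sub_le (hδ : 0 < δ t) (hC : (C t).PosDef) (hlam : 1 ≤ lam)
    (hco : ∀ x : St D, lam * ‖x‖ ^ 2 ≤ inner ℝ x (act (C t) x)) {x u z : St D}
    (hm : ‖m t‖ ≤ S) (hx : ‖x‖ ≤ S) :
    Real.log (gaussDensity u (isoCov δ t) x) -
      Real.log (gaussDensity (agradMean (Model.factorised m C G) δ t z u)
        (agradCov (Model.factorised m C G) δ t) x) ≤ 2 * (lam⁻¹ * S ^ 2) := by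
  have hC' : ((Model.factorised m C G).C t).PosDef := hC
  have hcov : (agradCov (Model.factorised m C G) δ t).PosDef := posDef_agradCov hδ hC'
  have h1 := (abs_le.1 (inner_act_inv_C_le hC (by linarith) hco hm hx)).2
  have h2 := inner_act_self_nonneg (posSemidef_one_sub_matA hδ hC')
    (u - (Model.factorised m C G).m t z)
  have hd := det_agradCov_le hδ hC'
  have hd0 := hcov.det_pos
  have h3 : Real.log (Real.sqrt ((2 * Real.pi) ^ D *
      (agradCov (Model.factorised m C G) δ t).det)) ≤
      Real.log (Real.sqrt ((2 * Real.pi) ^ D * (isoCov (D := D) δ t).det)) := by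
    refine Real.log_le_log (by positivity) ?_
    gcongr
  rw [log_gaussDensity_isoCov hδ, log_gaussDensity hcov, inner_agradCov_inv hδ hC']
  have h4 : 0 ≤ 1 / δ t * inner ℝ (u - (Model.factorised m C G).m t z)
      (act (1 - matA (Model.factorised m C G) δ t) (u - (Model.factorised m C G).m t z)) := by
    positivity
  have h5 : (Model.factorised m C G).m t z = m t := rfl
  have h6 : (Model.factorised m C G).C t = C t := rfl
  rw [h5, h6]
  rw [h5] at h4
  have e1 : ∀ a b c : ℝ, 1 / 2 * (2 / δ t * a + b - 2 / δ t * c) =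
      1 / δ t * a + 1 / 2 * b - 1 / δ t * c := fun a b c => by ring
  rw [e1]
  linarith

/-- Comparison of the weights of Particle-aMALA and Particle-aGRAD: the term with `1 - A` depends on
the auxiliary variable only, and cancels in the normalisation. -/
theorem log_amalaPotential_sub (hδ : 0 < δ t) (hκ : |κ| ≤ 1) (hC : (C t).PosDef)
    (hGpos : ∀ x, 0 < G t x) (hGd : Differentiable ℝ (G t)) (hlam : 1 ≤ lam)
    (hco : ∀ x : St D, lam * ‖x‖ ^ 2 ≤ inner ℝ x (act (C t) x)) (u : St D) :
    ∃ a : ℝ, ∀ (x z z' : St D) (S : ℝ), 1 ≤ S → ‖m t‖ ≤ S → ‖x‖ ≤ S → ‖u‖ ≤ S →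
      ‖gradShift (Model.factorised m C G) δ κ t z x‖ ≤ S →
      |Real.log (amalaPotential (Model.factorised m C G) δ κ t z x u) -
        Real.log (agradPotential (Model.factorised m C G) δ κ t z' x u) - a| ≤
        (8 + δ t) * (lam⁻¹ * S ^ 2) := by
  have hC' : ((Model.factorised m C G).C t).PosDef := hC
  have hcov : (agradCov (Model.factorised m C G) δ t).PosDef := posDef_agradCov hδ hC'
  have hiso : (isoCov (D := D) δ t).PosDef := Matrix.PosDef.one.smul (half_pos hδ)
  refine ⟨Real.log (Real.sqrt ((2 * Real.pi) ^ D * (isoCov (D := D) δ t).det)) -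
    Real.log (Real.sqrt ((2 * Real.pi) ^ D * (agradCov (Model.factorised m C G) δ t).det)) +
    1 / δ t * inner ℝ (u - m t) (act (1 - matA (Model.factorised m C G) δ t) (u - m t)),
    fun x z z' S hS hm hx hu hφ => ?_⟩
  have h1 := inner_act_inv_C_le hC (by linarith) hco hm hx
  have h2 := log_auxDensity_sub_le (z := z) (z' := z') hδ hκ hC hGpos hGd hlam hco hS hm hx hu hφ
  have hQ : 0 < (Model.factorised m C G).Q t z x := mul_pos (gaussDensity_pos hC' _ _) (hGpos x)
  have hQ' : (Model.factorised m C G).Q t z' x = (Model.factorised m C G).Q t z x := rfl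
  have hp1 := gaussDensity_pos hiso (x + malaShift (Model.factorised m C G) δ κ t z x) u
  have hp2 := gaussDensity_pos hiso (x + gradShift (Model.factorised m C G) δ κ t z' x) u
  have hp3 := gaussDensity_pos hiso x u
  have hp4 := gaussDensity_pos hcov (agradMean (Model.factorised m C G) δ t z' u) x
  rw [amalaPotential, agradPotential, hQ', Real.log_mul hQ.ne' (div_pos hp1 hp3).ne',
    Real.log_mul hQ.ne' (div_pos hp2 hp4).ne', Real.log_div hp1.ne' hp3.ne',
    Real.log_div hp2.ne' hp4.ne', log_gaussDensity_isoCov hδ x u, log_gaussDensity hcov,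
    inner_agradCov_inv hδ hC']
  have h5 : (Model.factorised m C G).m t z' = m t := rfl
  have h6 : (Model.factorised m C G).C t = C t := rfl
  rw [h5, h6, norm_sub_rev u x]
  have e1 : ∀ a b c : ℝ, 1 / 2 * (2 / δ t * a + b - 2 / δ t * c) =
      1 / δ t * a + 1 / 2 * b - 1 / δ t * c := fun a b c => by ring
  rw [e1]
  rw [abs_le] at h1 h2 ⊢
  constructor <;> linarith [h1.1, h1.2, h2.1, h2.2]

/-- The exponent in the weights of Particle-MALA changes little if the shift changes little. -/
theorem log_malaFactor_sub_le (N : ℕ) (hδ : 0 < δ t) (hlam : 1 ≤ lam) (hS : 1 ≤ S)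
    {x xbar φ d : St D} (hx : ‖x‖ ≤ S) (hxbar : ‖xbar‖ ≤ S)
    (hφ : ‖φ‖ ≤ S) (hd : ‖d‖ ≤ δ t * (lam⁻¹ * S)) :
    |Real.log (malaFactor N δ t (φ - d) x xbar) - Real.log (malaFactor N δ t φ x xbar)| ≤
      (6 + δ t) * (lam⁻¹ * S ^ 2) := by
  have he : lam⁻¹ ≤ 1 := inv_le_one_of_one_le₀ hlam
  have he0 : 0 < lam⁻¹ := inv_pos.2 (by linarith)
  have hd' : ‖d‖ ≤ δ t * S := hd.trans (by
    have : lam⁻¹ * S ≤ 1 * S := by gcongr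
    nlinarith)
  have hxx : ‖xbar - x‖ ≤ 2 * S := (norm_sub_le _ _).trans (by linarith)
  have h1 := abs_inner_le_mul hd hxx
  have h2 := abs_inner_le_mul hφ hd
  have h3 := abs_inner_le_mul hd hd'
  have hN1 : (N : ℝ) / ((N : ℝ) + 1) ≤ 1 := (div_le_one (by positivity)).2 (by linarith)
  have hN0 : 0 ≤ (N : ℝ) / ((N : ℝ) + 1) := by positivity
  set ρ := (N : ℝ) / ((N : ℝ) + 1)
  have e : Real.log (malaFactor N δ t (φ - d) x xbar) - Real.log (malaFactor N δ t φ x xbar) =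
      1 / δ t * (-2 * inner ℝ d (xbar - x) + ρ * (2 * inner ℝ φ d - inner ℝ d d)) := by
    rw [malaFactor, malaFactor, Real.log_exp, Real.log_exp]
    simp only [inner_sub_left, inner_sub_right, real_inner_comm φ d]
    ring
  rw [e, abs_mul, abs_of_pos (by positivity : 0 < 1 / δ t)]
  have h4 : |-2 * inner ℝ d (xbar - x) + ρ * (2 * inner ℝ φ d - inner ℝ d d)| ≤
      2 * (δ t * (lam⁻¹ * S) * (2 * S)) + 1 * (2 * (S * (δ t * (lam⁻¹ * S))) +
        δ t * (lam⁻¹ * S) * (δ t * S)) := by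
    refine (abs_add_le _ _).trans (add_le_add ?_ ?_)
    · rw [abs_mul, abs_neg, abs_two]; gcongr
    · rw [abs_mul, abs_of_nonneg hN0]
      gcongr
      refine (abs_sub _ _).trans (add_le_add ?_ h3)
      rw [abs_mul, abs_two]; gcongr
  calc 1 / δ t * |-2 * inner ℝ d (xbar - x) + ρ * (2 * inner ℝ φ d - inner ℝ d d)| ≤
      1 / δ t * (2 * (δ t * (lam⁻¹ * S) * (2 * S)) + 1 * (2 * (S * (δ t * (lam⁻¹ * S))) +
        δ t * (lam⁻¹ * S) * (δ t * S))) := by gcongr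
    _ = _ := by field_simp; ring

/-- As the prior covariance grows, `A` tends to `1` and `v` to `0`, and the exponent in the weights
of Particle-mGRAD tends to that in the weights of Particle-MALA. -/
theorem log_malaFactor_sub_log_mgradFactor_le (N : ℕ) {F : Model D T} (hδ : 0 < δ t)
    (hC : (F.C t).PosDef) (hlam : 1 ≤ lam)
    (hco : ∀ x : St D, lam * ‖x‖ ^ 2 ≤ inner ℝ x (act (F.C t) x)) {x xbar φ z : St D} (hS : 1 ≤ S)
    (hm : ‖F.m t z‖ ≤ S) (hx : ‖x‖ ≤ S) (hxbar : ‖xbar‖ ≤ S) (hφ : ‖φ‖ ≤ S) :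
    |Real.log (malaFactor N δ t φ x xbar) -
      Real.log (mgradFactor N F δ t φ x (mgradV F δ t z) xbar (mgradV F δ t z))| ≤
      (2 * N + 3 + 10 / δ t) * (3 + δ t) ^ 2 * (lam⁻¹ * S ^ 2) := by
  have hlam0 : 0 < lam := by linarith
  have he : lam⁻¹ ≤ 1 := inv_le_one_of_one_le₀ hlam
  have he0 : 0 < lam⁻¹ := inv_pos.2 hlam0
  have hN0 : (0 : ℝ) < (N : ℝ) + 1 := by positivity
  have hv : ‖mgradV F δ t z‖ ≤ lam⁻¹ * (δ t / 2 * S) := by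
    refine (norm_act_one_sub_matA_le hC hlam0 hco hδ _).trans ?_
    calc δ t / 2 * lam⁻¹ * ‖F.m t z‖ ≤ δ t / 2 * lam⁻¹ * S := by gcongr
      _ = _ := by ring
  generalize mgradV F δ t z = v at *
  set g := 2 / δ t / ((N : ℝ) + 1) with hg
  have hg0 : 0 < g := by positivity
  have hg1 : g ≤ 2 / δ t := div_le_self (by positivity) (by linarith [N.cast_nonneg (α := ℝ)])
  have hg2 : ((N : ℝ) + 1) * g = 2 / δ t := by rw [hg]; field_simp
  set R := matG N F δ t - g • (1 : Matrix (Fin D) (Fin D) ℝ) with hR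
  set R' := matA F δ t * matG N F δ t - g • (1 : Matrix (Fin D) (Fin D) ℝ) with hR'
  -- All vectors below have norm at most `M`, and `v` even has norm at most `λ⁻¹ M`.
  set M := (3 + δ t) * S with hM
  have hM0 : 0 ≤ M := by positivity
  have hv1 : ‖v‖ ≤ lam⁻¹ * M := hv.trans (by gcongr; linarith)
  have hv2 : ‖v‖ ≤ δ t * S := hv.trans (by
    have : lam⁻¹ * (δ t / 2 * S) ≤ 1 * (δ t / 2 * S) := by gcongr
    nlinarith)
  have hδS : 0 ≤ δ t * S := by positivity
  have hMe : M = 3 * S + δ t * S := by rw [hM]; ring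
  have hxM : ‖x‖ ≤ M := by linarith
  have hvM : ‖v‖ ≤ M := by linarith
  have hpM : ‖x - v‖ ≤ M := (norm_sub_le _ _).trans (by linarith)
  have hqM : ‖x + φ‖ ≤ M := (norm_add_le _ _).trans (by linarith)
  have hbM : ‖xbar - v‖ ≤ M := (norm_sub_le _ _).trans (by linarith)
  have hwM : ‖v + φ‖ ≤ M := (norm_add_le _ _).trans (by linarith)
  have hbwM : ‖xbar - v - φ‖ ≤ M := (norm_sub_le _ _).trans (by
    linarith [norm_sub_le xbar v])
  have bR : ∀ {a b : St D}, ‖a‖ ≤ M → ‖b‖ ≤ M → |inner ℝ a (act R b)| ≤ lam⁻¹ * M ^ 2 :=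
    fun ha hb => (abs_inner_act_le (norm_act_matG_sub_le hC hlam0 hco N hδ) _ _).trans (by
      rw [sq]; gcongr)
  have bR' : |inner ℝ (x + φ) (act R' (x + φ))| ≤ 2 * (lam⁻¹ * M ^ 2) :=
    (abs_inner_act_le (c := 2 * lam⁻¹) (fun y => by
      rw [mul_assoc]; exact norm_act_matA_matG_sub_le hC hlam0 hco N hδ y) _ _).trans (by
      rw [sq, mul_assoc]; gcongr)
  have bC : |inner ℝ (x - v) (act (F.C t)⁻¹ (x - v))| ≤ lam⁻¹ * M ^ 2 :=
    (abs_inner_act_le (norm_act_inv_C_le hC hlam0 hco) _ _).trans (by rw [sq]; gcongr)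
  have bv : ∀ {a : St D}, ‖a‖ ≤ M → |inner ℝ a v| ≤ lam⁻¹ * M ^ 2 := fun ha =>
    (abs_inner_le_mul ha hv1).trans (by rw [sq]; linarith)
  -- The terms without `C⁻¹`, `R`, `R'` or `v` cancel because `(N + 1) g = 2 / δ`.
  have e : Real.log (malaFactor N δ t φ x xbar) -
      Real.log (mgradFactor N F δ t φ x v xbar v) =
      -(1 / 2 * inner ℝ (x - v) (act (F.C t)⁻¹ (x - v))) -
      1 / 2 * inner ℝ (x - v) (act R (x - v)) +
      N * (1 / 2 * inner ℝ (x + φ) (act R' (x + φ))) + inner ℝ (x - v) (act R (x + φ)) -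
      (N + 1) * inner ℝ (xbar - v) (act R (v + φ)) +
      (2 / δ t + g) * (inner ℝ x v - 1 / 2 * inner ℝ v v) - g * inner ℝ (x + φ) v -
      2 / δ t * inner ℝ (xbar - v - φ) v := by
    have hGR : matG N F δ t = R + g • 1 := by rw [hR]; abel
    have hGR' : matA F δ t * matG N F δ t = R' + g • 1 := by rw [hR']; abel
    have hN : ∀ a b : ℝ, 1 / δ t * (2 * a - (N : ℝ) / ((N : ℝ) + 1) * b) =
        ((N : ℝ) + 1) * g * a - N * g / 2 * b := fun a b => by rw [hg]; field_simp
    rw [malaFactor, mgradFactor, Real.log_exp, Real.log_exp, hGR', hGR, agradCov_inv hδ hC, hN,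
      ← hg2]
    simp only [act_add_left, act_smul_left, act_one, inner_add_right (x - v),
      inner_add_right (x + φ), inner_add_right (xbar - v), real_inner_smul_right]
    generalize inner ℝ (x - v) (act (F.C t)⁻¹ (x - v)) = i1
    generalize inner ℝ (x - v) (act R (x - v)) = i2
    generalize inner ℝ (x + φ) (act R' (x + φ)) = i3
    generalize inner ℝ (x - v) (act R (x + φ)) = i4
    generalize inner ℝ (xbar - v) (act R (v + φ)) = i5
    simp only [inner_add_left, inner_sub_left, inner_sub_right, real_inner_comm x φ,
      real_inner_comm x v, real_inner_comm φ v, real_inner_comm xbar φ]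
    ring
  have hB : (2 * N + 3 + 10 / δ t) * (3 + δ t) ^ 2 * (lam⁻¹ * S ^ 2) =
      (2 * N + 3 + 10 / δ t) * (lam⁻¹ * M ^ 2) := by rw [hM]; ring
  have c1 := bC
  have c2 := bR hpM hpM
  have c4 := bR hpM hqM
  have c5 := bR hbM hwM
  have c6 := bv hxM
  have c7 := bv hvM
  have c8 := bv hqM
  have c9 := bv hbwM
  rw [e, hB]
  have hB0 : 0 ≤ lam⁻¹ * M ^ 2 := by positivity
  generalize lam⁻¹ * M ^ 2 = B at *
  have d3 : |(N : ℝ) * (1 / 2 * inner ℝ (x + φ) (act R' (x + φ)))| ≤ N * B := by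
    rw [abs_mul, abs_mul, Nat.abs_cast, abs_of_pos (by norm_num : (0 : ℝ) < 1 / 2)]
    gcongr
    linarith
  have d5 : |((N : ℝ) + 1) * inner ℝ (xbar - v) (act R (v + φ))| ≤ (N + 1) * B := by
    rw [abs_mul, abs_of_pos hN0]
    gcongr
  have d6 : |(2 / δ t + g) * (inner ℝ x v - 1 / 2 * inner ℝ v v)| ≤ 6 * (1 / δ t * B) := by
    rw [abs_mul, abs_of_pos (by positivity)]
    calc (2 / δ t + g) * |inner ℝ x v - 1 / 2 * inner ℝ v v|
        ≤ (2 / δ t + 2 / δ t) * (B + 1 / 2 * B) := by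
          gcongr
          refine (abs_sub _ _).trans (add_le_add c6 ?_)
          rw [abs_mul, abs_of_pos (by norm_num : (0 : ℝ) < 1 / 2)]
          gcongr
      _ = _ := by ring
  have d8 : |g * inner ℝ (x + φ) v| ≤ 2 * (1 / δ t * B) := by
    rw [abs_mul, abs_of_pos hg0]
    calc g * |inner ℝ (x + φ) v| ≤ 2 / δ t * B := by gcongr
      _ = _ := by ring
  have d9 : |2 / δ t * inner ℝ (xbar - v - φ) v| ≤ 2 * (1 / δ t * B) := by
    rw [abs_mul, abs_of_pos (by positivity)]
    calc 2 / δ t * |inner ℝ (xbar - v - φ) v| ≤ 2 / δ t * B := by gcongr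
      _ = _ := by ring
  have hfin : (2 * (N : ℝ) + 3 + 10 / δ t) * B = N * B + (N + 1) * B + 2 * B +
    10 * (1 / δ t * B) := by ring
  rw [hfin]
  rw [abs_le] at c1 c2 c4 d3 d5 d6 d8 d9 ⊢
  constructor <;> linarith [c1.1, c1.2, c2.1, c2.2, c4.1, c4.2, d3.1, d3.2, d5.1, d5.2, d6.1,
    d6.2, d8.1, d8.2, d9.1, d9.2]

end Comparison

/-! ### Second moments and the error of one time step -/

/-- The weight function `1 + ‖x‖ ^ 2` in which all errors are measured. -/
def quadWeight {D : ℕ} (x : St D) : ℝ≥0∞ := ENNReal.ofReal (1 + ‖x‖ ^ 2)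

section Moments

variable {D : ℕ}

theorem measurable_quadWeight : Measurable (quadWeight : St D → ℝ≥0∞) := by
  unfold quadWeight; fun_prop

theorem multivariateGaussian_eq_map (u : St D) (S : Matrix (Fin D) (Fin D) ℝ) :
    multivariateGaussian u S = (multivariateGaussian 0 S).map fun y => u + y := by
  rw [multivariateGaussian, multivariateGaussian,
    Measure.map_map (by fun_prop) (by fun_prop)]
  congr 1
  funext y
  simp

theorem lintegral_quadWeight_ne_top (S : Matrix (Fin D) (Fin D) ℝ) :
    ∫⁻ y, quadWeight y ∂(multivariateGaussian 0 S) ≠ ∞ := by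
  have h : Integrable (fun y : St D => 1 + ‖y‖ ^ 2) (multivariateGaussian 0 S) :=
    (integrable_const 1).add
      (IsGaussian.memLp_two_id (μ := multivariateGaussian (0 : St D) S)).integrable_norm_pow'
  exact h.lintegral_lt_top.ne

theorem lintegral_quadWeight_le (u : St D) (S : Matrix (Fin D) (Fin D) ℝ) :
    ∫⁻ y, quadWeight y ∂(multivariateGaussian u S) ≤
      2 * (∫⁻ y, quadWeight y ∂(multivariateGaussian 0 S)) * quadWeight u := by
  rw [multivariateGaussian_eq_map, lintegral_map measurable_quadWeight (by fun_prop),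
    mul_comm (2 * _), mul_comm 2, ← mul_assoc, ← lintegral_const_mul _ measurable_quadWeight,
    ← lintegral_mul_const _ (measurable_quadWeight.const_mul _)]
  refine lintegral_mono fun y => ?_
  unfold quadWeight
  have h2 : ENNReal.ofReal ((1 + ‖u‖ ^ 2) * (1 + ‖y‖ ^ 2) * 2) =
      ENNReal.ofReal (1 + ‖u‖ ^ 2) * ENNReal.ofReal (1 + ‖y‖ ^ 2) * 2 := by
    rw [ENNReal.ofReal_mul (by positivity), ENNReal.ofReal_mul (by positivity),
      ENNReal.ofReal_ofNat]
  rw [← h2]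
  refine ENNReal.ofReal_le_ofReal ?_
  have h1 : ‖u + y‖ ^ 2 ≤ (‖u‖ + ‖y‖) ^ 2 := by gcongr; exact norm_add_le _ _
  nlinarith [sq_nonneg (‖u‖ - ‖y‖), mul_nonneg (sq_nonneg ‖u‖) (sq_nonneg ‖y‖)]

theorem lintegral_sum_quadWeight_le {N : ℕ} {s : Step D N} (hs : s.Regular) {u : St D} {V : ℝ≥0∞}
    (hV : ∀ z, ∫⁻ y, quadWeight y ∂(s.proposal z u) ≤ V) (x : St D) (k : Fin (N + 1))
    (z : Fin (N + 1) → St D) :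
    ∫⁻ y, ∑ n, quadWeight (y n) ∂(s.particleLaw x k z u) ≤
      ((N : ℝ≥0∞) + 1) * (quadWeight x + V) := by
  have hm : ∀ n, Measurable fun y : Fin (N + 1) → St D => quadWeight (y n) :=
    fun n => measurable_quadWeight.comp (measurable_pi_apply n)
  rw [lintegral_finsetSum _ fun n _ => hm n]
  have hp : ∀ n, IsProbabilityMeasure (if n = k then Measure.dirac x else s.proposal (z n) u) := by
    intro n
    split_ifs
    · infer_instance
    · exact hs.prop _ _
  calc ∑ n, ∫⁻ y, quadWeight (y n) ∂(s.particleLaw x k z u)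
      ≤ ∑ _n : Fin (N + 1), (quadWeight x + V) := by
        refine Finset.sum_le_sum fun n _ => ?_
        have hmp := measurePreserving_eval
          (fun n => if n = k then Measure.dirac x else s.proposal (z n) u) n
        rw [Step.particleLaw, hmp.lintegral_comp measurable_quadWeight]
        split_ifs
        · rw [lintegral_dirac' _ measurable_quadWeight]; exact le_self_add
        · exact (hV _).trans le_add_self
    _ = _ := by simp [mul_add]

theorem Close.multivariateGaussian {m m' : St D} {S S' : Matrix (Fin D) (Fin D) ℝ}
    (hS : S.PosDef) (hS' : S'.PosDef) {η : St D → ℝ}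
    (h : ∀ x, Real.log (gaussDensity m S x) - Real.log (gaussDensity m' S' x) ≤ η x) :
    Close (multivariateGaussian m S) (multivariateGaussian m' S')
      (∫⁻ x, ENNReal.ofReal (η x) ∂(multivariateGaussian m S)) := by
  rw [multivariateGaussian_eq_withDensity hS, multivariateGaussian_eq_withDensity hS']
  exact Close.of_density (fun x => gaussDensity_pos hS _ _) (fun x => gaussDensity_pos hS' _ _)
    (measurable_gaussDensity measurable_const measurable_id _)
    (measurable_gaussDensity measurable_const measurable_id _) h

theorem norm_average_le {N : ℕ} (y : Fin (N + 1) → St D) : ‖average y‖ ≤ ∑ n, ‖y n‖ := by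
  rw [average, norm_smul, Real.norm_of_nonneg (by positivity)]
  have h1 : ((N : ℝ) + 1)⁻¹ ≤ 1 := inv_le_one_of_one_le₀ (by linarith [N.cast_nonneg (α := ℝ)])
  calc ((N : ℝ) + 1)⁻¹ * ‖∑ n, y n‖ ≤ 1 * ∑ n, ‖y n‖ := by
        gcongr; exact norm_sum_le _ _
    _ = _ := one_mul _

theorem sq_one_add_norms_le {N : ℕ} (u : St D) (y : Fin (N + 1) → St D) :
    (1 + (‖u‖ + ∑ i, ‖y i‖)) ^ 2 ≤
      3 * ((N : ℝ) + 1) * ((1 + ‖u‖ ^ 2) + ∑ i, (1 + ‖y i‖ ^ 2)) := by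
  have hN1 : (1 : ℝ) ≤ (N : ℝ) + 1 := by linarith [N.cast_nonneg (α := ℝ)]
  have hcs : (∑ i, ‖y i‖) ^ 2 ≤ ((N : ℝ) + 1) * ∑ i, ‖y i‖ ^ 2 := by
    have := sq_sum_le_card_mul_sum_sq (s := Finset.univ) (f := fun i => ‖y i‖)
    simpa using this
  have h1 : (1 + (‖u‖ + ∑ i, ‖y i‖)) ^ 2 ≤
      3 * (1 + ‖u‖ ^ 2 + ((N : ℝ) + 1) * ∑ i, ‖y i‖ ^ 2) := by
    nlinarith [sq_nonneg (1 - ‖u‖), sq_nonneg (1 - ∑ i, ‖y i‖),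
      sq_nonneg (‖u‖ - ∑ i, ‖y i‖)]
  have h2 : ∑ i, ‖y i‖ ^ 2 ≤ ∑ i, (1 + ‖y i‖ ^ 2) :=
    Finset.sum_le_sum fun i _ => by linarith
  have h4 : 1 + ‖u‖ ^ 2 ≤ ((N : ℝ) + 1) * (1 + ‖u‖ ^ 2) :=
    le_mul_of_one_le_left (by positivity) hN1
  have h5 : ((N : ℝ) + 1) * ∑ i, ‖y i‖ ^ 2 ≤ ((N : ℝ) + 1) * ∑ i, (1 + ‖y i‖ ^ 2) := by
    gcongr
  linarith

/-- The accumulated error of a time step if all errors are quadratic with the factor `a`. -/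
theorem stepBudget_le {D N : ℕ} {s : Step D N} (hs : s.Regular) {x xp : St D} {a : ℝ}
    (ha : 0 ≤ a) {V W : ℝ≥0∞}
    (hVaux : ∫⁻ u, quadWeight u ∂(s.auxLaw xp x) ≤ V * (W * quadWeight x))
    (hVprop : ∀ z u, ∫⁻ y, quadWeight y ∂(s.proposal z u) ≤ V * quadWeight u)
    (k : Fin (N + 1)) (z : Fin (N + 1) → St D) :
    ENNReal.ofReal a * (quadWeight x + V * (W * quadWeight x)) + ∫⁻ u,
      (((N : ℝ≥0∞) + 1) * (ENNReal.ofReal a * (V * quadWeight u)) +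
        ∫⁻ y, ENNReal.ofReal (((N : ℝ) + 1) * (((N : ℝ) + 1) * (4 *
          (a * ((1 + ‖u‖ ^ 2) + ∑ n, (1 + ‖y n‖ ^ 2)))))) ∂(s.particleLaw x k z u))
        ∂(s.auxLaw xp x) ≤
      ENNReal.ofReal a * ((1 + V * W) + (((N : ℝ≥0∞) + 1) * (V * (V * W)) +
        ENNReal.ofReal (((N : ℝ) + 1) * (((N : ℝ) + 1) * 4)) *
          (V * W + ((N : ℝ≥0∞) + 1) * (1 + V * (V * W))))) * quadWeight x := by
  set K : ℝ≥0∞ := ENNReal.ofReal (((N : ℝ) + 1) * (((N : ℝ) + 1) * 4)) with hK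
  have hy : ∀ u, ∫⁻ y, ENNReal.ofReal (((N : ℝ) + 1) * (((N : ℝ) + 1) * (4 *
      (a * ((1 + ‖u‖ ^ 2) + ∑ n, (1 + ‖y n‖ ^ 2)))))) ∂(s.particleLaw x k z u) ≤
      ENNReal.ofReal a * (K * (quadWeight u +
        ((N : ℝ≥0∞) + 1) * (quadWeight x + V * quadWeight u))) := fun u => by
    have := hs.isProb_particleLaw x k z u
    have e1 : ∀ y : Fin (N + 1) → St D, ENNReal.ofReal (((N : ℝ) + 1) * (((N : ℝ) + 1) * (4 *
        (a * ((1 + ‖u‖ ^ 2) + ∑ n, (1 + ‖y n‖ ^ 2)))))) =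
        ENNReal.ofReal a * K * (quadWeight u + ∑ n, quadWeight (y n)) := fun y => by
      unfold quadWeight
      rw [← ENNReal.ofReal_sum_of_nonneg (fun i _ => by positivity),
        ← ENNReal.ofReal_add (by positivity) (by positivity), hK,
        ← ENNReal.ofReal_mul (by positivity), ← ENNReal.ofReal_mul (by positivity)]
      congr 1
      ring
    have hm : Measurable fun y : Fin (N + 1) → St D => ∑ n, quadWeight (y n) :=
      Finset.measurable_fun_sum _ fun n _ => measurable_quadWeight.comp (measurable_pi_apply n)
    simp only [e1]
    rw [lintegral_const_mul _ (hm.const_add _), lintegral_add_left measurable_const,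
      lintegral_const, measure_univ, mul_one, mul_assoc]
    gcongr
    exact lintegral_sum_quadWeight_le hs (fun z => hVprop z u) x k z
  have := hs.aux xp x
  have hq := measurable_quadWeight (D := D)
  calc ENNReal.ofReal a * (quadWeight x + V * (W * quadWeight x)) + ∫⁻ u,
        (((N : ℝ≥0∞) + 1) * (ENNReal.ofReal a * (V * quadWeight u)) +
        ∫⁻ y, ENNReal.ofReal (((N : ℝ) + 1) * (((N : ℝ) + 1) * (4 *
        (a * ((1 + ‖u‖ ^ 2) + ∑ n, (1 + ‖y n‖ ^ 2)))))) ∂(s.particleLaw x k z u))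
          ∂(s.auxLaw xp x)
      ≤ ENNReal.ofReal a * (quadWeight x + V * (W * quadWeight x)) + ∫⁻ u,
        ENNReal.ofReal a * ((((N : ℝ≥0∞) + 1) * V + K * (1 + ((N : ℝ≥0∞) + 1) * V)) *
          quadWeight u + K * ((N : ℝ≥0∞) + 1) * quadWeight x) ∂(s.auxLaw xp x) := by
        gcongr with u
        refine (add_le_add le_rfl (hy u)).trans (le_of_eq ?_)
        ring
    _ = ENNReal.ofReal a * (quadWeight x + V * (W * quadWeight x) +
        ((((N : ℝ≥0∞) + 1) * V + K * (1 + ((N : ℝ≥0∞) + 1) * V)) *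
          ∫⁻ u, quadWeight u ∂(s.auxLaw xp x) + K * ((N : ℝ≥0∞) + 1) * quadWeight x)) := by
        rw [lintegral_const_mul _ (by fun_prop), lintegral_add_right _ measurable_const,
          lintegral_const_mul _ hq, lintegral_const, measure_univ, mul_one]
        ring
    _ ≤ ENNReal.ofReal a * (quadWeight x + V * (W * quadWeight x) +
        ((((N : ℝ≥0∞) + 1) * V + K * (1 + ((N : ℝ≥0∞) + 1) * V)) *
          (V * (W * quadWeight x)) + K * ((N : ℝ≥0∞) + 1) * quadWeight x)) := by
        gcongr
    _ = _ := by ring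

end Moments

section OneStep

variable {D T N : ℕ} {m : Fin T → St D} {G : Fin T → St D → ℝ} {δ : Fin T → ℝ} {κ : ℝ}
  {t : Fin T} {L : ℝ}

set_option maxHeartbeats 400000 in
/-- The error of one time step of an algorithm with preconditioning, relative to the one without:
it is of order `λ⁻¹ (1 + ‖x‖ ^ 2)` at the reference state `x`, with a constant that depends
on neither the covariances nor `x`. -/
theorem exists_stepsClose (hδ : 0 < δ t) (hκ : |κ| ≤ 1) (hGpos : ∀ x, 0 < G t x)
    (hGd : Differentiable ℝ (G t)) (hL : 1 ≤ L) (hmL : ‖m t‖ ≤ L)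
    (hφL : ∀ x, ‖(κ * (δ t / 2)) • gradient (fun y => Real.log (G t y)) x‖ ≤ L * (1 + ‖x‖)) :
    ∃ B : ℝ≥0∞, B ≠ ∞ ∧ ∀ (C : Fin T → Matrix (Fin D) (Fin D) ℝ) (lam : ℝ), (C t).PosDef →
      1 ≤ lam → (∀ x : St D, lam * ‖x‖ ^ 2 ≤ inner ℝ x (act (C t) x)) →
      ∀ (s s' : Step D N), s.Regular → s'.Regular →
      (∀ z z' x u, s.backward z x u = s.backward z' x u) →
      (∀ z z' x u, s'.backward z x u = s'.backward z' x u) →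
      (∀ xp x, s.auxLaw xp x = multivariateGaussian
        (x + malaShift (Model.factorised m C G) δ κ t xp x) (isoCov δ t)) →
      (∀ xp x, s'.auxLaw xp x = multivariateGaussian
        (x + gradShift (Model.factorised m C G) δ κ t xp x) (isoCov δ t)) →
      (∀ z u, s.proposal z u = multivariateGaussian u (isoCov δ t)) →
      (∀ z u, s'.proposal z u = multivariateGaussian
        (agradMean (Model.factorised m C G) δ t z u) (agradCov (Model.factorised m C G) δ t)) →
      (∀ u, ∃ a, ∀ z z' y n S, 1 ≤ S → ‖m t‖ ≤ S → ‖u‖ ≤ S → ‖y n‖ ≤ S → ‖average y‖ ≤ S →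
        ‖gradShift (Model.factorised m C G) δ κ t (z n) (y n)‖ ≤ S →
        |Real.log (s.weight z y u n) - Real.log (s'.weight z' y u n) - a| ≤
          errConst N (δ t) * (lam⁻¹ * S ^ 2)) →
      ∀ x, StepsClose s s' x (B * ENNReal.ofReal lam⁻¹ * quadWeight x) := by
  set P : ℝ := 3 * ((N : ℝ) + 1) * L ^ 2 with hP
  have hP0 : 0 ≤ P := by positivity
  set E : ℝ := errConst N (δ t) * P with hE
  have hK := le_errConst N hδ
  have hE0 : 0 ≤ E := by
    have : 0 ≤ errConst N (δ t) := by linarith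
    positivity
  set V : ℝ≥0∞ := 2 * ∫⁻ y, quadWeight y ∂(multivariateGaussian (0 : St D) (isoCov δ t)) with hV
  have hVt : V ≠ ∞ := ENNReal.mul_ne_top (by simp) (lintegral_quadWeight_ne_top _)
  set W : ℝ≥0∞ := ENNReal.ofReal (1 + 2 * ((2 + δ t) * L) ^ 2) with hW
  set K : ℝ≥0∞ := ENNReal.ofReal (((N : ℝ) + 1) * (((N : ℝ) + 1) * 4)) with hKdef
  refine ⟨ENNReal.ofReal E * ((1 + V * W) + (((N : ℝ≥0∞) + 1) * (V * (V * W)) +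
    K * (V * W + ((N : ℝ≥0∞) + 1) * (1 + V * (V * W))))), ?_, ?_⟩
  · finiteness
  intro C lam hC hlam hco s s' hs hs' hb hb' haux haux' hprop hprop' hw x
  have hlam0 : 0 < lam := by linarith
  have he0 : 0 < lam⁻¹ := inv_pos.2 hlam0
  have he1 : lam⁻¹ ≤ 1 := inv_le_one_of_one_le₀ hlam
  have hφ : ∀ z y, ‖gradShift (Model.factorised m C G) δ κ t z y‖ ≤ L * (1 + ‖y‖) :=
    fun z y => hφL y
  have hiso : (isoCov (D := D) δ t).PosDef := Matrix.PosDef.one.smul (half_pos hδ)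
  have hC' : ((Model.factorised m C G).C t).PosDef := hC
  have hcov : (agradCov (Model.factorised m C G) δ t).PosDef := posDef_agradCov hδ hC'
  have hN1 : (1 : ℝ) ≤ (N : ℝ) + 1 := by linarith [N.cast_nonneg (α := ℝ)]
  -- Any bound `S ≤ L (1 + ...)` on the norms turns into a quadratic bound on the error.
  have hquad : ∀ {c q : ℝ}, 0 ≤ c → c ≤ errConst N (δ t) → ∀ {S : ℝ}, S ^ 2 ≤ P * q →
      c * (lam⁻¹ * S ^ 2) ≤ E * lam⁻¹ * q := fun {c q} hc0 hc {S} hS => by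
    calc c * (lam⁻¹ * S ^ 2) ≤ errConst N (δ t) * (lam⁻¹ * (P * q)) := by
          gcongr
          linarith
      _ = _ := by rw [hE]; ring
  have hofReal : ∀ {q : ℝ}, ENNReal.ofReal (E * lam⁻¹ * q) =
      ENNReal.ofReal (E * lam⁻¹) * ENNReal.ofReal q := ENNReal.ofReal_mul (by positivity)
  have hWx : ∀ xp, quadWeight (x + malaShift (Model.factorised m C G) δ κ t xp x) ≤
      W * quadWeight x := fun xp => by
    have h1 : ‖(κ * (δ t / 2)) • act (C t)⁻¹ (x - m t)‖ ≤ δ t * (lam⁻¹ * (L * (1 + ‖x‖))) :=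
      norm_priorDrift_le hδ hκ hC hlam0 hco (by nlinarith [norm_nonneg x])
        (by nlinarith [norm_nonneg x])
    have h2 : δ t * (lam⁻¹ * (L * (1 + ‖x‖))) ≤ δ t * (1 * (L * (1 + ‖x‖))) := by gcongr
    have h3 : ‖x + malaShift (Model.factorised m C G) δ κ t xp x‖ ≤
        (2 + δ t) * L * (1 + ‖x‖) := by
      rw [malaShift_factorised hC hGpos hGd]
      have h4 := norm_add_le x (gradShift (Model.factorised m C G) δ κ t xp x -
        (κ * (δ t / 2)) • act (C t)⁻¹ (x - m t))
      have h5 := norm_sub_le (gradShift (Model.factorised m C G) δ κ t xp x)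
        ((κ * (δ t / 2)) • act (C t)⁻¹ (x - m t))
      have h6 := hφ xp x
      have h7 : ‖x‖ ≤ L * (1 + ‖x‖) := by nlinarith [norm_nonneg x]
      linarith
    unfold quadWeight
    rw [hW, ← ENNReal.ofReal_mul (by positivity)]
    refine ENNReal.ofReal_le_ofReal ?_
    have h8 : ‖x + malaShift (Model.factorised m C G) δ κ t xp x‖ ^ 2 ≤
        ((2 + δ t) * L * (1 + ‖x‖)) ^ 2 := by gcongr
    have h9 : (1 + ‖x‖) ^ 2 ≤ 2 * (1 + ‖x‖ ^ 2) := by nlinarith [sq_nonneg (1 - ‖x‖)]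
    have h10 : ((2 + δ t) * L) ^ 2 * (1 + ‖x‖) ^ 2 ≤
        ((2 + δ t) * L) ^ 2 * (2 * (1 + ‖x‖ ^ 2)) := by gcongr
    nlinarith [sq_nonneg ‖x‖]
  have hVaux : ∀ xp, ∫⁻ u, quadWeight u ∂(s.auxLaw xp x) ≤ V * (W * quadWeight x) := fun xp => by
    rw [haux]
    refine (lintegral_quadWeight_le _ _).trans ?_
    gcongr
    exact hWx xp
  have hVprop : ∀ z u, ∫⁻ y, quadWeight y ∂(s.proposal z u) ≤ V * quadWeight u := fun z u => by
    rw [hprop]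
    exact lintegral_quadWeight_le _ _
  have hS1 : ∀ {r : ℝ}, 0 ≤ r → 1 ≤ L * (1 + r) := fun {r} hr => by nlinarith
  have hSL : ∀ {r a : ℝ}, 0 ≤ r → a ≤ L → a ≤ L * (1 + r) := fun {r a} hr ha => by nlinarith
  have hSr : ∀ {r a : ℝ}, 0 ≤ r → a ≤ r → a ≤ L * (1 + r) := fun {r a} hr ha => by nlinarith
  have hSφ : ∀ {r : ℝ} {z y : St D}, ‖y‖ ≤ r →
      ‖gradShift (Model.factorised m C G) δ κ t z y‖ ≤ L * (1 + r) := fun {r z y} hy =>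
    (hφ z y).trans (by gcongr)
  refine ⟨hs, hs', hb, hb', ENNReal.ofReal (E * lam⁻¹) * (quadWeight x + V * (W * quadWeight x)),
    fun u => ENNReal.ofReal (E * lam⁻¹) * (V * quadWeight u),
    fun u y => E * lam⁻¹ * ((1 + ‖u‖ ^ 2) + ∑ n, (1 + ‖y n‖ ^ 2)),
    fun xp xp' => ?_, fun z z' u => ?_, fun u y => by positivity, fun z z' y u => ?_,
    fun xp k z => ?_⟩
  · rw [haux', haux]
    refine (Close.multivariateGaussian hiso hiso (η := fun u => E * lam⁻¹ *
      ((1 + ‖x‖ ^ 2) + (1 + ‖u‖ ^ 2))) fun u => ?_).mono ?_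
    · have hr : 0 ≤ ‖x‖ + ‖u‖ := by positivity
      refine (abs_le.1 (log_auxDensity_sub_le (z := xp) (z' := xp')
        hδ hκ hC hGpos hGd hlam hco (hS1 hr) (hSL hr hmL) (hSr hr (by simp)) (hSr hr (by simp))
        (hSφ (by simp)))).2.trans (hquad (by positivity) (by linarith) ?_)
      rw [mul_pow, hP]
      have h1 : (1 + (‖x‖ + ‖u‖)) ^ 2 ≤ 3 * 1 * ((1 + ‖x‖ ^ 2) + (1 + ‖u‖ ^ 2)) := by
        nlinarith [sq_nonneg (1 - ‖x‖), sq_nonneg (1 - ‖u‖), sq_nonneg (‖x‖ - ‖u‖)]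
      calc L ^ 2 * (1 + (‖x‖ + ‖u‖)) ^ 2
          ≤ L ^ 2 * (3 * ((N : ℝ) + 1) * ((1 + ‖x‖ ^ 2) + (1 + ‖u‖ ^ 2))) := by
            gcongr
            exact h1.trans (by gcongr)
        _ = _ := by ring
    · simp only [hofReal]
      rw [lintegral_const_mul _ (by fun_prop)]
      gcongr
      simp only [fun u : St D => ENNReal.ofReal_add (by positivity : 0 ≤ 1 + ‖x‖ ^ 2)
        (by positivity : 0 ≤ 1 + ‖u‖ ^ 2)]
      rw [lintegral_add_left measurable_const, lintegral_const, measure_univ, mul_one, ← haux]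
      exact add_le_add le_rfl (hVaux xp)
  · rw [hprop', hprop]
    refine (Close.multivariateGaussian hiso hcov (η := fun y => E * lam⁻¹ *
      (1 + ‖y‖ ^ 2)) fun y => ?_).mono ?_
    · have hr := norm_nonneg y
      refine (log_proposalDensity_sub_le hδ hC hlam hco (hSL hr hmL) (hSr hr le_rfl)).trans
        (hquad (by positivity) (by linarith) ?_)
      rw [mul_pow, hP]
      have h1 : (1 + ‖y‖) ^ 2 ≤ 3 * 1 * (1 + ‖y‖ ^ 2) := by nlinarith [sq_nonneg (1 - ‖y‖)]
      calc L ^ 2 * (1 + ‖y‖) ^ 2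
          ≤ L ^ 2 * (3 * ((N : ℝ) + 1) * (1 + ‖y‖ ^ 2)) := by
            gcongr
            exact h1.trans (by gcongr)
        _ = _ := by ring
    · simp only [hofReal]
      rw [lintegral_const_mul _ (by fun_prop), ← hprop z u]
      gcongr
      exact hVprop z u
  · obtain ⟨a, ha⟩ := hw u
    refine ⟨a, fun n => ?_⟩
    have hsum : ‖y n‖ ≤ ∑ i, ‖y i‖ :=
      Finset.single_le_sum (f := fun i => ‖y i‖) (fun i _ => norm_nonneg _) (Finset.mem_univ n)
    have hsum0 : 0 ≤ ∑ i, ‖y i‖ := Finset.sum_nonneg fun i _ => norm_nonneg _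
    have hu0 := norm_nonneg u
    have hr : 0 ≤ ‖u‖ + ∑ i, ‖y i‖ := add_nonneg hu0 hsum0
    refine (ha z z' y n _ (hS1 hr) (hSL hr hmL) (hSr hr (by linarith)) (hSr hr (by linarith))
      (hSr hr (by linarith [norm_average_le y])) (hSφ (by linarith))).trans
      (hquad (by linarith) le_rfl ?_)
    calc (L * (1 + (‖u‖ + ∑ i, ‖y i‖))) ^ 2 = L ^ 2 * (1 + (‖u‖ + ∑ i, ‖y i‖)) ^ 2 := mul_pow ..
      _ ≤ L ^ 2 * (3 * ((N : ℝ) + 1) * ((1 + ‖u‖ ^ 2) + ∑ i, (1 + ‖y i‖ ^ 2))) :=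
        mul_le_mul_of_nonneg_left (sq_one_add_norms_le u y) (sq_nonneg L)
      _ = _ := by rw [hP]; ring
  · refine (stepBudget_le hs (by positivity) (hVaux xp) hVprop k z).trans (le_of_eq ?_)
    rw [ENNReal.ofReal_mul hE0]
    ring

end OneStep

/-! ### Concentration of the target -/

section Target

variable {D T : ℕ}

/-- A bounded potential with finite second moments is integrable: away from the unit ball it is
dominated by `‖x‖ ^ 2 G x`. -/
theorem integrable_of_second_moments {g : St D → ℝ} (hg : ∀ x, 0 < g x) (hgc : Continuous g)
    {B : ℝ} (hB : ∀ x, g x ≤ B) (hmom : ∀ d, Integrable fun x : St D => (x d) ^ 2 * g x) :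
    Integrable g := by
  have h1 : Integrable ((Metric.closedBall (0 : St D) 1).indicator fun _ => B) :=
    (integrable_indicator_iff Metric.isClosed_closedBall.measurableSet).2
      (integrableOn_const (isCompact_closedBall 0 1).measure_lt_top.ne)
  have h2 : Integrable fun x : St D => ∑ d, (x d) ^ 2 * g x :=
    integrable_finsetSum _ fun d _ => hmom d
  refine (h1.add h2).mono' hgc.aestronglyMeasurable (Eventually.of_forall fun x => ?_)
  rw [Real.norm_of_nonneg (hg x).le, Pi.add_apply, ← Finset.sum_mul,
    ← EuclideanSpace.real_norm_sq_eq]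
  have hgx := hg x
  by_cases hx : x ∈ Metric.closedBall (0 : St D) 1
  · rw [Set.indicator_of_mem hx]
    nlinarith [hB x, mul_nonneg (sq_nonneg ‖x‖) hgx.le]
  · rw [Set.indicator_of_notMem hx]
    rw [mem_closedBall_zero_iff, not_le] at hx
    nlinarith [mul_le_mul_of_nonneg_right (by nlinarith : 1 ≤ ‖x‖ ^ 2) hgx.le]

/-- The Gaussian prior of the factorised model without its normalising constant, times the
potentials. -/
def flatDensity (m : Fin T → St D) (C : Fin T → Matrix (Fin D) (Fin D) ℝ)
    (G : Fin T → St D → ℝ) (x : Fin T → St D) : ℝ :=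
  ∏ t, Real.exp (-(1 / 2) * inner ℝ (x t - m t) (act (C t)⁻¹ (x t - m t))) * G t (x t)

theorem measurable_flatDensity {m : Fin T → St D} {C : Fin T → Matrix (Fin D) (Fin D) ℝ}
    {G : Fin T → St D → ℝ} (hGc : ∀ t, Continuous (G t)) : Measurable (flatDensity m C G) := by
  unfold flatDensity act
  refine Finset.measurable_fun_prod _ fun t _ => ?_
  have := (hGc t).measurable
  fun_prop

/-- The normalising constants of the Gaussian priors cancel in the target. -/
theorem target_factorised {m : Fin T → St D} {C : Fin T → Matrix (Fin D) (Fin D) ℝ}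
    {G : Fin T → St D → ℝ} (hC : ∀ t, (C t).PosDef) (hGc : ∀ t, Continuous (G t))
    {A : Set (Fin T → St D)} (hA : MeasurableSet A) :
    (Model.factorised m C G).target A =
      (∫⁻ x, ENNReal.ofReal (flatDensity m C G x))⁻¹ *
        ∫⁻ x, A.indicator (fun x => ENNReal.ofReal (flatDensity m C G x)) x := by
  set c : ℝ := ∏ t, (Real.sqrt ((2 * Real.pi) ^ D * (C t).det))⁻¹ with hc
  have hc0 : 0 < c := Finset.prod_pos fun t _ => by
    have := (hC t).det_pos
    positivity
  have hm := (measurable_flatDensity (m := m) (C := C) hGc).ennreal_ofReal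
  have key : ∀ B, MeasurableSet B → (Model.factorised m C G).unnormalisedTarget B =
      ENNReal.ofReal c * ∫⁻ x, B.indicator (fun x => ENNReal.ofReal (flatDensity m C G x)) x := by
    intro B hB
    rw [Model.unnormalisedTarget, withDensity_apply _ hB, lintegral_indicator hB,
      ← lintegral_const_mul _ hm]
    refine lintegral_congr fun x => ?_
    rw [← ENNReal.ofReal_mul hc0.le, flatDensity, hc, ← Finset.prod_mul_distrib]
    congr 1
    refine Finset.prod_congr rfl fun t _ => ?_
    simp only [Model.Q, Model.M, Model.factorised, gaussDensity]
    ring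
  have h0 : ENNReal.ofReal c ≠ 0 := by simpa using hc0
  rw [Model.target, Measure.smul_apply, smul_eq_mul, key _ hA, key _ MeasurableSet.univ,
    Set.indicator_univ, ENNReal.mul_inv (Or.inl h0) (Or.inl ENNReal.ofReal_ne_top)]
  calc _ = ((ENNReal.ofReal c)⁻¹ * ENNReal.ofReal c) *
        ((∫⁻ x, ENNReal.ofReal (flatDensity m C G x))⁻¹ *
        ∫⁻ x, A.indicator (fun x => ENNReal.ofReal (flatDensity m C G x)) x) := by ring
    _ = _ := by rw [ENNReal.inv_mul_cancel h0 ENNReal.ofReal_ne_top, one_mul]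

theorem measurableSet_balls (r : ℝ) : MeasurableSet {x : Fin T → St D | ∀ t, ‖x t‖ ≤ r} := by
  rw [Set.ofPred_forall]
  exact MeasurableSet.iInter fun t => measurableSet_le (by fun_prop) measurable_const

/-- As the prior covariances grow, the target converges to the probability measure with density
proportional to `∏ t, G t (x t)`, and the mass of increasing balls tends to one. -/
theorem tendsto_target_balls {m : Fin T → St D} {C : ℕ → Fin T → Matrix (Fin D) (Fin D) ℝ}
    {G : Fin T → St D → ℝ} (hC : ∀ k t, (C k t).PosDef) (hG : ∀ t x, 0 < G t x)
    (hGc : ∀ t, Continuous (G t)) (hGi : ∀ t, Integrable (G t)) {lam R : ℕ → ℝ}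
    (hlam0 : ∀ k, 0 < lam k) (hlam : Tendsto lam atTop atTop) (hR : Tendsto R atTop atTop)
    (hco : ∀ k t, ∀ x : St D, lam k * ‖x‖ ^ 2 ≤ inner ℝ x (act (C k t) x)) :
    Tendsto (fun k => (Model.factorised m (C k) G).target {x | ∀ t, ‖x t‖ ≤ R k})
      atTop (𝓝 1) := by
  have hset : ∀ k, MeasurableSet {x : Fin T → St D | ∀ t, ‖x t‖ ≤ R k} := fun k =>
    measurableSet_balls (R k)
  set f : ℕ → (Fin T → St D) → ℝ≥0∞ := fun k x => ENNReal.ofReal (flatDensity m (C k) G x)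
    with hf
  set b : (Fin T → St D) → ℝ≥0∞ := fun x => ENNReal.ofReal (∏ t, G t (x t)) with hb
  have hfm : ∀ k, Measurable (f k) := fun k => (measurable_flatDensity hGc).ennreal_ofReal
  have hbm : Measurable b := by
    refine Measurable.ennreal_ofReal (Finset.measurable_fun_prod _ fun t _ => ?_)
    have := (hGc t).measurable
    fun_prop
  have hquad0 : ∀ k t (x : St D), 0 ≤ inner ℝ x (act (C k t)⁻¹ x) := fun k t x =>
    inner_act_self_nonneg (hC k t).inv.posSemidef x
  have hfb : ∀ k x, f k x ≤ b x := fun k x => by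
    refine ENNReal.ofReal_le_ofReal (Finset.prod_le_prod (fun t _ => ?_) fun t _ => ?_)
    · have := hG t (x t)
      positivity
    · refine mul_le_of_le_one_left (hG t _).le (Real.exp_le_one_iff.2 ?_)
      have := hquad0 k t (x t - m t)
      linarith
  have hbfin : ∫⁻ x, b x ≠ ∞ := by
    have : Integrable fun x : Fin T → St D => ∏ t, G t (x t) := Integrable.fintype_prod hGi
    exact this.lintegral_lt_top.ne
  have hbpos : ∫⁻ x, b x ≠ 0 := fun h => by
    rw [lintegral_eq_zero_iff hbm] at h
    have h2 : ∀ᵐ _x : Fin T → St D, False := h.mono fun x hx => by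
      have : 0 < ∏ t, G t (x t) := Finset.prod_pos fun t _ => hG t _
      simp only [hb, Pi.zero_apply, ENNReal.ofReal_eq_zero] at hx
      linarith
    rw [eventually_false_iff_eq_bot, ae_eq_bot] at h2
    exact (NeZero.ne (volume : Measure (Fin T → St D))) h2
  have hflim : ∀ x, Tendsto (fun k => f k x) atTop (𝓝 (b x)) := fun x => by
    refine (ENNReal.continuous_ofReal.tendsto _).comp ?_
    refine tendsto_finsetProd _ fun t _ => ?_
    have h1 : Tendsto (fun k => inner ℝ (x t - m t) (act (C k t)⁻¹ (x t - m t))) atTop (𝓝 0) := by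
      refine squeeze_zero (g := fun k => (lam k)⁻¹ * (‖x t - m t‖ * ‖x t - m t‖))
        (fun k => hquad0 k t _) (fun k => ?_) ?_
      · exact (le_abs_self _).trans (abs_inner_act_le
          (fun y => norm_act_inv_le (hlam0 k) (isUnit_det_of_posDef (hC k t)) (hco k t) y) _ _)
      · simpa using hlam.inv_tendsto_atTop.mul_const (‖x t - m t‖ * ‖x t - m t‖)
    have h2 := ((h1.const_mul (-(1 / 2))).rexp).mul_const (G t (x t))
    simpa using h2
  have hI : Tendsto (fun k => ∫⁻ x, f k x) atTop (𝓝 (∫⁻ x, b x)) :=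
    tendsto_lintegral_of_dominated_convergence b hfm (fun k => Eventually.of_forall (hfb k)) hbfin
      (Eventually.of_forall hflim)
  have hJ : Tendsto (fun k => ∫⁻ x, {x : Fin T → St D | ∀ t, ‖x t‖ ≤ R k}.indicator (f k) x) atTop
      (𝓝 (∫⁻ x, b x)) := by
    refine tendsto_lintegral_of_dominated_convergence b (fun k => (hfm k).indicator (hset k))
      (fun k => Eventually.of_forall fun x => ?_) hbfin (Eventually.of_forall fun x => ?_)
    · exact (Set.indicator_le_self' (fun _ _ => zero_le) x).trans (hfb k x)
    · refine (hflim x).congr' ?_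
      have : ∀ᶠ k in atTop, ∀ t, ‖x t‖ ≤ R k :=
        eventually_all.2 fun t => hR.eventually_ge_atTop _
      filter_upwards [this] with k hk
      rw [Set.indicator_of_mem (by exact hk)]
  have hfin := ENNReal.Tendsto.mul ((continuous_inv.tendsto _).comp hI)
    (Or.inl (ENNReal.inv_ne_zero.2 hbfin)) hJ (Or.inl hbpos)
  rw [ENNReal.inv_mul_cancel hbpos hbfin] at hfin
  refine hfin.congr fun k => ?_
  rw [target_factorised (hC k) hGc (hset k)]
  rfl

end Target

/-! ### The four algorithms -/

section Algorithms

variable {D T N : ℕ} {m : Fin T → St D} {C : Fin T → Matrix (Fin D) (Fin D) ℝ}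
  {G : Fin T → St D → ℝ} {δ : Fin T → ℝ} {κ : ℝ} {t : Fin T} {lam : ℝ}

theorem average_const (N : ℕ) (v : St D) : (average fun _ : Fin (N + 1) => v) = v := by
  have h : (N : ℝ) + 1 ≠ 0 := by positivity
  rw [average, Finset.sum_const, Finset.card_univ, Fintype.card_fin, ← Nat.cast_smul_eq_nsmul ℝ,
    smul_smul]
  push_cast
  rw [inv_mul_cancel₀ h, one_smul]

/-- The weights of Particle-MALA and Particle-mGRAD. -/
theorem log_malaWeight_sub_le (hδ : 0 < δ t) (hκ : |κ| ≤ 1) (hC : (C t).PosDef)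
    (hGpos : ∀ x, 0 < G t x) (hGd : Differentiable ℝ (G t)) (hlam : 1 ≤ lam)
    (hco : ∀ x : St D, lam * ‖x‖ ^ 2 ≤ inner ℝ x (act (C t) x)) {S : ℝ}
    {z z' y : Fin (N + 1) → St D} {u : St D} {n : Fin (N + 1)} (hS : 1 ≤ S) (hm : ‖m t‖ ≤ S)
    (hy : ‖y n‖ ≤ S) (hav : ‖average y‖ ≤ S)
    (hφ : ‖gradShift (Model.factorised m C G) δ κ t (z n) (y n)‖ ≤ S) :
    |Real.log ((malaStep N (Model.factorised m C G) δ κ t).weight z y u n) -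
      Real.log ((mgradStep N (Model.factorised m C G) δ κ t).weight z' y u n)| ≤
      errConst N (δ t) * (lam⁻¹ * S ^ 2) := by
  set F := Model.factorised m C G with hF
  have hC' : (F.C t).PosDef := hC
  have hQ : 0 < F.Q t (z n) (y n) := mul_pos (gaussDensity_pos hC' _ _) (hGpos _)
  have hQ' : F.Q t (z' n) (y n) = F.Q t (z n) (y n) := rfl
  have hφ' : gradShift F δ κ t (z' n) (y n) = gradShift F δ κ t (z n) (y n) := rfl
  have hv : (average fun i => mgradV F δ t (z' i)) = mgradV F δ t (z n) :=
    average_const N (mgradV F δ t (z n))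
  have hv' : mgradV F δ t (z' n) = mgradV F δ t (z n) := rfl
  have h1 := log_malaFactor_sub_le N hδ hlam hS hy hav hφ
    (norm_priorDrift_le hδ hκ hC (by linarith) hco hm hy)
  have h2 := log_malaFactor_sub_log_mgradFactor_le N (F := F) (z := z n) hδ hC' hlam hco hS hm hy
    hav hφ
  have hw : (malaStep N F δ κ t).weight z y u n = F.Q t (z n) (y n) *
      malaFactor N δ t (malaShift F δ κ t (z n) (y n)) (y n) (average y) := rfl
  have hw' : (mgradStep N F δ κ t).weight z' y u n = F.Q t (z' n) (y n) *
      mgradFactor N F δ t (gradShift F δ κ t (z' n) (y n)) (y n) (mgradV F δ t (z' n))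
      (average y) (average fun i => mgradV F δ t (z' i)) := rfl
  rw [← malaShift_factorised (m := m) (κ := κ) hC hGpos hGd (z n) (y n), ← hF] at h1
  rw [hw, hw', hQ', hφ', hv, hv', Real.log_mul hQ.ne' (by exact (Real.exp_pos _).ne'),
    Real.log_mul hQ.ne' (by exact (Real.exp_pos _).ne'), errConst, add_mul]
  have h3 : 0 ≤ lam⁻¹ * S ^ 2 := by
    have : 0 < lam := by linarith
    positivity
  rw [abs_le] at h1 h2 ⊢
  constructor <;> linarith [h1.1, h1.2, h2.1, h2.2]

/-- One constant per time step serves for both pairs of algorithms. -/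
theorem exists_stepsClose_algorithms (N : ℕ) (hδ : ∀ t, 0 < δ t) (hκ0 : 0 ≤ κ) (hκ1 : κ ≤ 1)
    (hGpos : ∀ t x, 0 < G t x) (hGd : ∀ t, Differentiable ℝ (G t)) {C₀ C₁ : ℝ} (hC₀ : 0 ≤ C₀)
    (hC₁ : 0 ≤ C₁)
    (hG : ∀ x, κ * ‖gradient (fun y => Real.log (G t y)) x‖ ≤ C₀ + C₁ * ‖x‖) :
    ∃ B : ℝ≥0∞, B ≠ ∞ ∧ ∀ (C : Fin T → Matrix (Fin D) (Fin D) ℝ) (lam : ℝ),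
      (∀ t, (C t).PosDef) → 1 ≤ lam →
      (∀ x : St D, lam * ‖x‖ ^ 2 ≤ inner ℝ x (act (C t) x)) → ∀ x,
      StepsClose (malaStep N (Model.factorised m C G) δ κ t)
        (mgradStep N (Model.factorised m C G) δ κ t) x
        (B * ENNReal.ofReal lam⁻¹ * quadWeight x) ∧
      StepsClose (amalaStep N (Model.factorised m C G) δ κ t)
        (agradStep N (Model.factorised m C G) δ κ t) x
        (B * ENNReal.ofReal lam⁻¹ * quadWeight x) := by
  have hκ : |κ| ≤ 1 := abs_le.2 ⟨by linarith, hκ1⟩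
  have hδt := hδ t
  have hCC : 0 ≤ δ t / 2 * (C₀ + C₁) := by positivity
  have hm0 := norm_nonneg (m t)
  obtain ⟨B, hB, h⟩ := exists_stepsClose (N := N) (m := m) (L := 1 + ‖m t‖ + δ t / 2 * (C₀ + C₁))
    hδt hκ (hGpos t) (hGd t) (by linarith) (by linarith) (fun x => by
      rw [norm_smul, norm_mul, Real.norm_of_nonneg hκ0, Real.norm_of_nonneg (half_pos hδt).le]
      calc κ * (δ t / 2) * ‖gradient (fun y => Real.log (G t y)) x‖
          = δ t / 2 * (κ * ‖gradient (fun y => Real.log (G t y)) x‖) := by ring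
        _ ≤ δ t / 2 * ((C₀ + C₁) * (1 + ‖x‖)) := by
          refine mul_le_mul_of_nonneg_left ((hG x).trans ?_) (half_pos hδt).le
          nlinarith [norm_nonneg x, mul_nonneg hC₀ (norm_nonneg x)]
        _ = δ t / 2 * (C₀ + C₁) * (1 + ‖x‖) := by ring
        _ ≤ _ := by gcongr; linarith)
  refine ⟨B, hB, fun C lam hC hlam hco x => ⟨?_, ?_⟩⟩
  · have hr := regular_factorised (m := m) hC hGpos hGd hδ κ
    refine h C lam (hC t) hlam hco _ _ (hr.malaStep N t) (hr.mgradStep N t)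
      (fun _ _ _ _ => rfl) (fun _ _ _ _ => rfl) (fun _ _ => rfl) (fun _ _ => rfl) (fun _ _ => rfl)
      (fun _ _ => rfl) (fun u => ⟨0, fun z z' y n S hS hm _ hy hav hφ => ?_⟩) x
    rw [sub_zero]
    exact log_malaWeight_sub_le hδt hκ (hC t) (hGpos t) (hGd t) hlam hco hS hm hy hav hφ
  · have hr := regular_factorised (m := m) hC hGpos hGd hδ κ
    refine h C lam (hC t) hlam hco _ _ (hr.amalaStep N t) (hr.agradStep N t)
      (fun _ _ _ _ => rfl) (fun _ _ _ _ => rfl) (fun _ _ => rfl) (fun _ _ => rfl) (fun _ _ => rfl)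
      (fun _ _ => rfl) (fun u => ?_) x
    obtain ⟨a, ha⟩ := log_amalaPotential_sub hδt hκ (hC t) (hGpos t) (hGd t) (m := m) hlam hco u
    refine ⟨a, fun z z' y n S hS hm hu hy _ hφ => ?_⟩
    refine (ha (y n) (z n) (z' n) S hS hm hy hu hφ).trans ?_
    have h3 : 0 ≤ lam⁻¹ * S ^ 2 := by
      have : 0 < lam := by linarith
      positivity
    exact mul_le_mul_of_nonneg_right (le_errConst N hδt) h3

/-- On balls of radius `λ ^ (1 / 8)`, errors of order `λ⁻¹ (1 + ‖x‖ ^ 2)` are at most of order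
`λ ^ (-(1 - ε) / 4)`. -/
theorem sum_stepError_le (B : Fin T → ℝ≥0∞) (hB : ∀ t, B t ≠ ∞) (hlam : 1 ≤ lam) {ε : ℝ}
    (hε : 0 < ε) {x : Fin T → St D} (hx : ∀ t, ‖x t‖ ≤ lam ^ (1 / 8 : ℝ)) :
    ∑ t, B t * ENNReal.ofReal lam⁻¹ * quadWeight (x t) ≤
      ENNReal.ofReal ((∑ t, B t).toReal * 2 * lam ^ (-(1 - ε) / 4)) := by
  have hlam0 : 0 < lam := by linarith
  have h1 : ∀ t, lam⁻¹ * (1 + ‖x t‖ ^ 2) ≤ 2 * lam ^ (-(1 - ε) / 4) := fun t => by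
    have h2 : ‖x t‖ ^ 2 ≤ lam ^ (1 / 4 : ℝ) := by
      calc ‖x t‖ ^ 2 ≤ (lam ^ (1 / 8 : ℝ)) ^ 2 := by gcongr; exact hx t
        _ = _ := by rw [← Real.rpow_natCast, ← Real.rpow_mul hlam0.le]; norm_num
    have h3 : 1 ≤ lam ^ (1 / 4 : ℝ) := Real.one_le_rpow hlam (by norm_num)
    calc lam⁻¹ * (1 + ‖x t‖ ^ 2) ≤ lam⁻¹ * (2 * lam ^ (1 / 4 : ℝ)) := by gcongr; linarith
      _ = 2 * lam ^ (-3 / 4 : ℝ) := by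
        rw [← Real.rpow_neg_one, mul_left_comm, ← Real.rpow_add hlam0]; norm_num
      _ ≤ _ := by
        gcongr 2 * ?_
        exact Real.rpow_le_rpow_of_exponent_le hlam (by linarith)
  have hsum : ∑ t, B t ≠ ∞ := ENNReal.sum_ne_top.2 fun t _ => hB t
  rw [mul_assoc, ENNReal.ofReal_mul ENNReal.toReal_nonneg, ENNReal.ofReal_toReal hsum,
    Finset.sum_mul]
  refine Finset.sum_le_sum fun t _ => ?_
  rw [mul_assoc, quadWeight, ← ENNReal.ofReal_mul (by positivity)]
  exact mul_le_mul_right (ENNReal.ofReal_le_ofReal (h1 t)) _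

end Algorithms

end ParticleMCMC

end

theorem mainTheorem2 (D T N : ℕ) (hD : 1 ≤ D) (hT : 1 ≤ T) (hN : 1 ≤ N)
    (δ : Fin T → ℝ) (hδ : ∀ t, 0 < δ t) (κ : ℝ) (hκ : κ = 0 ∨ κ = 1)
    (m : Fin T → ParticleMCMC.St D)
    (C : ℕ → Fin T → Matrix (Fin D) (Fin D) ℝ) (hC : ∀ k t, (C k t).PosDef)
    (G : Fin T → ParticleMCMC.St D → ℝ)
    (hGpos : ∀ t x, 0 < G t x) (hGdiff : ∀ t, Differentiable ℝ (G t))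
    (hGbdd : ∀ t, ∃ B : ℝ, ∀ x, G t x ≤ B)
    (hGgrad : ∀ t, ∃ C₀ C₁ : ℝ, 0 ≤ C₀ ∧ 0 ≤ C₁ ∧
      ∀ x, κ * ‖gradient (fun y => Real.log (G t y)) x‖ ≤ C₀ + C₁ * ‖x‖)
    (hGmom : ∀ t d, Integrable (fun x : ParticleMCMC.St D => (x d) ^ 2 * G t x))
    (lam : ℕ → ℝ) (hlam_pos : ∀ k, 0 < lam k) (hlam : Tendsto lam atTop atTop)
    (hCeig : ∀ k t, ∀ μ ∈ spectrum ℝ (C k t), lam k ≤ μ)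
    (ε : ℝ) (hε : 0 < ε) :
    ∃ F : ℕ → Set (Fin T → ParticleMCMC.St D),
      (∀ k, MeasurableSet (F k)) ∧
      Tendsto (fun k => (ParticleMCMC.Model.factorised m (C k) G).target (F k)) atTop (𝓝 1) ∧
      (∃ B : ℝ, ∀ᶠ k in atTop,
        ⨆ x ∈ F k, ParticleMCMC.tvDist
          (ParticleMCMC.kernelMGRAD N (ParticleMCMC.Model.factorised m (C k) G) δ κ x)
          (ParticleMCMC.kernelMALA N (ParticleMCMC.Model.factorised m (C k) G) δ κ x)
        ≤ ENNReal.ofReal (B * lam k ^ (-(1 - ε) / 4))) ∧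
      (∃ B : ℝ, ∀ᶠ k in atTop,
        ⨆ x ∈ F k, ParticleMCMC.tvDist
          (ParticleMCMC.kernelAGRAD N (ParticleMCMC.Model.factorised m (C k) G) δ κ x)
          (ParticleMCMC.kernelAMALA N (ParticleMCMC.Model.factorised m (C k) G) δ κ x)
        ≤ ENNReal.ofReal (B * lam k ^ (-(1 - ε) / 4))) := by
  have hκ0 : 0 ≤ κ := by rcases hκ with rfl | rfl <;> norm_num
  have hκ1 : κ ≤ 1 := by rcases hκ with rfl | rfl <;> norm_num
  have hco : ∀ k t, ∀ x : ParticleMCMC.St D,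
      lam k * ‖x‖ ^ 2 ≤ inner ℝ x (ParticleMCMC.act (C k t) x) := fun k t =>
    ParticleMCMC.le_inner_act_self_of_spectrum (hC k t).isHermitian (hCeig k t)
  have hB : ∀ t, ∃ B : ℝ≥0∞, B ≠ ∞ ∧ _ := fun t => by
    obtain ⟨C₀, C₁, hC₀, hC₁, hG⟩ := hGgrad t
    exact ParticleMCMC.exists_stepsClose_algorithms (m := m) N hδ hκ0 hκ1 hGpos hGdiff hC₀ hC₁ hG
  choose B hBfin hBclose using hB
  have hR : Tendsto (fun k => lam k ^ (1 / 8 : ℝ)) atTop atTop :=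
    (tendsto_rpow_atTop (by norm_num)).comp hlam
  refine ⟨fun k => {x | ∀ t, ‖x t‖ ≤ lam k ^ (1 / 8 : ℝ)}, fun k => ?_, ?_, ?_, ?_⟩
  · exact ParticleMCMC.measurableSet_balls _
  · refine ParticleMCMC.tendsto_target_balls hC hGpos (fun t => (hGdiff t).continuous)
      (fun t => ?_) hlam_pos hlam hR hco
    obtain ⟨b, hb⟩ := hGbdd t
    exact ParticleMCMC.integrable_of_second_moments (hGpos t) (hGdiff t).continuous hb (hGmom t)
  · refine ⟨(∑ t, B t).toReal * 2, ?_⟩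
    filter_upwards [hlam.eventually_ge_atTop 1] with k hk
    refine iSup₂_le fun x hx => ?_
    obtain ⟨_, h1, _, h2⟩ := ParticleMCMC.isProb_kernels N hN
      (ParticleMCMC.regular_factorised (m := m) (hC k) hGpos hGdiff hδ κ) x
    have hclose : ParticleMCMC.Close
        (ParticleMCMC.kernelMALA N (ParticleMCMC.Model.factorised m (C k) G) δ κ x)
        (ParticleMCMC.kernelMGRAD N (ParticleMCMC.Model.factorised m (C k) G) δ κ x) _ :=
      ParticleMCMC.close_kernel hN fun t =>
        (hBclose t (C k) (lam k) (hC k) hk (hco k t) (x t)).1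
    exact hclose.tvDist_le.trans (ParticleMCMC.sum_stepError_le B hBfin hk hε hx)
  · refine ⟨(∑ t, B t).toReal * 2, ?_⟩
    filter_upwards [hlam.eventually_ge_atTop 1] with k hk
    refine iSup₂_le fun x hx => ?_
    obtain ⟨h1, _, h2, _⟩ := ParticleMCMC.isProb_kernels N hN
      (ParticleMCMC.regular_factorised (m := m) (hC k) hGpos hGdiff hδ κ) x
    have hclose : ParticleMCMC.Close
        (ParticleMCMC.kernelAMALA N (ParticleMCMC.Model.factorised m (C k) G) δ κ x)
        (ParticleMCMC.kernelAGRAD N (ParticleMCMC.Model.factorised m (C k) G) δ κ x) _ :=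
      ParticleMCMC.close_kernel hN fun t =>
        (hBclose t (C k) (lam k) (hC k) hk (hco k t) (x t)).2
    exact hclose.tvDist_le.trans (ParticleMCMC.sum_stepError_le B hBfin hk hε hx)
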